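/- **Notation.** Let $a=\zeta(3)$. Let $k\ge 1$ and $0\le h<k$ with $\gcd(h,k)=1$ (so $h=0$ if $k=1$), and put $\omega_{h,k}=e^{2\pi i h/k}$. Let $B_p(x)$ be the Bernoulli polynomials, $\zeta(s,x)$ the Hurwitz zeta function, and $D=\mathrm d/\mathrm dn$. For $\mathrm{Re}\,z>0$ and $0<\epsilon<1$ put $$V_{h,k}(z)=v^{(1)}_{h,k}z+\int_{-1-\epsilon-i\infty}^{-1-\epsilon+i\infty}\frac{\mathrm ds}{2\pi i}\,(zk^2)^{-s}\,\Gamma(s)\sum_{d,d'=1}^k\omega_{h,k}^{dd'}\,\zeta(s-1,\tfrac{d'}k)\,\zeta(s+1,\tfrac dk),$$ which does not depend on $\epsilon$, where for $p\ge1$ $$v^{(p)}_{h,k}=\frac{(-k^2)^p}{p!\,p\,(p+2)}\sum_{d,d'=1}^k\omega_{h,k}^{dd'}\,B_{p+2}(\tfrac{d'}k)\,B_p(\tfrac dk).$$ Let $\widetilde V_{h,k}(z)=\sum_{m\ge1}v^{(m)}_{h,k}z^m$ as a formal power series, and define $b^{(m)}_{h,k}$ by the formal identity $\exp\widetilde V_{h,k}(z)=\sum_{m\ge0}b^{(m)}_{h,k}z^m$.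 Let $\mathcal C$ be a loop in the right half-plane that leaves $0$ along the ray $\arg z=-\pi/3$ and returns to $0$ along the ray $\arg z=\pi/3$; explicitly, the triangle $0\to 1-i\sqrt3\to 1+i\sqrt3\to 0$. Let $$\mathcal A(x|\gamma)=\frac1{2\pi i}\int_{\mathcal C}z^{-\gamma}e^{1/z^2+xz}\,\mathrm dz,\qquad A_k^{(m)}(n)=D^m\mathcal A\big((a k^{-3})^{1/2}n\,\big|\,{-\tfrac k{12}}\big),$$ $$C_{h,k}=\tfrac k2\sum_{j=1}^{k-1}B_2(\tfrac jk)\log\big|2\sin\tfrac{\pi jh}k\big| .$$ Finally let $$\phi_k(n)=\sum_h e^{-2\pi i nh/k}\,\frac1{2\pi i}\int_{\mathcal C}(zk)^{k/12}\exp\Big[k\zeta'(-1)+C_{h,k}+V_{h,k}(z)+\frac a{k^3z^2}+nz\Big]\mathrm dz,$$ $$\phi^{(m)}_k(n)=\sum_h k^{-1}\big(\tfrac ak\big)^{\frac12+\frac k{24}}e^{-2\pi i nh/k+k\zeta'(-1)+C_{h,k}}\;b^{(m)}_{h,k}\,A_k^{(m)}(n),$$ where both sums run over $0\le h<k$ with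 $\gcd(h,k)=1$. **Statement.** 1. *(Asymptotic.)* For all $h,k$ as above and every $M\ge0$ there is a least $N>M$ with $b^{(N)}_{h,k}\ne0$, and $$e^{V_{h,k}(z)}-\sum_{m=0}^Mb^{(m)}_{h,k}z^m=\mathcal O\big(b^{(N)}_{h,k}z^{N}\big)\qquad(z\to0)$$ in every sector $\{\mathrm{Re}\,z>0,\ |\mathrm{Im}\,z|\le\kappa\,\mathrm{Re}\,z\}$. In particular the error is $\mathcal O(b^{(M+1)}_{h,k}z^{M+1})$ whenever $b^{(M+1)}_{h,k}\neq0$, and it is $\mathcal O(z^{M+1})$ always. The implied constant may depend on $h,k,M,\kappa$. 2. *(Not convergent.)* For all $h,k$ as above, $\sum_m b^{(m)}_{h,k}z^m$ is not absolutely convergent for any complex $z\ne0$; hence its radius of convergence is $0$. 3. *(Factorial growth.)* There are absolute constants $c,C>0$ such that, for all $h,k$ as above and all sufficiently large $m$ (depending on $h,k$), $$|b^{(m)}_{h,k}|\le C\beta_m,\qquad\text{and}\qquad |b^{(m)}_{h,k}|\ge c\,\beta_m\ \text{ or }\ |b^{(m+1)}_{h,k}|\ge c\,\beta_{m+1},\qquad\text{where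 }\ \beta_m=\big(\tfrac k{2\pi}\big)^{2m+1}m!\,.$$ 4. *(Consequence for $\phi_k$.)* For every $k\ge1$ and $M\ge0$, as $n\to\infty$ through the integers, $$\phi_k(n)-\sum_{m=0}^M\phi^{(m)}_k(n)=\mathcal O\big(A_k^{(M+1)}(n)\big),\qquad A_k^{(M+1)}(n)=o\big(A_k^{(M)}(n)\big).$$ Moreover, for every $N>M$, as $n\to\infty$ through those $n$ for which $\phi_k^{(N)}(n)$ is the first non-vanishing term after $\phi_k^{(M)}(n)$ (that is, $\phi_k^{(j)}(n)=0$ for $M<j<N$ and $\phi_k^{(N)}(n)\ne0$), $$\phi_k(n)-\sum_{m=0}^M\phi^{(m)}_k(n)=\mathcal O\big(\phi_k^{(N)}(n)\big).$$ In particular the error is $\mathcal O(\phi_k^{(M+1)}(n))$ as $n\to\infty$ through the $n$ with $\phi_k^{(M+1)}(n)\ne0$. -/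

import Mathlib

open Filter Asymptotics
open scoped Topology

namespace PlanePartitions

noncomputable section

/-- The constant `a = ζ(3)`, as a real number. -/
def zetaThree : ℝ := (riemannZeta 3).re

/-- The primitive root of unity `ω_{h,k} = exp (2 π i h / k)`. -/
def omega (h k : ℕ) : ℂ := Complex.exp (2 * Real.pi * Complex.I * h / k)

/-- The integrand (without the factor `1 / (2 π i)`) of the Mellin-Barnes integral for
`log P₂ (e^{-z} ω_{h,k})`:
`(z k²)^{-s} Γ(s) ∑_{d,d'=1}^k ω_{h,k}^{d d'} ζ(s-1, d'/k) ζ(s+1, d/k)`,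
with Hurwitz zeta functions (at `d = k` this is `ζ(s, 1) = ζ(s)`). -/
def mellinIntegrand (h k : ℕ) (z s : ℂ) : ℂ :=
  (z * (k : ℂ) ^ 2) ^ (-s) * Complex.Gamma s *
    ∑ d ∈ Finset.Icc 1 k, ∑ d' ∈ Finset.Icc 1 k,
      omega h k ^ (d * d') *
        HurwitzZeta.hurwitzZeta (((d' : ℝ) / (k : ℝ) : ℝ) : UnitAddCircle) (s - 1) *
        HurwitzZeta.hurwitzZeta (((d : ℝ) / (k : ℝ) : ℝ) : UnitAddCircle) (s + 1)

/-- `L_{h,k}(z) = (1 / 2πi) ∫ (mellinIntegrand) ds` over the upward vertical line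
`Re s = -1 - ε`, here with `ε = 1/2` (the integrand has no pole with `-2 < Re s < -1`, so every
`0 < ε < 1` gives the same function on `Re z > 0`). On the line `s = -3/2 + i t`, `ds = i dt`. -/
def LFun (h k : ℕ) (z : ℂ) : ℂ :=
  1 / (2 * Real.pi) * ∫ t : ℝ, mellinIntegrand h k z (-(3 / 2) + t * Complex.I)

/-- The coefficient `v^{(p)}_{h,k}`, `p ≥ 1`: the residue of `mellinIntegrand` at `s = -p` is
`v^{(p)}_{h,k} z^p`, that is
`v^{(p)}_{h,k} = (-k²)^p / (p! p (p+2)) ∑_{d,d'=1}^k ω_{h,k}^{d d'} B_{p+2}(d'/k) B_p(d/k)`. -/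
def vCoeff (h k p : ℕ) : ℂ :=
  (-(k : ℂ) ^ 2) ^ p / ((p.factorial : ℂ) * p * (p + 2)) *
    ∑ d ∈ Finset.Icc 1 k, ∑ d' ∈ Finset.Icc 1 k,
      omega h k ^ (d * d') *
        ((bernoulliFun (p + 2) ((d' : ℝ) / k) * bernoulliFun p ((d : ℝ) / k) : ℝ) : ℂ)

/-- `V_{h,k}(z) = v^{(1)}_{h,k} z + L_{h,k}(z)`, for `Re z > 0`. -/
def VFun (h k : ℕ) (z : ℂ) : ℂ := vCoeff h k 1 * z + LFun h k z

/-- The formal power series `Ṽ_{h,k} = ∑_{m ≥ 1} v^{(m)}_{h,k} X^m`. -/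
def VSeries (h k : ℕ) : PowerSeries ℂ :=
  PowerSeries.mk fun m => if m = 0 then 0 else vCoeff h k m

/-- The coefficients `b^{(m)}_{h,k}` of the formal power series
`exp Ṽ_{h,k} = ∑_{m ≥ 0} b^{(m)}_{h,k} X^m`. -/
def bCoeff (h k m : ℕ) : ℂ :=
  PowerSeries.coeff m ((PowerSeries.exp ℂ).subst (VSeries h k))

/-- The closed sector `|Im z| ≤ κ Re z` (without its vertex) in the right half-plane. -/
def sector (κ : ℝ) : Set ℂ := {z | 0 < z.re ∧ |z.im| ≤ κ * z.re}

/-- `(1 / 2πi) ∫_𝒞 f(z) dz` over the loop `𝒞` that leaves `0` along the ray `arg z = -π/3` up to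
`1 - i√3`, goes up the vertical segment to `1 + i√3`, and returns to `0` along the ray
`arg z = π/3`. On both rays `exp (c / z²)`, `c > 0`, tends rapidly to `0` as `z → 0`; so, for the
integrands below, this is the value in the limit `ε → 0` of the contour in the right half-plane
that runs around the origin from near `-iε` to near `iε`. -/
def loopIntegral (f : ℂ → ℂ) : ℂ :=
  1 / (2 * Real.pi * Complex.I) *
    ((∫ t in (0 : ℝ)..1, f (t * (1 - √3 * Complex.I)) * (1 - √3 * Complex.I)) +
      (∫ y in (-√3 : ℝ)..√3, f (1 + y * Complex.I) * Complex.I) -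
      ∫ t in (0 : ℝ)..1, f (t * (1 + √3 * Complex.I)) * (1 + √3 * Complex.I))

/-- The Almkvist function
`𝒜(x | γ) = (1 / 2πi) ∫_𝒞 z^{-γ} exp (1 / z² + x z) dz`. -/
def almkvist (x γ : ℝ) : ℂ :=
  loopIntegral fun z => z ^ (-(γ : ℂ)) * Complex.exp (1 / z ^ 2 + x * z)

/-- The generalized Dedekind sum
`C_{h,k} = (k / 2) ∑_{j=1}^{k-1} B₂(j/k) log |2 sin (π j h / k)|`. -/
def dedekindC (h k : ℕ) : ℝ :=
  (k : ℝ) / 2 * ∑ j ∈ Finset.Ico 1 k,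
    bernoulliFun 2 ((j : ℝ) / k) * Real.log |2 * Real.sin (Real.pi * j * h / k)|

/-- `ψ_{h,k}(n)`, the contribution of the root of unity `ω_{h,k}` to the number of plane partitions
of `n`:
`ψ_{h,k}(n) = e^{-2πi n h / k} (1 / 2πi) ∫_𝒞 (z k)^{k/12}
    exp [k ζ'(-1) + C_{h,k} + V_{h,k}(z) + a / (k³ z²) + n z] dz`.
It is also written
`k⁻¹ (a/k)^{1/2 + k/24} e^{-2πi n h/k + k ζ'(-1) + C_{h,k} + V_{h,k}(D)} 𝒜((a/k³)^{1/2} n | -k/12)`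
with `D = d/dn`. -/
def psi (h k n : ℕ) : ℂ :=
  Complex.exp (-(2 * Real.pi * Complex.I * n * h / k)) *
    loopIntegral fun z =>
      (z * k) ^ ((k : ℂ) / 12) *
        Complex.exp (k * deriv riemannZeta (-1) + (dedekindC h k : ℂ) + VFun h k z
          + (zetaThree : ℂ) / ((k : ℂ) ^ 3 * z ^ 2) + n * z)

/-- `D^m 𝒜((a/k³)^{1/2} n | -k/12)`, where `D = d/dn`. -/
def almkvistDeriv (k m n : ℕ) : ℂ :=
  iteratedDeriv m (fun x : ℝ => almkvist (√(zetaThree / (k : ℝ) ^ 3) * x) (-(k : ℝ) / 12)) (n : ℝ)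

/-- The terms `ψ^{(m)}_{h,k}(n)` of the formal series for `ψ_{h,k}(n)` that arises from
`exp (Ṽ_{h,k}(D)) = ∑_m b^{(m)}_{h,k} D^m`. -/
def psiTerm (h k m n : ℕ) : ℂ :=
  (k : ℂ)⁻¹ * (((zetaThree / k) ^ ((1 : ℝ) / 2 + k / 24) : ℝ) : ℂ) *
    Complex.exp (-(2 * Real.pi * Complex.I * n * h / k) + k * deriv riemannZeta (-1)
      + (dedekindC h k : ℂ)) *
    (bCoeff h k m * almkvistDeriv k m n)

/-- The residues `0 ≤ h < k` coprime to `k` (for `k = 1` this is `h = 0`). -/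
def coprimeResidues (k : ℕ) : Finset ℕ := (Finset.range k).filter fun h => Nat.Coprime h k

/-- `φ_k(n) = ∑_h ψ_{h,k}(n)`. -/
def phi (k n : ℕ) : ℂ := ∑ h ∈ coprimeResidues k, psi h k n

/-- `φ_k^{(m)}(n) = ∑_h ψ^{(m)}_{h,k}(n)`. -/
def phiTerm (k m n : ℕ) : ℂ := ∑ h ∈ coprimeResidues k, psiTerm h k m n

end

end PlanePartitions

open PlanePartitions

/-! ### Exponential decay of the Gamma function on vertical lines -/

/-! Expansion of `V`. Hurwitz's formula writes the two zeta factors of the Mellin-Barnes integrand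
through `Γ(2-s)` and `Γ(-s)`, each at a cost of `e^{π|Im s|/2}`. Since `Γ(2-s) = (1-s) Γ(1-s)`, the
reflection formula for `Γ(s) Γ(1-s)` gains `e^{-π|Im s|}` and pays both costs. What remains is a
polynomial times `Γ(-s)`, which decays almost like `e^{-π|Im s|/2}` and so beats the growth `e^{|arg
z| |Im s|}` of `z^{-s}` in every proper sector of the half-plane. Hence the line can be moved left
over the simple poles of `Γ`. The pole at `-p` contributes `v^{(p)} z^p`, and the integral over `Re
s = -(p+1/2)` is `O(|z|^{p+1/2})` (`VFun_eq_sum_add`, `exists_norm_mellinLine_le`). Exponentiation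
gives the asymptotic series (`exp_VFun_sub_sum_isBigO_pow`).

Growth. Up to an error exponentially small in `p`, a normalized Bernoulli polynomial is its first
pair of Fourier modes. So `v^{(p)}` is governed by a finite exponential sum with main term `2k (w⁻¹
+ (-1)^p w)`, `|w| = 1`, which cannot be small for two consecutive `p`. In the recurrence coming
from `(exp V)' = V' exp V` the single term `v^{(m)}` dominates, because products of lower factorials
are smaller by a factor of order `m`; thus `b^{(m)}` inherits the size of `v^{(m)}`
(`exists_forall_norm_sub_le`, `bCoeff_bounds`). Divergence follows.

Consequence for `φ_k`. By linearity, `ψ` minus a partial sum of its series is a single loop integral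
whose amplitude is the remainder of `e^V`. Rescaling the loop by `R = (2c/n)^{1/3}`, `c = a/k³`,
turns the phase into `λ (1/z² + 2z)` with `λ = c/R² → ∞` and saddle point `1`. Laplace's method
shows that an amplitude `O(z^m)` gives at most `R^m` times a common scale
(`almkvistIntegral_isBigO`), and that `z^m` itself attains this order (`saddleScale_isBigO`).
Finally `φ_k^{(m)}(n)` is the derivative of the Almkvist function times a factor periodic in `n`,
whose finitely many nonzero values are bounded away from `0`. -/

theorem norm_Gamma_le_add_mul {s : ℂ} {u : ℝ} (hs : 0 < s.re) (hu : 0 < u) :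
    ‖Complex.Gamma s‖ ≤
      ‖Complex.Gamma (s + u)‖ * (Real.Gamma s.re / Real.Gamma (s.re + u)) := by
  -- The beta integral is at most its value at the real part of `s`. This carries a bound for `Γ` on
  -- one vertical line to the points left of it, at the cost of a factor depending only on `s.re`
  -- and `u`.
  have key := Complex.Gamma_mul_Gamma_eq_betaIntegral (s := s) (t := (u : ℂ)) hs (by simpa using hu)
  have hB : ‖Complex.betaIntegral s u‖ ≤
      Real.Gamma s.re * Real.Gamma u / Real.Gamma (s.re + u) := by
    set g : ℝ → ℂ := fun x => (x : ℂ) ^ (s - 1) * (1 - (x : ℂ)) ^ ((u : ℂ) - 1)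
    have h1 : ‖Complex.betaIntegral s u‖ ≤ ∫ x in (0 : ℝ)..1, ‖g x‖ :=
      intervalIntegral.norm_integral_le_integral_norm zero_le_one
    have h2 : Complex.betaIntegral (s.re : ℂ) u = ((∫ x in (0 : ℝ)..1, ‖g x‖ : ℝ) : ℂ) := by
      rw [← intervalIntegral.integral_ofReal, Complex.betaIntegral]
      rw [intervalIntegral.integral_of_le zero_le_one, intervalIntegral.integral_of_le zero_le_one,
        MeasureTheory.integral_Ioc_eq_integral_Ioo, MeasureTheory.integral_Ioc_eq_integral_Ioo]
      refine MeasureTheory.setIntegral_congr_fun measurableSet_Ioo fun x hx => ?_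
      have hx1 : (0 : ℝ) < 1 - x := by linarith [hx.2]
      have e : (1 - (x : ℂ)) = ((1 - x : ℝ) : ℂ) := by push_cast; rfl
      simp only [g]
      rw [norm_mul, e, Complex.norm_cpow_eq_rpow_re_of_pos hx.1,
        Complex.norm_cpow_eq_rpow_re_of_pos hx1]
      simp only [Complex.sub_re, Complex.one_re, Complex.ofReal_re]
      push_cast [Complex.ofReal_cpow hx.1.le, Complex.ofReal_cpow hx1.le]
      rfl
    rw [Complex.betaIntegral_eq_Gamma_mul_div _ _ (by simpa using hs) (by simpa using hu),
      ← Complex.ofReal_add, Complex.Gamma_ofReal, Complex.Gamma_ofReal, Complex.Gamma_ofReal] at h2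
    have h3 : Real.Gamma s.re * Real.Gamma u / Real.Gamma (s.re + u)
      = ∫ x in (0 : ℝ)..1, ‖g x‖ := by exact_mod_cast h2
    rw [h3]; exact h1
  have hGu : 0 < Real.Gamma u := Real.Gamma_pos_of_pos hu
  have h4 : ‖Complex.Gamma s‖ * Real.Gamma u
      = ‖Complex.Gamma (s + u)‖ * ‖Complex.betaIntegral s u‖ := by
    rw [← norm_mul, ← key, norm_mul, Complex.Gamma_ofReal, Complex.norm_real,
      Real.norm_of_nonneg hGu.le]
  have h5 : ‖Complex.Gamma s‖ * Real.Gamma u ≤ ‖Complex.Gamma (s + u)‖ *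
      (Real.Gamma s.re / Real.Gamma (s.re + u)) * Real.Gamma u := by
    rw [h4]
    calc _ ≤ ‖Complex.Gamma (s + u)‖ *
        (Real.Gamma s.re * Real.Gamma u / Real.Gamma (s.re + u)) := by gcongr
      _ = _ := by ring
  exact le_of_mul_le_mul_right h5 hGu

/-- On the critical line `1 - s` is the conjugate of `s`, so the reflection formula reads `|Γ(s)|² =
π / cosh (π t)`, and `2π ≤ 9`. -/
theorem norm_Gamma_half_le (t : ℝ) :
    ‖Complex.Gamma (1 / 2 + t * Complex.I)‖ ≤ 3 * Real.exp (-(Real.pi / 2 * |t|)) := by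
  set s : ℂ := 1 / 2 + t * Complex.I
  have hconj : 1 - s = (starRingEnd ℂ) s := by
    apply Complex.ext <;> simp [s]; norm_num
  have h1 := Complex.Gamma_mul_Gamma_one_sub s
  rw [hconj, Complex.Gamma_conj, Complex.mul_conj] at h1
  have hsin : Complex.sin (Real.pi * s) = (Real.cosh (Real.pi * t) : ℂ) := by
    rw [show (Real.pi : ℂ) * s = (Real.pi * t : ℝ) * Complex.I + Real.pi / 2 by
      simp only [s]; push_cast; ring, Complex.sin_add_pi_div_two, Complex.cos_mul_I]
    push_cast; rfl
  rw [hsin] at h1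
  have h2 : Complex.normSq (Complex.Gamma s) = Real.pi / Real.cosh (Real.pi * t) := by
    exact_mod_cast h1
  have h3 : Real.exp (Real.pi * |t|) / 2 ≤ Real.cosh (Real.pi * t) := by
    rw [← Real.cosh_abs, abs_mul, abs_of_pos Real.pi_pos, Real.cosh_eq]
    have := Real.exp_pos (-(Real.pi * |t|))
    linarith
  have h4 : ‖Complex.Gamma s‖ ^ 2 ≤ (3 * Real.exp (-(Real.pi / 2 * |t|))) ^ 2 := by
    rw [← Complex.normSq_eq_norm_sq, h2, mul_pow, ← Real.exp_nat_mul]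
    rw [div_le_iff₀ (Real.cosh_pos _)]
    have e : ((2 : ℕ) : ℝ) * -(Real.pi / 2 * |t|) = -(Real.pi * |t|) := by push_cast; ring
    rw [e]
    have : Real.exp (-(Real.pi * |t|)) * Real.exp (Real.pi * |t|) = 1 := by
      rw [← Real.exp_add]; simp
    have h0 := Real.exp_pos (-(Real.pi * |t|))
    nlinarith [Real.pi_le_four, mul_le_mul_of_nonneg_left h3 h0.le]
  exact (sq_le_sq₀ (norm_nonneg _) (by positivity)).1 h4

theorem norm_Gamma_nat_add_half_le (n : ℕ) (t : ℝ) :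
    ‖Complex.Gamma (n + 1 / 2 + t * Complex.I)‖ ≤
      3 * (n + 1 + |t|) ^ n * Real.exp (-(Real.pi / 2 * |t|)) := by
  induction n with
  | zero => simpa using norm_Gamma_half_le t
  | succ n ih =>
    set s : ℂ := n + 1 / 2 + t * Complex.I
    have hs : s ≠ 0 := fun h => by
      have := congrArg Complex.re h
      simp [s] at this
      have h2 : (0 : ℝ) ≤ n := n.cast_nonneg
      linarith
    have e : ((n + 1 : ℕ) : ℂ) + 1 / 2 + t * Complex.I = s + 1 := by
      simp only [s]; push_cast; ring
    have hn : ‖s‖ ≤ n + 1 + |t| := by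
      calc ‖s‖ ≤ ‖(n : ℂ)‖ + ‖(1 / 2 : ℂ)‖ + ‖t * Complex.I‖ := norm_add₃_le
        _ ≤ _ := by
          simp only [Complex.norm_natCast, norm_mul, Complex.norm_I, Complex.norm_real,
            Real.norm_eq_abs]
          norm_num
    rw [e, Complex.Gamma_add_one s hs, norm_mul]
    push_cast
    calc ‖s‖ * ‖Complex.Gamma s‖ ≤ (n + 1 + |t|) *
          (3 * (n + 1 + |t|) ^ n * Real.exp (-(Real.pi / 2 * |t|))) := by gcongr
      _ = 3 * (n + 1 + |t|) ^ (n + 1) * Real.exp (-(Real.pi / 2 * |t|)) := by ring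
      _ ≤ 3 * (n + 1 + 1 + |t|) ^ (n + 1) * Real.exp (-(Real.pi / 2 * |t|)) := by
        gcongr; linarith

theorem exists_pow_le_mul_exp (a : ℝ) (ha : 0 ≤ a) (n : ℕ) {δ : ℝ} (hδ : 0 < δ) :
    ∃ C : ℝ, 0 < C ∧ ∀ x : ℝ, 0 ≤ x → (a + x) ^ n ≤ C * Real.exp (δ * x) := by
  refine ⟨n.factorial * Real.exp (δ * a) / δ ^ n, by positivity, fun x hx => ?_⟩
  have h := Real.pow_div_factorial_le_exp (δ * (a + x)) (by positivity) n
  rw [div_le_iff₀ (by positivity), mul_pow, mul_add, Real.exp_add] at h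
  rw [div_mul_eq_mul_div, le_div_iff₀ (by positivity)]
  linarith

/-- In a vertical strip the Gamma function decays faster than `exp (-θ |t|)` for `θ < π / 2`. -/
theorem exists_norm_Gamma_le (P : ℕ) {θ : ℝ} (hθ : θ < Real.pi / 2) :
    ∃ C : ℝ, 0 < C ∧ ∀ s : ℂ, 3 / 2 ≤ s.re → s.re < P + 1 / 2 →
      ‖Complex.Gamma s‖ ≤ C * Real.exp (-(θ * |s.im|)) := by
  obtain ⟨C₁, hC₁, h₁⟩ := exists_pow_le_mul_exp (P + 1) (by positivity) P (sub_pos.2 hθ)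
  have hcont : ContinuousOn (fun x : ℝ => Real.Gamma x / Real.Gamma (P + 1 / 2))
      (Set.Icc (3 / 2) (P + 1 / 2)) := by
    refine ContinuousOn.div_const (fun x hx => ?_) _
    refine (Real.differentiableAt_Gamma fun m h => ?_).continuousAt.continuousWithinAt
    have : (0 : ℝ) ≤ m := m.cast_nonneg
    linarith [hx.1]
  obtain ⟨C₂, h₂⟩ := isCompact_Icc.exists_bound_of_continuousOn hcont
  refine ⟨3 * C₁ * (|C₂| + 1), by positivity, fun s hs hs' => ?_⟩
  have hu : 0 < (P + 1 / 2 : ℝ) - s.re := by linarith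
  have h3 := norm_Gamma_le_add_mul (s := s) (by linarith) hu
  have e : s + ((P + 1 / 2 - s.re : ℝ) : ℂ) = P + 1 / 2 + s.im * Complex.I := by
    apply Complex.ext <;> simp
  rw [e, add_sub_cancel] at h3
  have h4 : Real.Gamma s.re / Real.Gamma (P + 1 / 2) ≤ |C₂| + 1 := by
    have := (le_abs_self _).trans (h₂ s.re ⟨hs, hs'.le⟩)
    linarith [le_abs_self C₂]
  calc _ ≤ _ := h3
    _ ≤ (3 * (P + 1 + |s.im|) ^ P * Real.exp (-(Real.pi / 2 * |s.im|))) * (|C₂| + 1) := by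
      have := norm_Gamma_nat_add_half_le P s.im
      gcongr
    _ ≤ (3 * (C₁ * Real.exp ((Real.pi / 2 - θ) * |s.im|)) * Real.exp (-(Real.pi / 2 * |s.im|)))
        * (|C₂| + 1) := by
      have := h₁ |s.im| (abs_nonneg _)
      gcongr
    _ = 3 * C₁ * (|C₂| + 1) *
        (Real.exp ((Real.pi / 2 - θ) * |s.im|) * Real.exp (-(Real.pi / 2 * |s.im|))) := by ring
    _ = _ := by rw [← Real.exp_add]; ring_nf

/-! ### Bounds for the Mellin-Barnes integrand -/

theorem exists_norm_expZeta_le :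
    ∃ C : ℝ, 0 < C ∧ ∀ (a : UnitAddCircle) (w : ℂ), 3 / 2 ≤ w.re →
      ‖HurwitzZeta.expZeta a w‖ ≤ C := by
  have hs : Summable fun n : ℕ => 1 / (n : ℝ) ^ (3 / 2 : ℝ) :=
    Real.summable_one_div_nat_rpow.2 (by norm_num)
  refine ⟨(∑' n : ℕ, 1 / (n : ℝ) ^ (3 / 2 : ℝ)) + 1, ?_, fun a w hw => ?_⟩
  · have : 0 ≤ ∑' n : ℕ, 1 / (n : ℝ) ^ (3 / 2 : ℝ) := tsum_nonneg fun n => by positivity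
    linarith
  · obtain ⟨x, rfl⟩ := QuotientAddGroup.mk_surjective a
    have h := HurwitzZeta.hasSum_expZeta_of_one_lt_re x (s := w) (by linarith)
    refine le_trans ?_ (lt_add_one _).le
    refine h.norm_le_of_bounded hs.hasSum fun n => ?_
    -- The series is indexed from `0`; its term there vanishes because `0 ^ w = 0` and division by
    -- zero gives `0`.
    rcases Nat.eq_zero_or_pos n with rfl | hn
    · rw [Nat.cast_zero, Complex.zero_cpow (by intro h0; rw [h0] at hw; norm_num at hw)]
      simp
    · have e : (2 * Real.pi * Complex.I * x * n : ℂ) = (2 * Real.pi * x * n : ℝ) * Complex.I := by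
        push_cast; ring
      rw [norm_div, e, Complex.norm_exp_ofReal_mul_I, Complex.norm_natCast_cpow_of_pos hn]
      have : (1 : ℝ) ≤ n := by exact_mod_cast hn
      gcongr

/-- Hurwitz's formula: the periodic zeta values are bounded by their Dirichlet series, and the
exponential comes from the factors `exp (∓π i w / 2)`. -/
theorem exists_norm_hurwitzZeta_one_sub_le :
    ∃ C : ℝ, 0 < C ∧ ∀ (a : UnitAddCircle) (w : ℂ), 3 / 2 ≤ w.re →
      ‖HurwitzZeta.hurwitzZeta a (1 - w)‖ ≤
        C * ‖Complex.Gamma w‖ * Real.exp (Real.pi / 2 * |w.im|) := by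
  obtain ⟨C, hC, hexp⟩ := exists_norm_expZeta_le
  refine ⟨2 * C, by positivity, fun a w hw => ?_⟩
  rw [HurwitzZeta.hurwitzZeta_one_sub a (s := w)
    (fun n h => by
      rw [h] at hw
      have : (0 : ℝ) ≤ n := n.cast_nonneg
      simp at hw; linarith)
    (Or.inr fun h => by rw [h] at hw; norm_num at hw)]
  have h1 : ‖(2 * Real.pi : ℂ) ^ (-w)‖ ≤ 1 := by
    have e : (2 * Real.pi : ℂ) = ((2 * Real.pi : ℝ) : ℂ) := by push_cast; rfl
    rw [e, Complex.norm_cpow_eq_rpow_re_of_pos Real.two_pi_pos]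
    refine Real.rpow_le_one_of_one_le_of_nonpos (by linarith [Real.pi_gt_three]) ?_
    simp only [Complex.neg_re]; linarith
  have h2 : ‖Complex.exp (-Real.pi * Complex.I * w / 2)‖ ≤ Real.exp (Real.pi / 2 * |w.im|) := by
    rw [Complex.norm_exp]
    gcongr
    have : (-Real.pi * Complex.I * w / 2 : ℂ).re = Real.pi / 2 * w.im := by
      rw [show (-Real.pi * Complex.I * w / 2 : ℂ) = ((Real.pi / 2 : ℝ) : ℂ) * (-Complex.I * w) by
        push_cast; ring, Complex.re_ofReal_mul]
      simp
    rw [this]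
    exact mul_le_mul_of_nonneg_left (le_abs_self _) (by positivity)
  have h3 : ‖Complex.exp (Real.pi * Complex.I * w / 2)‖ ≤ Real.exp (Real.pi / 2 * |w.im|) := by
    rw [Complex.norm_exp]
    gcongr
    have : (Real.pi * Complex.I * w / 2 : ℂ).re = Real.pi / 2 * (-w.im) := by
      rw [show (Real.pi * Complex.I * w / 2 : ℂ) = ((Real.pi / 2 : ℝ) : ℂ) * (Complex.I * w) by
        push_cast; ring, Complex.re_ofReal_mul]
      simp
    rw [this]
    exact mul_le_mul_of_nonneg_left (neg_le_abs _) (by positivity)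
  rw [norm_mul, norm_mul]
  calc _ ≤ 1 * ‖Complex.Gamma w‖ * (Real.exp (Real.pi / 2 * |w.im|) * C +
        Real.exp (Real.pi / 2 * |w.im|) * C) := by
        gcongr
        refine (norm_add_le _ _).trans ?_
        rw [norm_mul, norm_mul]
        gcongr <;> exact hexp _ _ hw
    _ = _ := by ring

/-- This and the next lemma supply the two regions where the reflection formula yields its full
gain: away from the real axis, for the horizontal sides of the contour, and on vertical lines midway
between the poles of `Γ`. -/
theorem exp_abs_im_le_norm_sin {w : ℂ} (hw : 1 ≤ |w.im|) :
    Real.exp |w.im| / 4 ≤ ‖Complex.sin w‖ := by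
  have h1 : ‖Complex.exp (-w * Complex.I)‖ = Real.exp w.im := by
    rw [Complex.norm_exp]; simp
  have h2 : ‖Complex.exp (w * Complex.I)‖ = Real.exp (-w.im) := by
    rw [Complex.norm_exp]; simp
  have h3 : ‖Complex.sin w‖
      = ‖Complex.exp (-w * Complex.I) - Complex.exp (w * Complex.I)‖ / 2 := by
    rw [Complex.sin, norm_div, norm_mul, Complex.norm_I]; simp
  have h4 : |Real.exp w.im - Real.exp (-w.im)| ≤
      ‖Complex.exp (-w * Complex.I) - Complex.exp (w * Complex.I)‖ := by
    rw [← h1, ← h2]; exact abs_norm_sub_norm_le _ _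
  have h5 : Real.exp |w.im| - Real.exp (-|w.im|) ≤ |Real.exp w.im - Real.exp (-w.im)| := by
    rcases abs_cases w.im with ⟨e, _⟩ | ⟨e, _⟩
    · rw [e]; exact le_abs_self _
    · rw [e, neg_neg, abs_sub_comm]; exact le_abs_self _
  have h6 : Real.exp (-|w.im|) ≤ 1 := Real.exp_le_one_iff.2 (by simp)
  have h7 : 2 ≤ Real.exp |w.im| := by
    have := Real.add_one_le_exp |w.im|; linarith
  rw [h3]; linarith

theorem exp_abs_le_norm_sin_half_line (p : ℕ) (t : ℝ) :
    Real.exp (Real.pi * |t|) / 4 ≤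
      ‖Complex.sin (Real.pi * (-(p + 1 / 2) + t * Complex.I))‖ := by
  have e : Real.pi * (-(p + 1 / 2) + t * Complex.I)
      = (Real.pi * t * Complex.I - Real.pi / 2) - p * Real.pi := by ring
  rw [e, Complex.sin_antiperiodic.sub_nat_mul_eq, norm_mul, norm_pow, norm_neg, norm_one, one_pow, one_mul,
    Complex.sin_sub_pi_div_two, norm_neg, Complex.cos_mul_I, ← Complex.ofReal_mul,
    ← Complex.ofReal_cosh, Complex.norm_real, Real.norm_of_nonneg (Real.cosh_pos _).le,
    ← Real.cosh_abs, abs_mul, abs_of_pos Real.pi_pos, Real.cosh_eq]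
  have h1 := Real.exp_pos (-(Real.pi * |t|))
  have h2 := Real.exp_pos (Real.pi * |t|)
  linarith

theorem abs_arg_le_of_mem_sector {κ : ℝ} {z : ℂ} (hz : z ∈ sector κ) :
    |z.arg| ≤ Real.arctan κ := by
  obtain ⟨h0, h1⟩ := hz
  have h2 : |z.arg| < Real.pi / 2 := Complex.abs_arg_lt_pi_div_two_iff.2 (Or.inl h0)
  have h3 : |z.arg| = Real.arctan |z.im / z.re| := by
    rw [← Complex.tan_arg]
    rcases abs_cases z.arg with ⟨e, h⟩ | ⟨e, h⟩
    · rw [e] at h2 ⊢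
      rw [abs_of_nonneg (Real.tan_nonneg_of_nonneg_of_le_pi_div_two h h2.le),
        Real.arctan_tan (by linarith) h2]
    · rw [e] at h2 ⊢
      rw [abs_of_nonpos (Real.tan_nonpos_of_nonpos_of_neg_pi_div_two_le h.le (by linarith)),
        ← Real.tan_neg, Real.arctan_tan (by linarith) h2]
  rw [h3]
  refine Real.arctan_mono ?_
  rw [abs_div, abs_of_pos h0, div_le_iff₀ h0]
  exact h1

theorem norm_omega (h k : ℕ) : ‖omega h k‖ = 1 := by
  rw [omega, show (2 * Real.pi * Complex.I * h / k : ℂ) = (2 * Real.pi * h / k : ℝ) * Complex.I by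
    push_cast; ring, Complex.norm_exp_ofReal_mul_I]

theorem sector_ne_zero {κ : ℝ} {z : ℂ} (hz : z ∈ sector κ) : z ≠ 0 := fun h => by
  have := hz.1; simp [h] at this

/-- Away from the poles, the integrand decays exponentially on vertical lines, uniformly in the
strip `-P - 1 / 2 < Re s ≤ -3 / 2` and in a sector of the right half-plane. -/
theorem exists_norm_mellinIntegrand_le (h k P : ℕ) (hk : 0 < k) (κ : ℝ) :
    ∃ C δ : ℝ, 0 < C ∧ 0 < δ ∧ ∀ z ∈ sector κ, ∀ s : ℂ, s.re ≤ -(3 / 2) → -(P + 1 / 2) < s.re →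
      Real.exp (Real.pi * |s.im|) / 4 ≤ ‖Complex.sin (Real.pi * s)‖ →
      ‖mellinIntegrand h k z s‖ ≤ C * ‖z‖ ^ (-s.re) * Real.exp (-(δ * |s.im|)) := by
  obtain ⟨C₁, hC₁, hzeta⟩ := exists_norm_hurwitzZeta_one_sub_le
  set α := Real.arctan κ
  -- The gap between `π/2` and the opening angle is split in three: one `δ` is lost in the Gamma
  -- bound, one absorbs the polynomial factor `1 - s`, and one survives as the decay rate.
  set δ := (Real.pi / 2 - α) / 3 with hδdef
  have hδ : 0 < δ := div_pos (sub_pos.2 (Real.arctan_lt_pi_div_two κ)) (by norm_num)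
  obtain ⟨C₂, hC₂, hΓ⟩ := exists_norm_Gamma_le P (θ := Real.pi / 2 - δ) (by linarith)
  obtain ⟨C₃, hC₃, hpow⟩ := exists_pow_le_mul_exp (P + 2) (by positivity) 1 hδ
  refine ⟨(k : ℝ) ^ (2 * P + 1) * k ^ 2 * (C₁ ^ 2 * (4 * Real.pi) * C₃ * C₂), δ, by positivity, hδ,
    fun z hz s hs hs' hsin => ?_⟩
  set t := s.im
  set E := Real.exp (Real.pi * |t|) with hE
  have hE0 : 0 < E := Real.exp_pos _
  have hk1 : (1 : ℝ) ≤ k := by exact_mod_cast hk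
  have hz0 : z ≠ 0 := sector_ne_zero hz
  have hcpow : ‖(z * (k : ℂ) ^ 2) ^ (-s)‖ ≤
      ‖z‖ ^ (-s.re) * (k : ℝ) ^ (2 * P + 1) * Real.exp (α * |t|) := by
    rw [Complex.norm_cpow_of_ne_zero (by simp [hz0, hk.ne']), norm_mul, norm_pow,
      Complex.norm_natCast, Complex.neg_re, Complex.neg_im, div_eq_mul_inv, ← Real.exp_neg,
      Real.mul_rpow (norm_nonneg _) (by positivity)]
    have e1 : (z * (k : ℂ) ^ 2).arg = z.arg := by
      rw [show ((k : ℂ) ^ 2) = ((k ^ 2 : ℝ) : ℂ) by push_cast; rfl,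
        Complex.arg_mul_real (by positivity)]
    rw [e1]
    gcongr ‖z‖ ^ (-s.re) * ?_ * Real.exp ?_
    · rw [← Real.rpow_natCast, ← Real.rpow_mul (by positivity), ← Real.rpow_natCast (n := 2 * P + 1)]
      refine Real.rpow_le_rpow_of_exponent_le hk1 ?_
      push_cast; linarith
    · calc -(z.arg * -s.im) ≤ |z.arg * t| := by
            rw [mul_neg, neg_neg]; exact le_abs_self _
        _ = |z.arg| * |t| := abs_mul _ _
        _ ≤ α * |t| := by
          have := abs_arg_le_of_mem_sector hz
          gcongr
  have hprod (a b : UnitAddCircle) : ‖Complex.Gamma s‖ *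
      (‖HurwitzZeta.hurwitzZeta a (s - 1)‖ * ‖HurwitzZeta.hurwitzZeta b (s + 1)‖) ≤
        C₁ ^ 2 * (4 * Real.pi) * C₃ * C₂ * Real.exp (-((Real.pi / 2 - 2 * δ) * |t|)) := by
    have ha := hzeta a (2 - s) (by simp; linarith)
    have hb := hzeta b (-s) (by simp; linarith)
    rw [show 1 - (2 - s) = s - 1 by ring] at ha
    rw [show 1 - -s = s + 1 by ring] at hb
    have i1 : |(2 - s).im| = |t| := by simp [t]
    have i2 : |(-s).im| = |t| := by simp [t]
    rw [i1] at ha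
    rw [i2] at hb
    -- Lowering the argument by one creates the factor that pairs with `Γ(s)` under reflection.
    have hg : Complex.Gamma (2 - s) = (1 - s) * Complex.Gamma (1 - s) := by
      rw [show 2 - s = (1 - s) + 1 by ring, Complex.Gamma_add_one]
      intro h0
      have := congrArg Complex.re h0
      simp at this; linarith
    have hrefl : ‖Complex.Gamma s‖ * ‖Complex.Gamma (1 - s)‖ ≤ 4 * Real.pi / E := by
      rw [← norm_mul, Complex.Gamma_mul_Gamma_one_sub, norm_div, Complex.norm_real,
        Real.norm_of_nonneg Real.pi_pos.le]
      rw [div_le_div_iff₀ (lt_of_lt_of_le (by positivity) hsin) hE0]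
      nlinarith [Real.pi_pos]
    have hG2 := hΓ (-s) (by simp; linarith) (by simp; linarith)
    rw [i2] at hG2
    have hs1 : ‖1 - s‖ ≤ C₃ * Real.exp (δ * |t|) := by
      refine le_trans ?_ (hpow |t| (abs_nonneg _))
      rw [pow_one]
      calc ‖1 - s‖ ≤ ‖(1 : ℂ)‖ + ‖s‖ := norm_sub_le _ _
        _ ≤ 1 + (|s.re| + |s.im|) := by
          rw [norm_one]; gcongr; exact Complex.norm_le_abs_re_add_abs_im s
        _ ≤ _ := by
          rw [abs_of_nonpos (by linarith : s.re ≤ 0)]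
          simp only [t]; linarith
    have hEE : Real.exp (Real.pi / 2 * |t|) * Real.exp (Real.pi / 2 * |t|) = E := by
      rw [hE, ← Real.exp_add]; ring_nf
    calc _ ≤ ‖Complex.Gamma s‖ *
          ((C₁ * ‖Complex.Gamma (2 - s)‖ * Real.exp (Real.pi / 2 * |t|)) *
            (C₁ * ‖Complex.Gamma (-s)‖ * Real.exp (Real.pi / 2 * |t|))) := by gcongr
      _ = C₁ ^ 2 * (‖Complex.Gamma s‖ * ‖Complex.Gamma (1 - s)‖) * ‖1 - s‖ *
            ‖Complex.Gamma (-s)‖ * E := by rw [hg, norm_mul, ← hEE]; ring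
      _ ≤ C₁ ^ 2 * (4 * Real.pi / E) * (C₃ * Real.exp (δ * |t|)) *
            (C₂ * Real.exp (-((Real.pi / 2 - δ) * |t|))) * E := by gcongr
      _ = C₁ ^ 2 * (4 * Real.pi) * C₃ * C₂ *
            (Real.exp (δ * |t|) * Real.exp (-((Real.pi / 2 - δ) * |t|))) := by
          field_simp
      _ = _ := by rw [← Real.exp_add]; ring_nf
  set K := C₁ ^ 2 * (4 * Real.pi) * C₃ * C₂
  have hsum : ‖Complex.Gamma s * ∑ d ∈ Finset.Icc 1 k, ∑ d' ∈ Finset.Icc 1 k,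
      omega h k ^ (d * d') *
        HurwitzZeta.hurwitzZeta (((d' : ℝ) / (k : ℝ) : ℝ) : UnitAddCircle) (s - 1) *
        HurwitzZeta.hurwitzZeta (((d : ℝ) / (k : ℝ) : ℝ) : UnitAddCircle) (s + 1)‖ ≤
      k ^ 2 * (K * Real.exp (-((Real.pi / 2 - 2 * δ) * |t|))) := by
    rw [Finset.mul_sum]
    have : (k : ℝ) ^ 2 * (K * Real.exp (-((Real.pi / 2 - 2 * δ) * |t|))) =
        ∑ d ∈ Finset.Icc 1 k, ∑ d' ∈ Finset.Icc 1 k,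
          (K * Real.exp (-((Real.pi / 2 - 2 * δ) * |t|))) := by
      simp; ring
    rw [this]
    refine norm_sum_le_of_le _ fun d _ => ?_
    rw [Finset.mul_sum]
    refine norm_sum_le_of_le _ fun d' _ => ?_
    rw [norm_mul, norm_mul, norm_mul, norm_pow, norm_omega, one_pow, one_mul]
    exact hprod _ _
  rw [mellinIntegrand, mul_assoc, norm_mul]
  calc _ ≤ (‖z‖ ^ (-s.re) * (k : ℝ) ^ (2 * P + 1) * Real.exp (α * |t|)) *
        (k ^ 2 * (K * Real.exp (-((Real.pi / 2 - 2 * δ) * |t|)))) := by gcongr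
    _ = (k : ℝ) ^ (2 * P + 1) * k ^ 2 * K * ‖z‖ ^ (-s.re) *
        (Real.exp (α * |t|) * Real.exp (-((Real.pi / 2 - 2 * δ) * |t|))) := by ring
    _ = _ := by
      rw [← Real.exp_add]
      congr 2
      have : Real.pi / 2 = 3 * δ + α := by rw [hδdef]; ring
      rw [this]; ring

/-! ### Shifting the line of integration -/

theorem integrable_exp_neg_mul_abs {δ : ℝ} (hδ : 0 < δ) :
    MeasureTheory.Integrable fun t : ℝ => Real.exp (-(δ * |t|)) := by
  obtain ⟨C, hC, h⟩ := exists_pow_le_mul_exp 1 zero_le_one 2 hδ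
  refine (integrable_inv_one_add_sq.const_mul C).mono'
    (by fun_prop) (Eventually.of_forall fun t => ?_)
  have h1 := h |t| (abs_nonneg t)
  have h2 : 1 + t ^ 2 ≤ (1 + |t|) ^ 2 := by
    nlinarith [abs_nonneg t, sq_abs t]
  rw [Real.norm_of_nonneg (Real.exp_pos _).le, Real.exp_neg, ← div_eq_mul_inv,
    inv_le_comm₀ (Real.exp_pos _) (by positivity), inv_div, div_le_iff₀ hC]
  linarith

theorem integral_inv_quarter_add_sq : ∫ y : ℝ, (1 / 4 + y ^ 2)⁻¹ = 2 * Real.pi := by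
  have h := MeasureTheory.Measure.integral_comp_mul_left (fun x : ℝ => (1 + x ^ 2)⁻¹) 2
  rw [integral_univ_inv_one_add_sq] at h
  have e : ∀ y : ℝ, (1 / 4 + y ^ 2)⁻¹ = 4 * (1 + (2 * y) ^ 2)⁻¹ := fun y => by
    have : 1 + (2 * y) ^ 2 ≠ 0 := by positivity
    have : 1 / 4 + y ^ 2 ≠ 0 := by positivity
    field_simp; ring
  simp_rw [e]
  rw [MeasureTheory.integral_const_mul, h, abs_of_pos (by norm_num)]
  simp; ring

theorem integrable_inv_quarter_add_sq :
    MeasureTheory.Integrable fun y : ℝ => (1 / 4 + y ^ 2)⁻¹ := by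
  by_contra h
  have := MeasureTheory.integral_undef h
  rw [integral_inv_quarter_add_sq] at this
  linarith [Real.pi_pos]

/-- Shifting a vertical line of integration over a simple pole at a real point `c`. -/
theorem integral_vertical_line_shift {f H : ℂ → ℂ} {c B δ : ℝ} (hδ : 0 < δ)
    (hH : DifferentiableOn ℂ H {s | c - 1 < s.re ∧ s.re < c + 1})
    (hf : ∀ s : ℂ, c - 1 < s.re → s.re < c + 1 → s ≠ c → f s = H s / (s - c))
    (hdecay : ∀ s : ℂ, c - 1 / 2 ≤ s.re → s.re ≤ c + 1 / 2 → 1 ≤ |s.im| →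
      ‖f s‖ ≤ B * Real.exp (-(δ * |s.im|)))
    (hr : MeasureTheory.Integrable fun t : ℝ => f ((c + 1 / 2 : ℝ) + t * Complex.I))
    (hl : MeasureTheory.Integrable fun t : ℝ => f ((c - 1 / 2 : ℝ) + t * Complex.I)) :
    (∫ t : ℝ, f ((c + 1 / 2 : ℝ) + t * Complex.I)) -
      ∫ t : ℝ, f ((c - 1 / 2 : ℝ) + t * Complex.I) = 2 * Real.pi * H c := by
  set U := {s : ℂ | c - 1 < s.re ∧ s.re < c + 1}
  have hUo : IsOpen U := by
    exact (isOpen_lt continuous_const Complex.continuous_re).inter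
      (isOpen_lt Complex.continuous_re continuous_const)
  have hcU : U ∈ 𝓝 (c : ℂ) := hUo.mem_nhds (by simp [U])
  -- Away from `c` this is `f` minus its principal part `H c / (s - c)`; it extends holomorphically
  -- over `c`, so Cauchy's theorem applies to rectangles around `c`.
  set g := dslope H c
  have hg : DifferentiableOn ℂ g U := (Complex.differentiableOn_dslope hcU).2 hH
  have hgs : ∀ s ∈ U, s ≠ c → g s = f s - H c * (s - c)⁻¹ := fun s hs hsc => by
    simp only [g]
    rw [dslope_of_ne _ hsc, slope_def_field, hf s hs.1 hs.2 hsc]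
    ring
  -- On one line the principal part alone is not integrable, but its difference between the two
  -- lines is `H c / (1/4 + t²)`, with integral `2π H c`: this is the residue. It remains to show
  -- that `D` integrates to `0`.
  set D : ℝ → ℂ := fun t => f ((c + 1 / 2 : ℝ) + t * Complex.I) -
    f ((c - 1 / 2 : ℝ) + t * Complex.I) - H c * (((1 / 4 + t ^ 2)⁻¹ : ℝ) : ℂ)
  have hDint : MeasureTheory.Integrable D :=
    (hr.sub hl).sub (integrable_inv_quarter_add_sq.ofReal.const_mul _)
  have hpt (t : ℝ) : g ((c + 1 / 2 : ℝ) + t * Complex.I) -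
      g ((c - 1 / 2 : ℝ) + t * Complex.I) = D t := by
    have a1 : (((c + 1 / 2 : ℝ) : ℂ) + t * Complex.I) - c = 1 / 2 + t * Complex.I := by
      push_cast; ring
    have a2 : (((c - 1 / 2 : ℝ) : ℂ) + t * Complex.I) - c = -1 / 2 + t * Complex.I := by
      push_cast; ring
    have n1 : (1 / 2 + t * Complex.I : ℂ) ≠ 0 := fun h => by
      have := congrArg Complex.re h; norm_num at this
    have n2 : (-1 / 2 + t * Complex.I : ℂ) ≠ 0 := fun h => by
      have := congrArg Complex.re h; norm_num at this
    rw [hgs _ (by constructor <;> simp <;> linarith) (by rw [← sub_ne_zero, a1]; exact n1),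
      hgs _ (by constructor <;> simp <;> linarith) (by rw [← sub_ne_zero, a2]; exact n2), a1, a2]
    have : (1 / 2 + t * Complex.I : ℂ)⁻¹ - (-1 / 2 + t * Complex.I : ℂ)⁻¹
        = (((1 / 4 + t ^ 2)⁻¹ : ℝ) : ℂ) := by
      have h3 : (1 / 2 + t * Complex.I : ℂ) * (-1 / 2 + t * Complex.I) = -(1 / 4 + t ^ 2) := by
        linear_combination (t ^ 2 : ℂ) * Complex.I_sq
      have n3 : (1 / 4 + (t : ℂ) ^ 2) ≠ 0 := by
        rw [← neg_ne_zero, ← h3]; exact mul_ne_zero n1 n2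
      push_cast
      rw [inv_sub_inv n1 n2, h3, ← one_div, div_eq_div_iff (neg_ne_zero.2 n3) n3]
      ring
    simp only [D]
    rw [← this]; ring
  set R : ℝ → ℝ := fun T => B * Real.exp (-(δ * T)) + ‖H c‖ / T
  have hrow (T y : ℝ) (hT : 1 ≤ T) (hy : |y| = T) :
      ‖∫ x : ℝ in (c - 1 / 2)..(c + 1 / 2), g (x + y * Complex.I)‖ ≤ R T := by
    have : ‖∫ x : ℝ in (c - 1 / 2)..(c + 1 / 2), g (x + y * Complex.I)‖ ≤
        R T * |c + 1 / 2 - (c - 1 / 2)| := by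
      refine intervalIntegral.norm_integral_le_of_norm_le_const fun x hx => ?_
      rw [Set.uIoc_of_le (by linarith)] at hx
      have hyx : |y| ≤ ‖(x + y * Complex.I : ℂ) - c‖ := by
        simpa using Complex.abs_im_le_norm ((x + y * Complex.I : ℂ) - c)
      rw [hgs _ (by constructor <;> simp <;> linarith [hx.1, hx.2]) (by
        intro h; have := congrArg Complex.im h; simp at this; rw [this] at hy; simp at hy; linarith)]
      refine (norm_sub_le _ _).trans (add_le_add ?_ ?_)
      · have := hdecay (x + y * Complex.I) (by simp; linarith [hx.1]) (by simp; linarith [hx.2])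
          (by simp [hy, hT])
        simpa [hy] using this
      · rw [norm_mul, norm_inv, div_eq_mul_inv]
        rw [hy] at hyx
        gcongr
    rwa [show c + 1 / 2 - (c - 1 / 2) = 1 by ring, abs_one, mul_one] at this
  have hbound (T : ℝ) (hT : 1 ≤ T) : ‖∫ y in (-T)..T, D y‖ ≤ 2 * R T := by
    have hrect := Complex.integral_boundary_rect_eq_zero_of_differentiableOn g
      ⟨c - 1 / 2, -T⟩ ⟨c + 1 / 2, T⟩ (hg.mono (by
        intro s hs
        rw [Complex.mem_reProdIm, Set.uIcc_of_le (by linarith)] at hs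
        exact ⟨by linarith [hs.1.1], by linarith [hs.1.2]⟩))
    simp only [smul_eq_mul] at hrect
    have hI (a : ℝ) (ha : |a - c| = 1 / 2) : IntervalIntegrable
        (fun y : ℝ => g ((a : ℂ) + y * Complex.I)) MeasureTheory.volume (-T) T := by
      refine Continuous.intervalIntegrable ?_ _ _
      refine hg.continuousOn.comp_continuous (by fun_prop) fun y => ?_
      have := abs_le.1 ha.le
      constructor <;> simp <;> linarith
    have hD : ∫ y in (-T)..T, D y = (∫ y in (-T)..T, g ((c + 1 / 2 : ℝ) + y * Complex.I)) -
        ∫ y in (-T)..T, g ((c - 1 / 2 : ℝ) + y * Complex.I) := by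
      rw [← intervalIntegral.integral_sub (hI _ (by rw [add_sub_cancel_left]; norm_num))
        (hI _ (by rw [sub_sub_cancel_left]; norm_num))]
      simp_rw [hpt]
    have e : ‖∫ y in (-T)..T, D y‖ = ‖Complex.I * ∫ y in (-T)..T, D y‖ := by
      rw [norm_mul, Complex.norm_I, one_mul]
    have e2 : Complex.I * ∫ y in (-T)..T, D y =
        (∫ x : ℝ in (c - 1 / 2)..(c + 1 / 2), g (x + (T : ℝ) * Complex.I)) -
        ∫ x : ℝ in (c - 1 / 2)..(c + 1 / 2), g (x + (-T : ℝ) * Complex.I) := by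
      rw [hD]; linear_combination hrect
    rw [e, e2]
    refine (norm_sub_le _ _).trans ?_
    have b1 := hrow T T hT (abs_of_pos (by linarith))
    have b2 := hrow T (-T) hT (by rw [abs_neg]; exact abs_of_pos (by linarith))
    linarith
  have hlim := MeasureTheory.intervalIntegral_tendsto_integral hDint tendsto_neg_atTop_atBot
    tendsto_id
  have hR : Tendsto (fun T => 2 * R T) atTop (𝓝 0) := by
    have h1 : Tendsto (fun T : ℝ => Real.exp (-(δ * T))) atTop (𝓝 0) :=
      Real.tendsto_exp_neg_atTop_nhds_zero.comp (tendsto_id.const_mul_atTop hδ)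
    have h2 : Tendsto (fun T : ℝ => ‖H c‖ / T) atTop (𝓝 0) := tendsto_const_nhds.div_atTop tendsto_id
    simpa using ((h1.const_mul B).add h2).const_mul 2
  have h0 : Tendsto (fun T : ℝ => ∫ y in (-T)..T, D y) atTop (𝓝 0) :=
    squeeze_zero_norm' ((eventually_ge_atTop 1).mono hbound) hR
  have hD0 : ∫ y, D y = 0 := tendsto_nhds_unique hlim h0
  have hsplit : ∫ y, D y = (∫ t : ℝ, f ((c + 1 / 2 : ℝ) + t * Complex.I)) -
      (∫ t : ℝ, f ((c - 1 / 2 : ℝ) + t * Complex.I)) - H c * (2 * Real.pi) := by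
    have e1 := MeasureTheory.integral_sub (hr.sub hl)
      ((integrable_inv_quarter_add_sq.ofReal (𝕜 := ℂ)).const_mul (H c))
    have e2 := MeasureTheory.integral_sub hr hl
    have e3 : ∫ t : ℝ, (((1 / 4 + t ^ 2)⁻¹ : ℝ) : ℂ) = 2 * Real.pi := by
      rw [integral_complex_ofReal, integral_inv_quarter_add_sq]; push_cast; rfl
    rw [MeasureTheory.integral_const_mul] at e1
    simp only [Pi.sub_apply] at e1
    rw [e2] at e1
    rw [← e3]
    exact e1
  rw [hD0] at hsplit
  linear_combination -hsplit

/-- The Mellin-Barnes integral over the vertical line `Re s = -(p + 1 / 2)`. -/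
noncomputable def mellinLine (h k p : ℕ) (z : ℂ) : ℂ :=
  1 / (2 * Real.pi) * ∫ t : ℝ, mellinIntegrand h k z (-(p + 1 / 2) + t * Complex.I)

theorem LFun_eq_mellinLine (h k : ℕ) : LFun h k = mellinLine h k 1 := by
  funext z
  simp only [LFun, mellinLine]
  norm_num

/-- The zeta part of the Mellin-Barnes integrand. -/
noncomputable def zetaSum (h k : ℕ) (s : ℂ) : ℂ :=
  ∑ d ∈ Finset.Icc 1 k, ∑ d' ∈ Finset.Icc 1 k,
      omega h k ^ (d * d') *
        HurwitzZeta.hurwitzZeta (((d' : ℝ) / (k : ℝ) : ℝ) : UnitAddCircle) (s - 1) *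
        HurwitzZeta.hurwitzZeta (((d : ℝ) / (k : ℝ) : ℝ) : UnitAddCircle) (s + 1)

theorem differentiableAt_zetaSum (h k : ℕ) {s : ℂ} (hs : s.re < 0) :
    DifferentiableAt ℂ (zetaSum h k) s := by
  unfold zetaSum
  refine DifferentiableAt.fun_sum fun d _ => DifferentiableAt.fun_sum fun d' _ => ?_
  have h1 : s - 1 ≠ 1 := fun e => by
    have := congrArg Complex.re e; simp at this; linarith
  have h2 : s + 1 ≠ 1 := fun e => by
    have := congrArg Complex.re e; simp at this; linarith
  refine DifferentiableAt.mul (DifferentiableAt.mul (differentiableAt_const _) ?_) ?_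
  · exact (HurwitzZeta.differentiableAt_hurwitzZeta _ h1).comp s (differentiableAt_id.sub_const 1)
  · exact (HurwitzZeta.differentiableAt_hurwitzZeta _ h2).comp s (differentiableAt_id.add_const 1)

theorem continuous_line (p : ℕ) (h k : ℕ) :
    Continuous fun t : ℝ => Complex.Gamma (-(p + 1 / 2) + t * Complex.I) *
      zetaSum h k (-(p + 1 / 2) + t * Complex.I) := by
  refine continuous_iff_continuousAt.2 fun t => ?_
  set s : ℂ := -(p + 1 / 2) + t * Complex.I with hsdef
  have hline : ContinuousAt (fun t : ℝ => (-(p + 1 / 2) + t * Complex.I : ℂ)) t := by fun_prop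
  have hp : (0 : ℝ) ≤ p := p.cast_nonneg
  have hG : ContinuousAt Complex.Gamma s := by
    refine (Complex.differentiableAt_Gamma s fun m e => ?_).continuousAt
    have := congrArg Complex.re e
    simp [hsdef] at this
    have h2 : ((2 * p + 1 : ℕ) : ℝ) = (2 * m : ℕ) := by push_cast; linarith
    have h3 : 2 * p + 1 = 2 * m := by exact_mod_cast h2
    lia
  have hZ : ContinuousAt (zetaSum h k) s :=
    (differentiableAt_zetaSum h k (by simp [hsdef]; linarith)).continuousAt
  exact (ContinuousAt.comp (f := fun t : ℝ => (-(p + 1 / 2) + t * Complex.I : ℂ)) hG hline).mul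
    (ContinuousAt.comp (f := fun t : ℝ => (-(p + 1 / 2) + t * Complex.I : ℂ)) hZ hline)

theorem mellinIntegrand_eq (h k : ℕ) (z s : ℂ) :
    mellinIntegrand h k z s = (z * (k : ℂ) ^ 2) ^ (-s) * (Complex.Gamma s * zetaSum h k s) := by
  rw [mellinIntegrand, mul_assoc]; rfl

theorem continuous_mellinIntegrand_line (p h k : ℕ) (hk : 0 < k) {z : ℂ} (hz : z ≠ 0) :
    Continuous fun t : ℝ => mellinIntegrand h k z (-(p + 1 / 2) + t * Complex.I) := by
  simp_rw [mellinIntegrand_eq]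
  refine Continuous.mul ?_ (continuous_line p h k)
  refine Continuous.const_cpow (by fun_prop) (Or.inl ?_)
  simp [hz, hk.ne']

theorem exists_norm_mellinIntegrand_line_le (h k p : ℕ) (hk : 0 < k) (hp : 1 ≤ p) (κ : ℝ) :
    ∃ C δ : ℝ, 0 < C ∧ 0 < δ ∧ ∀ z ∈ sector κ, ∀ t : ℝ,
      ‖mellinIntegrand h k z (-(p + 1 / 2) + t * Complex.I)‖ ≤
        C * ‖z‖ ^ (p + 1 / 2 : ℝ) * Real.exp (-(δ * |t|)) := by
  -- `p + 1` because the line `Re s = -(p + 1/2)` must lie strictly inside the strip.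
  obtain ⟨C, δ, hC, hδ, hb⟩ := exists_norm_mellinIntegrand_le h k (p + 1) hk κ
  have hp1 : (1 : ℝ) ≤ p := by exact_mod_cast hp
  refine ⟨C, δ, hC, hδ, fun z hz t => ?_⟩
  have := hb z hz (-(p + 1 / 2) + t * Complex.I) (by simp; linarith) (by simp; linarith)
    (by simpa using exp_abs_le_norm_sin_half_line p t)
  convert this using 3 <;> simp

theorem mem_sector_of_re_pos {z : ℂ} (hz : 0 < z.re) : z ∈ sector (|z.im| / z.re) :=
  ⟨hz, by rw [div_mul_cancel₀ _ hz.ne']⟩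

theorem integrable_mellinIntegrand_line (h k p : ℕ) (hk : 0 < k) (hp : 1 ≤ p) {z : ℂ}
    (hz : 0 < z.re) :
    MeasureTheory.Integrable
      fun t : ℝ => mellinIntegrand h k z (-(p + 1 / 2) + t * Complex.I) := by
  obtain ⟨C, δ, hC, hδ, hb⟩ := exists_norm_mellinIntegrand_line_le h k p hk hp (|z.im| / z.re)
  refine ((integrable_exp_neg_mul_abs hδ).const_mul (C * ‖z‖ ^ (p + 1 / 2 : ℝ))).mono'
    (continuous_mellinIntegrand_line p h k hk
      (sector_ne_zero (mem_sector_of_re_pos hz))).aestronglyMeasurable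
    (Eventually.of_forall fun t => hb z (mem_sector_of_re_pos hz) t)

theorem exists_norm_mellinLine_le (h k p : ℕ) (hk : 0 < k) (hp : 1 ≤ p) (κ : ℝ) :
    ∃ C : ℝ, 0 < C ∧ ∀ z ∈ sector κ, ‖mellinLine h k p z‖ ≤ C * ‖z‖ ^ (p + 1 / 2 : ℝ) := by
  obtain ⟨C, δ, hC, hδ, hb⟩ := exists_norm_mellinIntegrand_line_le h k p hk hp κ
  set J := ∫ t : ℝ, Real.exp (-(δ * |t|))
  have hJ : 0 ≤ J := MeasureTheory.integral_nonneg fun t => (Real.exp_pos _).le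
  refine ⟨1 / (2 * Real.pi) * (C * (J + 1)), by positivity, fun z hz => ?_⟩
  rw [mellinLine, norm_mul]
  have h1 : ‖(1 / (2 * Real.pi) : ℂ)‖ = 1 / (2 * Real.pi) := by
    rw [norm_div, norm_mul, Complex.norm_real, Real.norm_of_nonneg Real.pi_pos.le]; simp
  have h2 : ‖∫ t : ℝ, mellinIntegrand h k z (-(p + 1 / 2) + t * Complex.I)‖ ≤
      ∫ t : ℝ, C * ‖z‖ ^ (p + 1 / 2 : ℝ) * Real.exp (-(δ * |t|)) :=
    MeasureTheory.norm_integral_le_of_norm_le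
      ((integrable_exp_neg_mul_abs hδ).const_mul _) (Eventually.of_forall fun t => hb z hz t)
  rw [MeasureTheory.integral_const_mul] at h2
  rw [h1]
  calc _ ≤ 1 / (2 * Real.pi) * (C * ‖z‖ ^ (p + 1 / 2 : ℝ) * J) := by gcongr
    _ ≤ 1 / (2 * Real.pi) * (C * ‖z‖ ^ (p + 1 / 2 : ℝ) * (J + 1)) := by gcongr; linarith
    _ = _ := by ring

/-! ### The residues -/

theorem hurwitzZeta_neg_nat_eq_bernoulliFun {n : ℕ} (hn : n ≠ 0) {x : ℝ} (hx : x ∈ Set.Icc (0 : ℝ) 1) :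
    HurwitzZeta.hurwitzZeta (x : UnitAddCircle) (-n) =
      -1 / (n + 1) * (bernoulliFun (n + 1) x : ℂ) := by
  rw [HurwitzZeta.hurwitzZeta_neg_nat hn hx]
  congr 1
  rw [bernoulliFun, ← Complex.coe_algebraMap, ← Polynomial.eval_map_apply, Polynomial.map_map]
  rfl

theorem Gamma_mul_prod_range (n : ℕ) {s : ℂ} (hs : ∀ j < n, s + j ≠ 0) :
    Complex.Gamma s * ∏ j ∈ Finset.range n, (s + j) = Complex.Gamma (s + n) := by
  induction n with
  | zero => simp
  | succ n ih =>
    rw [Finset.prod_range_succ, ← mul_assoc, ih fun j hj => hs j (hj.trans n.lt_succ_self),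
      Nat.cast_succ, ← add_assoc, Complex.Gamma_add_one _ (hs n n.lt_succ_self)]
    ring

theorem prod_range_neg_add (q : ℕ) :
    ∏ j ∈ Finset.range q, (-(q : ℂ) + j) = (-1) ^ q * q.factorial := by
  have h1 : ∀ j ∈ Finset.range q, (-(q : ℂ) + j) = -1 * (((q - 1 - j : ℕ) : ℂ) + 1) := fun j hj => by
    have : j < q := Finset.mem_range.1 hj
    rw [show q - 1 - j = q - (j + 1) by lia, Nat.cast_sub this]
    push_cast; ring
  rw [Finset.prod_congr rfl h1, Finset.prod_mul_distrib, Finset.prod_const, Finset.card_range,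
    Finset.prod_range_reflect (fun i => (i : ℂ) + 1) q, ← Finset.prod_range_add_one_eq_factorial]
  push_cast; rfl

/-- For `q = 1` one factor would be a Hurwitz zeta value at `0`, which the Bernoulli formula used
here excludes. That residue is never computed, since `vCoeff h k 1 * z` is built into `VFun`. -/
theorem zetaSum_neg_nat (h k q : ℕ) (hk : 0 < k) (hq : 2 ≤ q) :
    zetaSum h k (-q) = 1 / (q * (q + 2)) * ∑ d ∈ Finset.Icc 1 k, ∑ d' ∈ Finset.Icc 1 k,
      omega h k ^ (d * d') *
        ((bernoulliFun (q + 2) ((d' : ℝ) / k) * bernoulliFun q ((d : ℝ) / k) : ℝ) : ℂ) := by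
  have hmem : ∀ d ∈ Finset.Icc 1 k, (d : ℝ) / k ∈ Set.Icc (0 : ℝ) 1 := fun d hd => by
    have hk' : (0 : ℝ) < k := by exact_mod_cast hk
    refine ⟨by positivity, (div_le_one hk').2 ?_⟩
    exact_mod_cast (Finset.mem_Icc.1 hd).2
  obtain ⟨r, rfl⟩ : ∃ r, q = r + 1 := ⟨q - 1, by lia⟩
  have hr : r ≠ 0 := by lia
  rw [zetaSum, Finset.mul_sum]
  refine Finset.sum_congr rfl fun d hd => ?_
  rw [Finset.mul_sum]
  refine Finset.sum_congr rfl fun d' hd' => ?_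
  rw [show (-((r + 1 : ℕ) : ℂ) - 1) = -((r + 2 : ℕ) : ℂ) by push_cast; ring,
    show (-((r + 1 : ℕ) : ℂ) + 1) = -(r : ℂ) by push_cast; ring,
    hurwitzZeta_neg_nat_eq_bernoulliFun (by lia) (hmem d' hd'),
    hurwitzZeta_neg_nat_eq_bernoulliFun hr (hmem d hd)]
  have n1 : (r : ℂ) + 1 ≠ 0 := by exact_mod_cast r.succ_ne_zero
  have n2 : (r : ℂ) + 1 + 2 ≠ 0 := by
    have : ((r + 3 : ℕ) : ℂ) ≠ 0 := by exact_mod_cast (r + 2).succ_ne_zero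
    intro h; apply this; push_cast; rw [← h]; ring
  have n3 : (r : ℂ) + 2 + 1 ≠ 0 := by intro h; apply n2; rw [← h]; ring
  push_cast
  field_simp
  rw [show r + 2 + 1 = r + 1 + 2 by ring]
  ring

/-- Between the two lines the only pole is the simple pole of `Γ` at `-(p + 1)`, where the zeta sum
is holomorphic. -/
theorem mellinLine_eq_add (h k p : ℕ) (hk : 0 < k) (hp : 1 ≤ p) {z : ℂ} (hz : 0 < z.re) :
    mellinLine h k p z = vCoeff h k (p + 1) * z ^ (p + 1) + mellinLine h k (p + 1) z := by
  set q := p + 1 with hq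
  -- The integrand times `s + q`: in `Γ(s) = Γ(s + q + 1) / ∏_{j ≤ q} (s + j)` the factor `j = q` is
  -- dropped, so that `H` is holomorphic across the pole.
  set H : ℂ → ℂ := fun s => (z * (k : ℂ) ^ 2) ^ (-s) *
    (Complex.Gamma (s + (q + 1 : ℕ)) / ∏ j ∈ Finset.range q, (s + j)) * zetaSum h k s
  have hz0 : z ≠ 0 := sector_ne_zero (mem_sector_of_re_pos hz)
  have hzk : z * (k : ℂ) ^ 2 ≠ 0 := by simp [hz0, hk.ne']
  obtain ⟨B, δ, hB, hδ, hb⟩ := exists_norm_mellinIntegrand_le h k (q + 1) hk (|z.im| / z.re)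
  have hp1 : (1 : ℝ) ≤ p := by exact_mod_cast hp
  have hqr : (q : ℝ) = p + 1 := by rw [hq]; push_cast; rfl
  have hne : ∀ s : ℂ, s.re < -(q : ℝ) + 1 → ∀ j < q, s + j ≠ 0 := fun s hs j hj e => by
    have := congrArg Complex.re e
    simp at this
    have : (j : ℝ) + 1 ≤ q := by exact_mod_cast hj
    linarith
  -- For fixed `z` the factor `‖z‖ ^ (-s.re)` is bounded on the closed strip by compactness, giving
  -- one constant for all horizontal segments.
  obtain ⟨B', hB'⟩ : ∃ B' : ℝ, ∀ s : ℂ, (-q : ℝ) - 1 / 2 ≤ s.re → s.re ≤ (-q : ℝ) + 1 / 2 →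
      1 ≤ |s.im| → ‖mellinIntegrand h k z s‖ ≤ B' * Real.exp (-(δ * |s.im|)) := by
    have hcont : ContinuousOn (fun x : ℝ => B * ‖z‖ ^ (-x)) (Set.Icc (-q - 1 / 2) (-q + 1 / 2)) := by
      refine Continuous.continuousOn ?_
      refine continuous_const.mul (continuous_const.rpow continuous_neg fun _ => Or.inl ?_)
      exact norm_ne_zero_iff.2 hz0
    obtain ⟨B', hB'⟩ := isCompact_Icc.exists_bound_of_continuousOn hcont
    refine ⟨B', fun s h1 h2 h3 => ?_⟩
    have e1 : |(Real.pi * s : ℂ).im| = Real.pi * |s.im| := by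
      rw [Complex.im_ofReal_mul, abs_mul, abs_of_pos Real.pi_pos]
    refine (hb z (mem_sector_of_re_pos hz) s (by linarith) (by push_cast; linarith) ?_).trans ?_
    · rw [← e1]
      refine exp_abs_im_le_norm_sin ?_
      rw [e1]
      nlinarith [Real.pi_gt_three]
    · have := (le_abs_self _).trans (hB' s.re ⟨h1, h2⟩)
      gcongr
  have hr := integrable_mellinIntegrand_line h k p hk hp hz
  have hl := integrable_mellinIntegrand_line h k q hk (by lia) hz
  have er : (((-q : ℝ) + 1 / 2 : ℝ) : ℂ) = -(p + 1 / 2) := by rw [hqr]; push_cast; ring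
  have el : (((-q : ℝ) - 1 / 2 : ℝ) : ℂ) = -(q + 1 / 2) := by push_cast; ring
  have key := integral_vertical_line_shift (f := mellinIntegrand h k z) (H := H) (c := -q)
    (B := B') hδ ?_ ?_ hB' (by rw [er]; exact hr) (by rw [el]; exact hl)
  · rw [er, el] at key
    have hres : H ((-q : ℝ) : ℂ) = vCoeff h k q * z ^ q := by
      have e1 : ((-q : ℝ) : ℂ) = -(q : ℂ) := by push_cast; rfl
      simp only [H]
      rw [e1, zetaSum_neg_nat h k q hk (by lia), prod_range_neg_add, neg_neg, Complex.cpow_natCast,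
        show -(q : ℂ) + (q + 1 : ℕ) = 1 by push_cast; ring, Complex.Gamma_one, vCoeff]
      have hs : ((-1 : ℂ) ^ q) * (-1) ^ q = 1 := by rw [← mul_pow]; simp
      have hs0 : ((-1 : ℂ) ^ q) ≠ 0 := pow_ne_zero _ (by norm_num)
      have hinv : (1 / ((-1 : ℂ) ^ q * q.factorial)) = (-1) ^ q / q.factorial := by
        rw [div_eq_div_iff (mul_ne_zero hs0 (by exact_mod_cast q.factorial_ne_zero))
          (by exact_mod_cast q.factorial_ne_zero)]
        linear_combination -(q.factorial : ℂ) * hs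
      rw [hinv, mul_pow, neg_pow]
      generalize (∑ d ∈ Finset.Icc 1 k, ∑ d' ∈ Finset.Icc 1 k, omega h k ^ (d * d') *
        ((bernoulliFun (q + 2) ((d' : ℝ) / k) * bernoulliFun q ((d : ℝ) / k) : ℝ) : ℂ)) = T
      simp only [div_eq_mul_inv, mul_inv]
      ring
    rw [hres] at key
    simp only [mellinLine]
    have hpi : (Real.pi : ℂ) ≠ 0 := by exact_mod_cast Real.pi_ne_zero
    rw [eq_add_of_sub_eq key]
    generalize (∫ t : ℝ, mellinIntegrand h k z (-(q + 1 / 2) + t * Complex.I)) = J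
    field_simp
  · intro s hs
    refine DifferentiableAt.differentiableWithinAt ?_
    have hq0 : (0 : ℝ) ≤ q := by positivity
    have d1 : DifferentiableAt ℂ (fun s : ℂ => (z * (k : ℂ) ^ 2) ^ (-s)) s :=
      differentiableAt_id.neg.const_cpow (Or.inl hzk)
    have d2 : DifferentiableAt ℂ (fun s : ℂ => Complex.Gamma (s + (q + 1 : ℕ))) s := by
      refine DifferentiableAt.comp s (g := Complex.Gamma) (f := fun s : ℂ => s + (q + 1 : ℕ)) ?_
        (differentiableAt_id.add_const _)
      refine Complex.differentiableAt_Gamma _ fun m e => ?_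
      have := congrArg Complex.re e
      simp at this
      have hm : (0 : ℝ) ≤ m := m.cast_nonneg
      linarith [hs.1]
    have d3 : DifferentiableAt ℂ (fun s : ℂ => ∏ j ∈ Finset.range q, (s + j)) s := by fun_prop
    have d4 := differentiableAt_zetaSum h k (s := s) (by linarith [hs.2])
    exact (d1.mul (d2.div d3 (Finset.prod_ne_zero_iff.2 fun j hj =>
      hne s hs.2 j (Finset.mem_range.1 hj)))).mul d4
  · intro s h1 h2 h3
    have e1 : ((-q : ℝ) : ℂ) = -(q : ℂ) := by push_cast; rfl
    rw [e1] at h3 ⊢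
    have h3' : s + q ≠ 0 := fun e => h3 (eq_neg_of_add_eq_zero_left e)
    have hall : ∀ j < q + 1, s + j ≠ 0 := fun j hj => by
      rcases Nat.lt_succ_iff_lt_or_eq.1 hj with hj | rfl
      · exact hne s h2 j hj
      · exact h3'
    have hprod : ∏ j ∈ Finset.range q, (s + j) ≠ 0 :=
      Finset.prod_ne_zero_iff.2 fun j hj => hne s h2 j (Finset.mem_range.1 hj)
    rw [mellinIntegrand_eq]
    simp only [H]
    rw [← Gamma_mul_prod_range (q + 1) hall, Finset.prod_range_succ, sub_neg_eq_add]
    field_simp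

/-- The asymptotic expansion of `V_{h,k}` with its remainder term. -/
theorem VFun_eq_sum_add (h k p : ℕ) (hk : 0 < k) (hp : 1 ≤ p) {z : ℂ} (hz : 0 < z.re) :
    VFun h k z = (∑ m ∈ Finset.range (p + 1), PowerSeries.coeff m (VSeries h k) * z ^ m) +
      mellinLine h k p z := by
  induction p, hp using Nat.le_induction with
  | base => simp [VFun, LFun_eq_mellinLine, VSeries, Finset.sum_range_succ]
  | succ p hp ih =>
    rw [ih, mellinLine_eq_add h k p hk hp hz, Finset.sum_range_succ _ (p + 1)]
    simp [VSeries, add_assoc]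

/-! ### Holomorphy of `V_{h,k}` -/

theorem hasDerivAt_mellinIntegrand {h k : ℕ} (hk : 0 < k) {z : ℂ} (hz : 0 < z.re) (s : ℂ) :
    HasDerivAt (fun z => mellinIntegrand h k z s) (-s / z * mellinIntegrand h k z s) z := by
  have hz0 : z ≠ 0 := sector_ne_zero (mem_sector_of_re_pos hz)
  have hk0 : (k : ℂ) ^ 2 ≠ 0 := by simp [hk.ne']
  have hmem : z * (k : ℂ) ^ 2 ∈ Complex.slitPlane := by
    left
    rw [show ((k : ℂ) ^ 2) = ((k ^ 2 : ℝ) : ℂ) by push_cast; rfl, Complex.re_mul_ofReal]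
    positivity
  have h1 := ((hasDerivAt_id z).mul_const ((k : ℂ) ^ 2)).cpow_const (c := -s) hmem
  have h2 := h1.mul_const (Complex.Gamma s * zetaSum h k s)
  simp only [id] at h2
  simp_rw [mellinIntegrand_eq]
  refine h2.congr_deriv ?_
  have hk1 : (k : ℂ) ≠ 0 := by simp [hk.ne']
  rw [Complex.cpow_sub _ _ (mul_ne_zero hz0 hk0), Complex.cpow_one]
  field_simp

/-- Differentiation under the integral. The new factor `-s / z` grows linearly in `t` and is
absorbed by half of the exponential decay. -/
theorem differentiableAt_mellinLine (h k p : ℕ) (hk : 0 < k) (hp : 1 ≤ p) {z₀ : ℂ}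
    (hz : 0 < z₀.re) : DifferentiableAt ℂ (mellinLine h k p) z₀ := by
  -- The extra `1` makes `z₀` an interior point of the sector, so that one bound serves a whole
  -- neighbourhood.
  set κ := |z₀.im| / z₀.re + 1
  have hz0 : z₀ ≠ 0 := sector_ne_zero (mem_sector_of_re_pos hz)
  have hn0 : 0 < ‖z₀‖ := norm_pos_iff.2 hz0
  obtain ⟨C, δ, hC, hδ, hb⟩ := exists_norm_mellinIntegrand_line_le h k p hk hp κ
  obtain ⟨C', hC', hb'⟩ := exists_pow_le_mul_exp (p + 1) (by positivity) 1 (half_pos hδ)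
  set N : Set ℂ := {z | 0 < z.re ∧ |z.im| < κ * z.re ∧ ‖z₀‖ / 2 < ‖z‖ ∧ ‖z‖ < 2 * ‖z₀‖}
  have hN : N ∈ 𝓝 z₀ := by
    refine IsOpen.mem_nhds ?_ ⟨hz, ?_, by linarith, by linarith⟩
    · refine (isOpen_lt continuous_const Complex.continuous_re).inter
        ((isOpen_lt (continuous_abs.comp Complex.continuous_im)
          (continuous_const.mul Complex.continuous_re)).inter
          ((isOpen_lt continuous_const continuous_norm).inter
            (isOpen_lt continuous_norm continuous_const)))
    · simp only [κ]
      rw [add_mul, div_mul_cancel₀ _ hz.ne']; linarith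
  set s : ℝ → ℂ := fun t => -(p + 1 / 2) + t * Complex.I
  have hsn (t : ℝ) : ‖s t‖ ≤ p + 1 + |t| := by
    refine (Complex.norm_le_abs_re_add_abs_im _).trans ?_
    have : |(s t).re| = p + 1 / 2 := by
      rw [← abs_neg]
      simp only [s]
      have e : -(-(p + 1 / 2 : ℂ) + t * Complex.I).re = p + 1 / 2 := by simp
      rw [e, abs_of_nonneg (by positivity)]
    rw [this]
    simp [s]; linarith
  have key := hasDerivAt_integral_of_dominated_loc_of_deriv_le (μ := MeasureTheory.volume)
    (F := fun z t => mellinIntegrand h k z (s t))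
    (F' := fun z t => -(s t) / z * mellinIntegrand h k z (s t))
    (bound := fun t => (2 / ‖z₀‖ * (C * (2 * ‖z₀‖) ^ (p + 1 / 2 : ℝ)) * C') *
      Real.exp (-(δ / 2 * |t|))) hN ?_ (integrable_mellinIntegrand_line h k p hk hp hz) ?_ ?_
    ((integrable_exp_neg_mul_abs (half_pos hδ)).const_mul _) ?_
  · exact (key.2.const_mul (1 / (2 * Real.pi) : ℂ)).differentiableAt
  · filter_upwards [hN] with z hzN
    exact (continuous_mellinIntegrand_line p h k hk
      (sector_ne_zero (mem_sector_of_re_pos hzN.1))).aestronglyMeasurable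
  · have hsc : Continuous s := by fun_prop
    exact ((hsc.neg.div_const _).mul
      (continuous_mellinIntegrand_line p h k hk hz0)).aestronglyMeasurable
  · refine Eventually.of_forall fun t z hzN => ?_
    have h1 := hb z ⟨hzN.1, hzN.2.1.le⟩ t
    have h2 := hb' |t| (abs_nonneg t)
    rw [pow_one] at h2
    have hzpos : 0 < ‖z‖ := by linarith [hzN.2.2.1]
    rw [norm_mul, norm_div, norm_neg]
    calc ‖s t‖ / ‖z‖ * ‖mellinIntegrand h k z (s t)‖ ≤
        (C' * Real.exp (δ / 2 * |t|)) / (‖z₀‖ / 2) *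
          (C * (2 * ‖z₀‖) ^ (p + 1 / 2 : ℝ) * Real.exp (-(δ * |t|))) := by
          refine mul_le_mul (div_le_div₀ (by positivity) ((hsn t).trans h2) (by positivity)
            hzN.2.2.1.le) (h1.trans ?_) (norm_nonneg _) (by positivity)
          have := hzN.2.2.2.le
          gcongr
      _ = (2 / ‖z₀‖ * (C * (2 * ‖z₀‖) ^ (p + 1 / 2 : ℝ)) * C') *
          (Real.exp (δ / 2 * |t|) * Real.exp (-(δ * |t|))) := by
          field_simp
      _ = _ := by rw [← Real.exp_add]; ring_nf
  · exact Eventually.of_forall fun t z hzN => hasDerivAt_mellinIntegrand hk hzN.1 (s t)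

theorem differentiableAt_VFun (h k : ℕ) (hk : 0 < k) {z : ℂ} (hz : 0 < z.re) :
    DifferentiableAt ℂ (VFun h k) z := by
  unfold VFun
  rw [LFun_eq_mellinLine]
  exact (differentiableAt_id.const_mul _).add (differentiableAt_mellinLine h k 1 hk le_rfl hz)

/-! ### The exponential of a formal power series -/

theorem coeff_VSeries_zero (h k : ℕ) : PowerSeries.coeff 0 (VSeries h k) = 0 := by simp [VSeries]

theorem coeff_VSeries_succ (h k j : ℕ) :
    PowerSeries.coeff (j + 1) (VSeries h k) = vCoeff h k (j + 1) := by simp [VSeries]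

theorem hasSubst_VSeries (h k : ℕ) : PowerSeries.HasSubst (VSeries h k) :=
  PowerSeries.HasSubst.of_constantCoeff_zero' (by
    rw [← PowerSeries.coeff_zero_eq_constantCoeff_apply, coeff_VSeries_zero])

/-- The recurrence for the coefficients of `exp V`, from `(exp V)' = V' exp V`. -/
theorem succ_mul_bCoeff (h k m : ℕ) :
    ((m : ℂ) + 1) * bCoeff h k (m + 1) =
      ∑ j ∈ Finset.range (m + 1), ((j : ℂ) + 1) * vCoeff h k (j + 1) * bCoeff h k (m - j) := by
  have hd := congrArg (PowerSeries.coeff m)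
    (PowerSeries.derivative_subst (f := PowerSeries.exp ℂ) (hasSubst_VSeries h k))
  rw [PowerSeries.derivative_exp, PowerSeries.coeff_derivative, mul_comm (PowerSeries.subst _ _),
    PowerSeries.coeff_mul, Finset.Nat.sum_antidiagonal_eq_sum_range_succ_mk] at hd
  rw [mul_comm]
  refine hd.trans (Finset.sum_congr rfl fun j _ => ?_)
  rw [PowerSeries.coeff_derivative, coeff_VSeries_succ, bCoeff]
  ring

/-- `V` has no constant term, so `V ^ d` begins in degree at least `d`. The freedom in `n` lets a
single truncation of the exponential series serve all `m < n`. -/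
theorem bCoeff_eq_sum (h k : ℕ) {m n : ℕ} (hmn : m < n) :
    bCoeff h k m = ∑ d ∈ Finset.range n,
      (1 / (d.factorial : ℂ)) * PowerSeries.coeff m (VSeries h k ^ d) := by
  rw [bCoeff, PowerSeries.coeff_subst' (hasSubst_VSeries h k)]
  rw [finsum_eq_sum_of_support_subset (s := Finset.range n)]
  · refine Finset.sum_congr rfl fun d _ => ?_
    rw [PowerSeries.coeff_exp, smul_eq_mul]
    simp
  · intro d hd
    by_contra hdn
    simp only [Finset.coe_range, Set.mem_Iio, not_lt] at hdn
    refine hd ?_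
    have hX : PowerSeries.X ∣ VSeries h k := PowerSeries.X_dvd_iff.2 (by
      rw [← PowerSeries.coeff_zero_eq_constantCoeff_apply, coeff_VSeries_zero])
    have h0 := PowerSeries.X_pow_dvd_iff.1 (pow_dvd_pow_of_dvd hX d) m (by lia)
    simp only
    rw [h0, smul_zero]

theorem bCoeff_zero (h k : ℕ) : bCoeff h k 0 = 1 := by
  rw [bCoeff_eq_sum h k zero_lt_one]; simp

/-! ### Asymptotic expansion of `exp V` at the vertex of a sector -/

theorem isBigO_pow_pow {l : Filter ℂ} (hl : l ≤ 𝓝 0) {m n : ℕ} (h : m ≤ n) :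
    (fun z : ℂ => z ^ n) =O[l] fun z => z ^ m := by
  obtain ⟨r, rfl⟩ := Nat.exists_eq_add_of_le h
  have : (fun z : ℂ => z ^ r) =O[l] fun _ => (1 : ℂ) :=
    (((continuous_pow r).tendsto (0 : ℂ)).mono_left hl).isBigO_one ℂ
  simpa [pow_add] using (isBigO_refl (fun z : ℂ => z ^ m) l).mul this

theorem isBigO_eval_sub_sum {l : Filter ℂ} (hl : l ≤ 𝓝 0) (Q : Polynomial ℂ) (n : ℕ) :
    (fun z => Q.eval z - ∑ m ∈ Finset.range n, Q.coeff m * z ^ m) =O[l] fun z => z ^ n := by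
  have e : ∀ z, Q.eval z - ∑ m ∈ Finset.range n, Q.coeff m * z ^ m =
      ∑ m ∈ Finset.Ico n (max n (Q.natDegree + 1)), Q.coeff m * z ^ m := fun z => by
    rw [Polynomial.eval_eq_sum_range' (n := max n (Q.natDegree + 1)) (by simp),
      Finset.sum_Ico_eq_sub _ (le_max_left _ _)]
  simp_rw [e]
  refine IsBigO.fun_sum fun m hm => ?_
  exact (isBigO_pow_pow hl (Finset.mem_Ico.1 hm).1).const_mul_left _

theorem exp_sub_sum_isBigO {l : Filter ℂ} {w : ℂ → ℂ} (hw : Tendsto w l (𝓝 0)) (n : ℕ) :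
    (fun z => Complex.exp (w z) - ∑ d ∈ Finset.range n, w z ^ d / d.factorial) =O[l]
      fun z => w z ^ n := by
  have h1 : ∀ᶠ z in l, ‖w z‖ < 1 := by
    have h0 := hw.norm
    rw [norm_zero] at h0
    exact h0.eventually (gt_mem_nhds one_pos)
  refine IsBigO.of_bound (Real.exp 1) (h1.mono fun z hz => ?_)
  refine (Complex.norm_exp_sub_sum_le_norm_mul_exp (w z) n).trans ?_
  rw [norm_pow, mul_comm]
  have := hz.le
  gcongr

/-- `∑ b^{(m)} z^m` is asymptotic to `exp V_{h,k}(z)` as `z → 0` in a sector. -/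
theorem exp_VFun_sub_sum_isBigO_pow (h k : ℕ) (hk : 0 < k) (κ : ℝ) (n : ℕ) :
    (fun z : ℂ => Complex.exp (VFun h k z) - ∑ m ∈ Finset.range n, bCoeff h k m * z ^ m)
      =O[𝓝[sector κ] 0] fun z : ℂ => z ^ n := by
  set l := 𝓝[sector κ] (0 : ℂ)
  have hl : l ≤ 𝓝 0 := nhdsWithin_le_nhds
  -- Degrees up to `n + 1` match the line `p = n + 1`: its remainder `O(|z|^{n + 3/2})` is more than
  -- enough, and `p ≥ 1` holds even for `n = 0`.
  set P : Polynomial ℂ := PowerSeries.trunc (n + 2) (VSeries h k) with hP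
  have hPeval (z : ℂ) : P.eval z =
      ∑ m ∈ Finset.range (n + 2), PowerSeries.coeff m (VSeries h k) * z ^ m := by
    rw [hP, Polynomial.eval, PowerSeries.eval₂_trunc_eq_sum_range]; rfl
  -- The exponential truncated twice, in the series of `exp` and in `V`. Neither truncation changes
  -- a coefficient below degree `n`.
  set Q : Polynomial ℂ := ∑ d ∈ Finset.range n, Polynomial.C (1 / (d.factorial : ℂ)) * P ^ d
  have hQ : ∀ m < n, Q.coeff m = bCoeff h k m := fun m hm => by
    rw [bCoeff_eq_sum h k hm, Polynomial.finsetSum_coeff]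
    refine Finset.sum_congr rfl fun d _ => ?_
    rw [Polynomial.coeff_C_mul]
    congr 1
    have := congrArg (fun p => Polynomial.coeff p m)
      (PowerSeries.trunc_trunc_pow (VSeries h k) (n + 2) d)
    simp only [PowerSeries.coeff_trunc, if_pos (by lia : m < n + 2)] at this
    rw [← this, ← Polynomial.coeff_coe, Polynomial.coe_pow]
  have hI : (fun z => mellinLine h k (n + 1) z) =O[l] fun z => z ^ n := by
    obtain ⟨C, hC, hb⟩ := exists_norm_mellinLine_le h k (n + 1) hk (by lia) κ
    refine IsBigO.of_bound C ?_
    have h1 : ∀ᶠ z in l, ‖z‖ < 1 := 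
      hl (by simpa [Metric.ball, dist_zero_right] using Metric.ball_mem_nhds (0 : ℂ) one_pos)
    filter_upwards [h1, self_mem_nhdsWithin] with z hz hzs
    refine (hb z hzs).trans ?_
    rw [norm_pow, ← Real.rpow_natCast]
    refine mul_le_mul_of_nonneg_left ?_ hC.le
    refine Real.rpow_le_rpow_of_exponent_ge (norm_pos_iff.2 (sector_ne_zero hzs)) hz.le ?_
    push_cast; linarith
  have hV : ∀ᶠ z in l, VFun h k z = P.eval z + mellinLine h k (n + 1) z := by
    filter_upwards [self_mem_nhdsWithin] with z hz
    rw [VFun_eq_sum_add h k (n + 1) hk (by lia) hz.1, hPeval]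
  have hP1 : (fun z => P.eval z) =O[l] fun z => z ^ 1 := by
    simpa [hP, PowerSeries.coeff_trunc, coeff_VSeries_zero] using isBigO_eval_sub_sum hl P 1
  have hl1 : Tendsto (fun z : ℂ => z ^ 1) l (𝓝 0) := by
    simp only [pow_one]
    exact tendsto_id.mono_left hl
  have hP0 : Tendsto (fun z => P.eval z) l (𝓝 0) := hP1.trans_tendsto hl1
  have hexpP : (fun z => Complex.exp (P.eval z) - Q.eval z) =O[l] fun z => z ^ n := by
    have h1 := (exp_sub_sum_isBigO hP0 n).trans (hP1.pow n)
    simp only [pow_one] at h1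
    refine h1.congr_left fun z => ?_
    simp only [Q, Polynomial.eval_finsetSum, Polynomial.eval_mul, Polynomial.eval_C,
      Polynomial.eval_pow]
    congr 1
    exact Finset.sum_congr rfl fun d _ => by ring
  have hone : (fun z => Complex.exp (P.eval z)) =O[l] fun _ => (1 : ℂ) :=
    ((Complex.continuous_exp.tendsto 0).comp hP0).isBigO_one ℂ
  have hexpI : (fun z => Complex.exp (mellinLine h k (n + 1) z) - 1) =O[l] fun z => z ^ n := by
    have hI0 : Tendsto (fun z => mellinLine h k (n + 1) z) l (𝓝 0) := by
      obtain ⟨C, hC, hb⟩ := exists_norm_mellinLine_le h k (n + 1) hk (by lia) κ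
      have h0 : Tendsto (fun z : ℂ => C * ‖z‖ ^ ((n + 1 : ℕ) + 1 / 2 : ℝ)) l (𝓝 0) := by
        have hc : Continuous fun z : ℂ => C * ‖z‖ ^ ((n + 1 : ℕ) + 1 / 2 : ℝ) :=
          continuous_const.mul (continuous_norm.rpow_const fun _ => Or.inr (by positivity))
        have := hc.tendsto 0
        rw [norm_zero, Real.zero_rpow (by positivity), mul_zero] at this
        exact this.mono_left hl
      exact squeeze_zero_norm' (eventually_nhdsWithin_of_forall fun z hz => hb z hz) h0
    have h1 := exp_sub_sum_isBigO hI0 1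
    simp only [Finset.range_one, Finset.sum_singleton, pow_zero, Nat.factorial_zero,
      Nat.cast_one, div_one, pow_one] at h1
    exact h1.trans hI
  -- With `I` the remainder integral, `e^V - ∑ b z^m = e^P (e^I - 1) + (e^P - Q) + (Q - ∑ b z^m)`,
  -- and each part is `O(z^n)`.
  have h2 := hone.mul hexpI
  simp only [one_mul] at h2
  have h3 := (h2.add hexpP).add (isBigO_eval_sub_sum hl Q n)
  refine h3.congr' ?_ EventuallyEq.rfl
  filter_upwards [hV] with z hz
  rw [hz, Complex.exp_add]
  have : ∑ m ∈ Finset.range n, Q.coeff m * z ^ m =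
      ∑ m ∈ Finset.range n, bCoeff h k m * z ^ m :=
    Finset.sum_congr rfl fun m hm => by rw [hQ m (Finset.mem_range.1 hm)]
  rw [this]; ring

theorem exp_VFun_sub_sum_isBigO (h k : ℕ) (hk : 0 < k) {M N : ℕ} (hMN : M < N)
    (hN : bCoeff h k N ≠ 0) (hzero : ∀ j, M < j → j < N → bCoeff h k j = 0) (κ : ℝ) :
    (fun z : ℂ => Complex.exp (VFun h k z)
        - ∑ m ∈ Finset.range (M + 1), bCoeff h k m * z ^ m)
      =O[𝓝[sector κ] 0] fun z : ℂ => bCoeff h k N * z ^ N := by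
  have h1 := exp_VFun_sub_sum_isBigO_pow h k hk κ N
  have h2 : ∀ z : ℂ, ∑ m ∈ Finset.range N, bCoeff h k m * z ^ m =
      ∑ m ∈ Finset.range (M + 1), bCoeff h k m * z ^ m := fun z => by
    symm
    refine Finset.sum_subset (Finset.range_mono hMN) fun j hj hj' => ?_
    rw [hzero j (by simpa using hj') (Finset.mem_range.1 hj), zero_mul]
  simp_rw [h2] at h1
  exact h1.trans (isBigO_self_const_mul hN _ _)

/-! ### Coefficients of the exponential of a factorially divergent series -/

theorem factorial_mul_factorial_le {i j : ℕ} (hi : 2 ≤ i) (hj : 2 ≤ j) :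
    j.factorial * i.factorial ≤ 2 * (i + j - 2).factorial := by
  induction j, hj using Nat.le_induction with
  | base => simp [Nat.factorial]
  | succ j hj ih =>
    have e : i + (j + 1) - 2 = (i + j - 2) + 1 := by lia
    rw [e, Nat.factorial_succ, Nat.factorial_succ]
    have : j + 1 ≤ i + j - 2 + 1 := by lia
    calc (j + 1) * j.factorial * i.factorial = (j + 1) * (j.factorial * i.factorial) := by ring
      _ ≤ (i + j - 2 + 1) * (2 * (i + j - 2).factorial) := Nat.mul_le_mul this ih
      _ = _ := by ring

/-- For `m ≥ 2` the two end terms equal `m!`; the `m - 2` inner ones are at most `2 (m-1)!` each,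
hence together at most `2 m!`. -/
theorem sum_factorial_mul_factorial_le (m : ℕ) :
    ∑ j ∈ Finset.range m, (j + 1).factorial * (m - j).factorial ≤ 4 * m.factorial := by
  match m with
  | 0 => simp
  | 1 => simp
  | r + 2 =>
    rw [Finset.sum_range_succ, Finset.sum_range_succ']
    have h1 : ∑ j ∈ Finset.range r, (j + 1 + 1).factorial * (r + 2 - (j + 1)).factorial ≤
        ∑ j ∈ Finset.range r, 2 * (r + 1).factorial := by
      refine Finset.sum_le_sum fun j hj => ?_
      have hj' := Finset.mem_range.1 hj
      refine (factorial_mul_factorial_le (by lia) (by lia)).trans (le_of_eq ?_)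
      congr 2; lia
    rw [Finset.sum_const, Finset.card_range, smul_eq_mul] at h1
    have e1 : r + 2 - (r + 1) = 1 := by lia
    rw [e1]
    simp only [Nat.factorial_one, Nat.sub_zero, zero_add, mul_one, one_mul]
    have h2 : (r + 2).factorial = (r + 2) * (r + 1).factorial := Nat.factorial_succ _
    have e2 : r + 1 + 1 = r + 2 := rfl
    rw [e2, h2]
    nlinarith

/-- In the recurrence the term `j = m` is exactly `(m+1) v (m+1)`. In the others the weight `j + 1`
is at most the factor `m + 1` on the left, and the convolution of factorials is `O(m!)`, a factor `m
+ 1` below `(m+1)!`. -/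
theorem exists_forall_norm_sub_le {b v : ℕ → ℂ} {A K : ℝ} (hA : 0 < A) (hK : 0 < K) (hb0 : b 0 = 1)
    (hrec : ∀ m : ℕ, ((m : ℂ) + 1) * b (m + 1) =
      ∑ j ∈ Finset.range (m + 1), ((j : ℂ) + 1) * v (j + 1) * b (m - j))
    (hv : ∀ j, 1 ≤ j → ‖v j‖ ≤ K * (A ^ j * j.factorial)) :
    ∃ K' : ℝ, 0 < K' ∧ ∀ m : ℕ,
      ‖b (m + 1) - v (m + 1)‖ ≤ K' / (m + 1) * (A ^ (m + 1) * (m + 1).factorial) := by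
  have hstep (m : ℕ) (U : ℝ) (hU : 0 < U) (hbU : ∀ i ≤ m, ‖b i‖ ≤ U * (A ^ i * i.factorial)) :
      ‖b (m + 1) - v (m + 1)‖ ≤ 4 * K * U / (m + 1) * (A ^ (m + 1) * (m + 1).factorial) := by
    have hm1 : ((m : ℂ) + 1) ≠ 0 := by exact_mod_cast m.succ_ne_zero
    have hm1' : ‖(m : ℂ) + 1‖ = m + 1 := by
      rw [← Nat.cast_succ, Complex.norm_natCast]; push_cast; rfl
    have h1 : ((m : ℂ) + 1) * (b (m + 1) - v (m + 1)) =
        ∑ j ∈ Finset.range m, ((j : ℂ) + 1) * v (j + 1) * b (m - j) := by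
      rw [mul_sub, hrec, Finset.sum_range_succ, Nat.sub_self, hb0]; ring
    have h2 : ‖∑ j ∈ Finset.range m, ((j : ℂ) + 1) * v (j + 1) * b (m - j)‖ ≤
        ∑ j ∈ Finset.range m, (m + 1) * (K * U * A ^ (m + 1)) *
          (((j + 1).factorial * (m - j).factorial : ℕ) : ℝ) := by
      refine norm_sum_le_of_le _ fun j hj => ?_
      have hj' := Finset.mem_range.1 hj
      have hj1 : ‖(j : ℂ) + 1‖ = j + 1 := by
        rw [← Nat.cast_succ, Complex.norm_natCast]; push_cast; rfl
      have hjm : (j : ℝ) + 1 ≤ m + 1 := by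
        have : (j : ℝ) ≤ m := by exact_mod_cast hj'.le
        linarith
      rw [norm_mul, norm_mul, hj1]
      calc _ ≤ ((m : ℝ) + 1) * (K * (A ^ (j + 1) * (j + 1).factorial)) *
            (U * (A ^ (m - j) * (m - j).factorial)) := by
              have a1 := hv (j + 1) (by lia)
              have a2 := hbU (m - j) (by lia)
              gcongr
        _ = (m + 1) * (K * U * (A ^ (j + 1) * A ^ (m - j))) *
          ((j + 1).factorial * (m - j).factorial) := by ring
        _ = _ := by
          rw [← pow_add, show j + 1 + (m - j) = m + 1 by lia]; push_cast; ring
    rw [← Finset.mul_sum, ← Nat.cast_sum, ← h1, norm_mul, hm1'] at h2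
    have h3 : ((∑ j ∈ Finset.range m, (j + 1).factorial * (m - j).factorial : ℕ) : ℝ) ≤
        4 * m.factorial := by exact_mod_cast sum_factorial_mul_factorial_le m
    have hmpos : (0 : ℝ) < m + 1 := by positivity
    have h4 : ((m : ℝ) + 1) * ‖b (m + 1) - v (m + 1)‖ ≤
        (m + 1) * ((K * U * A ^ (m + 1)) * (4 * m.factorial)) := by
      refine h2.trans ?_
      rw [mul_assoc]
      gcongr
    refine (le_of_mul_le_mul_left h4 hmpos).trans (le_of_eq ?_)
    rw [Nat.factorial_succ]; push_cast
    field_simp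
  -- Beyond `n₀` the difference costs at most `4KU/(m+1) ≤ U/2`, and `v` costs `K ≤ U/2`, so the
  -- bound `U` reproduces itself. The sum in `U` covers the indices up to `n₀`.
  obtain ⟨n₀, hn₀⟩ := exists_nat_ge (8 * K)
  set U : ℝ := 2 * K + ∑ i ∈ Finset.range (n₀ + 1), ‖b i‖ / (A ^ i * i.factorial)
  have hU2 : 2 * K ≤ U := le_add_of_nonneg_right (Finset.sum_nonneg fun i _ => by positivity)
  have hU : 0 < U := by linarith
  have hall : ∀ m i, i ≤ m → ‖b i‖ ≤ U * (A ^ i * i.factorial) := by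
    intro m
    induction m with
    | zero =>
      intro i hi
      obtain rfl : i = 0 := by lia
      rw [← div_le_iff₀ (by positivity)]
      have : ‖b 0‖ / (A ^ 0 * (0 : ℕ).factorial) ≤
        ∑ i ∈ Finset.range (n₀ + 1), ‖b i‖ / (A ^ i * i.factorial) :=
        Finset.single_le_sum (f := fun i => ‖b i‖ / (A ^ i * i.factorial))
          (fun i _ => by positivity) (by simp)
      linarith
    | succ m ih =>
      intro i hi
      rcases Nat.lt_or_ge i (m + 1) with h | h
      · exact ih i (by lia)
      obtain rfl : i = m + 1 := by lia
      rcases Nat.lt_or_ge (m + 1) (n₀ + 1) with h' | h'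
      · rw [← div_le_iff₀ (by positivity)]
        have : ‖b (m + 1)‖ / (A ^ (m + 1) * (m + 1).factorial) ≤
          ∑ i ∈ Finset.range (n₀ + 1), ‖b i‖ / (A ^ i * i.factorial) :=
          Finset.single_le_sum (f := fun i => ‖b i‖ / (A ^ i * i.factorial))
            (fun i _ => by positivity) (Finset.mem_range.2 h')
        linarith
      · have h1 := hstep m U hU ih
        have h2 := hv (m + 1) (by lia)
        have h3 : 4 * K * U / (m + 1) ≤ U / 2 := by
          have : (n₀ : ℝ) ≤ m + 1 := by exact_mod_cast (by lia : n₀ ≤ m + 1)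
          rw [div_le_iff₀ (by positivity)]
          nlinarith
        have h4 : (0 : ℝ) < A ^ (m + 1) * (m + 1).factorial := by positivity
        have h5 : ‖b (m + 1)‖ ≤ ‖b (m + 1) - v (m + 1)‖ + ‖v (m + 1)‖ := by
          simpa using norm_add_le (b (m + 1) - v (m + 1)) (v (m + 1))
        nlinarith [mul_le_mul_of_nonneg_right h3 h4.le, mul_le_mul_of_nonneg_right hU2 h4.le]
  exact ⟨4 * K * U, by positivity, fun m => hstep m U hU (hall m)⟩

/-! ### The size of `v^{(p)}_{h,k}` -/

/-- The Fourier series converges like `∑ n^{-p}`, so everything after the modes `±1` is `O(2^{-p})`.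
-/
theorem norm_bernoulliFun_fourier_sub_le {p : ℕ} (hp : 2 ≤ p) {x : ℝ} (hx : x ∈ Set.Icc (0 : ℝ) 1) :
    ‖-(2 * Real.pi * Complex.I) ^ p / p.factorial * bernoulliFun p x -
      (Complex.exp (2 * Real.pi * Complex.I * x) +
        (-1) ^ p * Complex.exp (-(2 * Real.pi * Complex.I * x)))‖ ≤ 16 / 2 ^ p := by
  have h := hasSum_one_div_nat_pow_mul_fourier hp hx
  set f : ℕ → ℂ := fun n : ℕ =>
    (1 : ℂ) / (n : ℂ) ^ p * (fourier n (x : UnitAddCircle) + (-1 : ℂ) ^ p * fourier (-n) (x : UnitAddCircle))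
  -- Two terms are removed: `n = 0`, which is `1 / 0 = 0`, and the main term `n = 1`.
  have h2 := (hasSum_nat_add_iff' (f := f) 2).2 h
  have e : ∑ i ∈ Finset.range 2, f i = Complex.exp (2 * Real.pi * Complex.I * x) +
        (-1) ^ p * Complex.exp (-(2 * Real.pi * Complex.I * x)) := by
    simp only [f, Finset.sum_range_succ, Finset.range_zero, Finset.sum_empty, fourier_coe_apply]
    simp [show p ≠ 0 by lia]
  rw [e] at h2
  have hsq : HasSum (fun n : ℕ => 1 / ((n : ℝ) + 1) ^ 2) (Real.pi ^ 2 / 6) := by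
    have := (hasSum_nat_add_iff' (f := fun n : ℕ => 1 / (n : ℝ) ^ 2) 1).2 hasSum_zeta_two
    simpa using this
  -- From `2 / (n+2)^p ≤ (8 / 2^p) / (n+1)²`; the final `16` uses `π²/6 ≤ 2`.
  have hbd := h2.norm_le_of_bounded (hsq.mul_left (8 / 2 ^ p)) fun n => by
    have hf : ‖f (n + 2)‖ ≤ 1 / ((n + 2 : ℕ) : ℝ) ^ p * 2 := by
      simp only [f]
      rw [norm_mul, norm_div, norm_one, norm_pow, Complex.norm_natCast]
      gcongr
      refine (norm_add_le _ _).trans ?_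
      rw [norm_mul, norm_pow, norm_neg, norm_one, one_pow, one_mul, fourier_apply, fourier_apply,
        Circle.norm_coe, Circle.norm_coe]
      norm_num
    refine hf.trans ?_
    obtain ⟨q, rfl⟩ : ∃ q, p = q + 2 := ⟨p - 2, by lia⟩
    have h3 : (2 : ℝ) ^ q * ((n : ℝ) + 1) ^ 2 ≤ ((n + 2 : ℕ) : ℝ) ^ (q + 2) := by
      rw [pow_add]
      push_cast
      have : (0 : ℝ) ≤ n := n.cast_nonneg
      gcongr <;> linarith
    have e2 : (8 : ℝ) / 2 ^ (q + 2) * (1 / ((n : ℝ) + 1) ^ 2) =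
        1 / (2 ^ q * ((n : ℝ) + 1) ^ 2) * 2 := by
      field_simp; ring
    rw [e2]
    gcongr
  refine hbd.trans ?_
  rw [div_mul_eq_mul_div]
  gcongr
  nlinarith [Real.pi_lt_d2, Real.pi_pos]

theorem sum_Icc_zpow_of_pow_eq_one {x : ℂ} {k : ℕ} (hx : x ^ k = 1) :
    ∑ d ∈ Finset.Icc 1 k, x ^ d = if x = 1 then (k : ℂ) else 0 := by
  split_ifs with h
  · simp [h]
  · have : ∑ d ∈ Finset.Icc 1 k, x ^ d = ∑ i ∈ Finset.range k, x ^ (i + 1) := by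
      rw [← Finset.Ico_add_one_right_eq_Icc, Finset.sum_Ico_eq_sum_range]
      simp [add_comm]
    rw [this]
    simp_rw [pow_succ]
    rw [← Finset.sum_mul, geom_sum_eq h, hx, sub_self, zero_div, zero_mul]

/-- Evaluation of the finite Gauss-type sums that give the leading term of `v^{(p)}`. -/
theorem sum_sum_zpow {ζ : ℂ} {h k : ℕ} (hk : 0 < k) (hζ : IsPrimitiveRoot ζ k) {u : ℤ}
    (hu : (k : ℤ) ∣ u * h - 1) (ε ε' : ℤ) :
    ∑ d ∈ Finset.Icc 1 k, ∑ d' ∈ Finset.Icc 1 k,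
      ζ ^ ((h * d * d' : ℤ)) * (ζ ^ (ε * d') * ζ ^ (ε' * d)) = k * ζ ^ (-(ε * ε' * u)) := by
  have hζ0 : ζ ≠ 0 := hζ.ne_zero hk.ne'
  obtain ⟨a, ha⟩ := hu
  -- The sum over `d'` is geometric and detects `h d ≡ -ε`, that is `d ≡ -ε u`, where `u` inverts
  -- `h` modulo `k`.
  have hin (d : ℕ) : ∑ d' ∈ Finset.Icc 1 k,
      ζ ^ ((h * d * d' : ℤ)) * (ζ ^ (ε * d') * ζ ^ (ε' * d)) =
      if (k : ℤ) ∣ d + ε * u then k * ζ ^ (-(ε * ε' * u)) else 0 := by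
    have e1 : ∀ d' : ℕ, ζ ^ ((h * d * d' : ℤ)) * (ζ ^ (ε * d') * ζ ^ (ε' * d)) =
        ζ ^ (ε' * d) * (ζ ^ (h * d + ε : ℤ)) ^ d' := fun d' => by
      rw [← zpow_natCast, ← zpow_mul, ← zpow_add₀ hζ0, ← zpow_add₀ hζ0, ← zpow_add₀ hζ0]
      congr 1; ring
    simp_rw [e1]
    rw [← Finset.mul_sum, sum_Icc_zpow_of_pow_eq_one (by
      rw [← zpow_natCast, ← zpow_mul, mul_comm, zpow_mul, zpow_natCast, hζ.pow_eq_one, one_zpow])]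
    have hiff : ζ ^ (h * d + ε : ℤ) = 1 ↔ (k : ℤ) ∣ d + ε * u := by
      rw [hζ.zpow_eq_one_iff_dvd]
      constructor
      · intro hd
        obtain ⟨b, hb⟩ := hd
        exact ⟨u * b - d * a, by linear_combination u * hb - d * ha⟩
      · intro hd
        obtain ⟨b, hb⟩ := hd
        exact ⟨h * b - ε * a, by linear_combination (h : ℤ) * hb - ε * ha⟩
    by_cases hd : (k : ℤ) ∣ d + ε * u
    · rw [if_pos hd, if_pos (hiff.2 hd), mul_comm]
      congr 1
      rw [← div_eq_one_iff_eq (zpow_ne_zero _ hζ0), ← zpow_sub₀ hζ0, hζ.zpow_eq_one_iff_dvd]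
      obtain ⟨b, hb⟩ := hd
      exact ⟨ε' * b, by linear_combination ε' * hb⟩
    · rw [if_neg hd, if_neg (fun h => hd (hiff.1 h)), mul_zero]
  simp_rw [hin]
  have hk' : (0 : ℤ) < k := by exact_mod_cast hk
  -- The shift by `1` puts the representative `r + 1` of `-ε u` into `1, …, k` instead of `0, …, k -
  -- 1`.
  set r := (-(ε * u) - 1) % k with hr
  have hr0 : 0 ≤ r := Int.emod_nonneg _ hk'.ne'
  have hrk : r < k := Int.emod_lt_of_pos _ hk'
  have hrd : (k : ℤ) ∣ (-(ε * u) - 1) - r := Int.dvd_self_sub_emod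
  rw [Finset.sum_eq_single (r.toNat + 1)]
  · rw [if_pos]
    have : ((r.toNat + 1 : ℕ) : ℤ) = r + 1 := by push_cast; lia
    rw [this]
    obtain ⟨b, hb⟩ := hrd
    exact ⟨-b, by linear_combination -hb⟩
  · intro d hd hne
    rw [if_neg]
    intro hdvd
    refine hne ?_
    have h1 := Finset.mem_Icc.1 hd
    have h2 : (k : ℤ) ∣ (d : ℤ) - (r + 1) := by
      obtain ⟨b, hb⟩ := hrd
      obtain ⟨c, hc⟩ := hdvd
      exact ⟨b + c, by linear_combination hb + hc⟩
    have h3 := Int.eq_zero_of_abs_lt_dvd h2 (by rw [abs_lt]; constructor <;> lia)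
    lia
  · intro hnot
    exact absurd (Finset.mem_Icc.2 ⟨by lia, by lia⟩) hnot

/-- The Bernoulli polynomial, normalized so that its leading Fourier coefficients are `±1`. -/
noncomputable def normBernoulli (p : ℕ) (x : ℝ) : ℂ :=
  -(2 * Real.pi * Complex.I) ^ p / p.factorial * bernoulliFun p x

/-- The leading Fourier modes of `normBernoulli`. -/
noncomputable def leadingModes (p : ℕ) (x : ℝ) : ℂ :=
  Complex.exp (2 * Real.pi * Complex.I * x) +
    (-1) ^ p * Complex.exp (-(2 * Real.pi * Complex.I * x))

/-- The scale `β_m = (k / 2π)^(2m+1) m!` of the coefficients. -/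
noncomputable def growthScale (k m : ℕ) : ℝ :=
  ((k : ℝ) / (2 * Real.pi)) ^ (2 * m + 1) * (m.factorial : ℝ)

theorem growthScale_pos {k : ℕ} (hk : 0 < k) (m : ℕ) : 0 < growthScale k m := by
  have : (0 : ℝ) < k := by exact_mod_cast hk
  unfold growthScale; positivity

theorem norm_leadingModes_le (p : ℕ) (x : ℝ) : ‖leadingModes p x‖ ≤ 2 := by
  have e1 : (2 * Real.pi * Complex.I * x : ℂ) = (2 * Real.pi * x : ℝ) * Complex.I := by
    push_cast; ring
  have e2 : -((2 * Real.pi * x : ℝ) * Complex.I) = (-(2 * Real.pi * x) : ℝ) * Complex.I := by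
    push_cast; ring
  refine (norm_add_le _ _).trans ?_
  rw [norm_mul, norm_pow, norm_neg, norm_one, one_pow, one_mul, e1, e2,
    Complex.norm_exp_ofReal_mul_I, Complex.norm_exp_ofReal_mul_I]
  norm_num

theorem leadingModes_add_two (p : ℕ) (x : ℝ) : leadingModes (p + 2) x = leadingModes p x := by
  simp [leadingModes, pow_add]

theorem norm_normBernoulli_mul_sub_le {p : ℕ} (hp : 2 ≤ p) {x y : ℝ} (hx : x ∈ Set.Icc (0 : ℝ) 1)
    (hy : y ∈ Set.Icc (0 : ℝ) 1) :
    ‖normBernoulli (p + 2) x * normBernoulli p y - leadingModes p x * leadingModes p y‖ ≤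
      128 / 2 ^ p := by
  have h1 : ‖normBernoulli (p + 2) x - leadingModes (p + 2) x‖ ≤ 16 / 2 ^ (p + 2) :=
    norm_bernoulliFun_fourier_sub_le (by lia) hx
  have h2 : ‖normBernoulli p y - leadingModes p y‖ ≤ 16 / 2 ^ p :=
    norm_bernoulliFun_fourier_sub_le hp hy
  rw [leadingModes_add_two] at h1
  have h1' : ‖normBernoulli (p + 2) x - leadingModes p x‖ ≤ 16 / 2 ^ p := by
    refine h1.trans ?_
    gcongr
    · norm_num
    · lia
  have h3 : (16 : ℝ) / 2 ^ p ≤ 4 := by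
    rw [div_le_iff₀ (by positivity)]
    have : (2 : ℝ) ^ 2 ≤ 2 ^ p := pow_le_pow_right₀ (by norm_num) hp
    linarith
  have h4 : ‖normBernoulli p y‖ ≤ 6 := by
    have := norm_add_le (normBernoulli p y - leadingModes p y) (leadingModes p y)
    rw [sub_add_cancel] at this
    linarith [norm_leadingModes_le p y]
  have e : normBernoulli (p + 2) x * normBernoulli p y - leadingModes p x * leadingModes p y =
      (normBernoulli (p + 2) x - leadingModes p x) * normBernoulli p y +
        leadingModes p x * (normBernoulli p y - leadingModes p y) := by ring
  rw [e]
  refine (norm_add_le _ _).trans ?_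
  rw [norm_mul, norm_mul]
  calc _ ≤ 16 / 2 ^ p * 6 + 2 * (16 / (2 : ℝ) ^ p) := by
        gcongr
        exact norm_leadingModes_le p x
    _ = 128 / 2 ^ p := by ring

/-- The sum that determines the size of `v^{(p)}_{h,k}`. -/
noncomputable def bernoulliSum (h k p : ℕ) : ℂ :=
  ∑ d ∈ Finset.Icc 1 k, ∑ d' ∈ Finset.Icc 1 k,
    omega h k ^ (d * d') * (normBernoulli (p + 2) ((d' : ℝ) / k) * normBernoulli p ((d : ℝ) / k))

/-- Normalizing the two Bernoulli polynomials releases `p! (p+2)! / (2πi)^{2p+2}` up to sign.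
Against `p! p (p+2)` this leaves `(p+1)!/p`, the source of the factorial growth. -/
theorem norm_vCoeff_eq (h : ℕ) {k p : ℕ} (hk : 0 < k) (hp : 1 ≤ p) :
    ‖vCoeff h k p‖ =
      growthScale k p * ((p + 1) / (p * (2 * Real.pi * k))) * ‖bernoulliSum h k p‖ := by
  have hpi : (2 * Real.pi * Complex.I : ℂ) ≠ 0 := by
    simp [Real.pi_ne_zero]
  have hp0 : (p : ℂ) ≠ 0 := by exact_mod_cast (by lia : p ≠ 0)
  have hp2 : (p : ℂ) + 2 ≠ 0 := by exact_mod_cast (by lia : p + 2 ≠ 0)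
  have hpf : (p.factorial : ℂ) ≠ 0 := by exact_mod_cast p.factorial_ne_zero
  have hpf2 : ((p + 2).factorial : ℂ) ≠ 0 := by exact_mod_cast (p + 2).factorial_ne_zero
  have hT : bernoulliSum h k p = (2 * Real.pi * Complex.I) ^ (2 * p + 2) /
      (p.factorial * (p + 2).factorial) * ∑ d ∈ Finset.Icc 1 k, ∑ d' ∈ Finset.Icc 1 k,
      omega h k ^ (d * d') *
        ((bernoulliFun (p + 2) ((d' : ℝ) / k) * bernoulliFun p ((d : ℝ) / k) : ℝ) : ℂ) := by
    rw [bernoulliSum, Finset.mul_sum]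
    refine Finset.sum_congr rfl fun d _ => ?_
    rw [Finset.mul_sum]
    refine Finset.sum_congr rfl fun d' _ => ?_
    rw [normBernoulli, normBernoulli]
    generalize (2 * Real.pi * Complex.I : ℂ) = c
    push_cast
    field_simp
    ring
  have hv : vCoeff h k p = (-(k : ℂ) ^ 2) ^ p * (p + 1).factorial /
      (p * (2 * Real.pi * Complex.I) ^ (2 * p + 2)) * bernoulliSum h k p := by
    rw [hT, vCoeff]
    generalize (∑ d ∈ Finset.Icc 1 k, ∑ d' ∈ Finset.Icc 1 k, omega h k ^ (d * d') *
        ((bernoulliFun (p + 2) ((d' : ℝ) / k) * bernoulliFun p ((d : ℝ) / k) : ℝ) : ℂ)) = T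
    have e : ((p + 2).factorial : ℂ) = (p + 2) * (p + 1).factorial := by
      rw [show p + 2 = (p + 1) + 1 by ring, Nat.factorial_succ]; push_cast; ring
    have hpf1 : ((p + 1).factorial : ℂ) ≠ 0 := by exact_mod_cast (p + 1).factorial_ne_zero
    have hc := pow_ne_zero (2 * p + 2) hpi
    generalize (2 * Real.pi * Complex.I : ℂ) ^ (2 * p + 2) = c at hc ⊢
    rw [e]
    field_simp
  rw [hv, norm_mul]
  congr 1
  have hk' : (0 : ℝ) < k := by exact_mod_cast hk
  rw [norm_div, norm_mul, norm_mul, norm_pow, norm_pow, norm_neg, norm_pow, norm_mul, norm_mul,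
    Complex.norm_natCast, Complex.norm_natCast, Complex.norm_natCast, Complex.norm_I,
    Complex.norm_real, Real.norm_of_nonneg Real.pi_pos.le, growthScale, Nat.factorial_succ]
  have hp0' : (p : ℝ) ≠ 0 := by exact_mod_cast (by lia : p ≠ 0)
  have hpi' := Real.pi_ne_zero
  simp only [Complex.norm_ofNat]
  push_cast
  rw [div_pow]
  field_simp
  ring

/-- The leading modes multiply out to four double sums evaluated by `sum_sum_zpow`, and `w = ζ^u`
with `u h ≡ 1` modulo `k`. Each of the `k²` pairs contributes an error of at most `128 / 2^p`. -/
theorem exists_bernoulliSum_sub_le {h k : ℕ} (hk : 0 < k) (hh : h ∈ coprimeResidues k) :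
    ∃ w : ℂ, ‖w‖ = 1 ∧ ∀ p, 2 ≤ p →
      ‖bernoulliSum h k p - 2 * k * (w⁻¹ + (-1) ^ p * w)‖ ≤ k ^ 2 * (128 / 2 ^ p) := by
  have hcop : Nat.Coprime h k := (Finset.mem_filter.1 hh).2
  obtain ⟨u, b, hub⟩ := Nat.isCoprime_iff_coprime.2 hcop
  have hu : (k : ℤ) ∣ u * h - 1 := ⟨-b, by linear_combination hub⟩
  set ζ : ℂ := Complex.exp (2 * Real.pi * Complex.I / k) with hζdef
  have hζ : IsPrimitiveRoot ζ k := Complex.isPrimitiveRoot_exp k hk.ne'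
  have hζ0 : ζ ≠ 0 := hζ.ne_zero hk.ne'
  have hω : omega h k = ζ ^ h := by
    rw [omega, hζdef, ← Complex.exp_nat_mul]; congr 1; ring
  have hmodes (p d : ℕ) : leadingModes p ((d : ℝ) / k) =
      ζ ^ ((1 : ℤ) * d) + (-1) ^ p * ζ ^ ((-1 : ℤ) * d) := by
    have e : Complex.exp (2 * Real.pi * Complex.I * ((d : ℝ) / k : ℝ)) = ζ ^ d := by
      rw [hζdef, ← Complex.exp_nat_mul]; congr 1; push_cast; ring
    rw [leadingModes, Complex.exp_neg, e]
    simp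
  refine ⟨ζ ^ u, by rw [norm_zpow, hζ.norm'_eq_one hk.ne', one_zpow], fun p hp => ?_⟩
  have hmain : ∑ d ∈ Finset.Icc 1 k, ∑ d' ∈ Finset.Icc 1 k,
      omega h k ^ (d * d') * (leadingModes p ((d' : ℝ) / k) * leadingModes p ((d : ℝ) / k)) =
      2 * k * ((ζ ^ u)⁻¹ + (-1) ^ p * ζ ^ u) := by
    have hsq : ((-1 : ℂ) ^ p) * (-1) ^ p = 1 := by rw [← mul_pow]; simp
    have e (d d' : ℕ) : omega h k ^ (d * d') *
        (leadingModes p ((d' : ℝ) / k) * leadingModes p ((d : ℝ) / k)) =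
        ζ ^ ((h * d * d' : ℤ)) * (ζ ^ ((1 : ℤ) * d') * ζ ^ ((1 : ℤ) * d)) +
        ζ ^ ((h * d * d' : ℤ)) * (ζ ^ ((-1 : ℤ) * d') * ζ ^ ((-1 : ℤ) * d)) +
        (-1) ^ p * (ζ ^ ((h * d * d' : ℤ)) * (ζ ^ ((1 : ℤ) * d') * ζ ^ ((-1 : ℤ) * d)) +
        ζ ^ ((h * d * d' : ℤ)) * (ζ ^ ((-1 : ℤ) * d') * ζ ^ ((1 : ℤ) * d))) := by
      have e1 : omega h k ^ (d * d') = ζ ^ ((h * d * d' : ℤ)) := by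
        rw [hω, ← pow_mul, ← zpow_natCast]; congr 1; push_cast; ring
      rw [e1, hmodes, hmodes]
      linear_combination (ζ ^ ((h * d * d' : ℤ)) * (ζ ^ ((-1 : ℤ) * d') * ζ ^ ((-1 : ℤ) * d))) * hsq
    simp_rw [e, Finset.sum_add_distrib, ← Finset.mul_sum, Finset.sum_add_distrib]
    rw [sum_sum_zpow hk hζ hu, sum_sum_zpow hk hζ hu, sum_sum_zpow hk hζ hu,
      sum_sum_zpow hk hζ hu, ← zpow_neg]
    simp only [mul_one, one_mul, neg_mul, mul_neg, neg_neg]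
    ring
  have hmem : ∀ d ∈ Finset.Icc 1 k, (d : ℝ) / k ∈ Set.Icc (0 : ℝ) 1 := fun d hd => by
    have hk' : (0 : ℝ) < k := by exact_mod_cast hk
    refine ⟨by positivity, (div_le_one hk').2 ?_⟩
    exact_mod_cast (Finset.mem_Icc.1 hd).2
  rw [← hmain, bernoulliSum, ← Finset.sum_sub_distrib]
  have hsum : (k : ℝ) ^ 2 * (128 / 2 ^ p) =
      ∑ d ∈ Finset.Icc 1 k, ∑ d' ∈ Finset.Icc 1 k, (128 : ℝ) / 2 ^ p := by
    simp; ring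
  rw [hsum]
  refine norm_sum_le_of_le _ fun d hd => ?_
  rw [← Finset.sum_sub_distrib]
  refine norm_sum_le_of_le _ fun d' hd' => ?_
  rw [← mul_sub, norm_mul, norm_pow, norm_omega, one_pow, one_mul]
  exact norm_normBernoulli_mul_sub_le hp (hmem d' hd') (hmem d hd)

/-- One parity gives a cosine and the other a sine, so either may vanish alone; their squared norms
add up to `4`. This is why the lower bounds concern two consecutive indices. -/
theorem one_le_norm_or_of_parallelogram {w : ℂ} (hw : ‖w‖ = 1) (p : ℕ) :
    1 ≤ ‖w⁻¹ + (-1) ^ p * w‖ ∨ 1 ≤ ‖w⁻¹ + (-1) ^ (p + 1) * w‖ := by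
  by_contra! hcon
  have h1 := parallelogram_law_with_norm ℝ w⁻¹ ((-1) ^ p * w)
  rw [norm_mul, norm_inv, norm_pow, norm_neg, norm_one, hw] at h1
  have e : w⁻¹ + (-1) ^ (p + 1) * w = w⁻¹ - (-1) ^ p * w := by rw [pow_succ]; ring
  rw [e] at hcon
  have n1 := norm_nonneg (w⁻¹ + (-1) ^ p * w)
  have n2 := norm_nonneg (w⁻¹ - (-1) ^ p * w)
  norm_num at h1
  nlinarith [hcon.1, hcon.2]

/-- Once the error is below `k`, the Bernoulli sum is at most `5k`, and at least `k` for the good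
parity. The prefactor turns these into `5(p+1)/(2πp) ≤ 2` and `(p+1)/(2πp) ≥ 1/7`, independent of
`h` and `k`. -/
theorem vCoeff_bounds {h k : ℕ} (hk : 0 < k) (hh : h ∈ coprimeResidues k) :
    ∀ᶠ p : ℕ in atTop, ‖vCoeff h k p‖ ≤ 2 * growthScale k p ∧
      (1 / 7 * growthScale k p ≤ ‖vCoeff h k p‖ ∨
        1 / 7 * growthScale k (p + 1) ≤ ‖vCoeff h k (p + 1)‖) := by
  obtain ⟨w, hw, hS⟩ := exists_bernoulliSum_sub_le hk hh
  have hk' : (0 : ℝ) < k := by exact_mod_cast hk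
  have hlim : Tendsto (fun p : ℕ => (k : ℝ) ^ 2 * (128 / 2 ^ p)) atTop (𝓝 0) := by
    have h1 := (tendsto_pow_atTop_nhds_zero_of_lt_one (r := (1 / 2 : ℝ)) (by norm_num)
      (by norm_num)).const_mul ((k : ℝ) ^ 2 * 128)
    rw [mul_zero] at h1
    refine h1.congr fun p => ?_
    rw [div_pow, one_pow]; ring
  have hup : ∀ p : ℕ, ‖w⁻¹ + (-1) ^ p * w‖ ≤ 2 := fun p => by
    refine (norm_add_le _ _).trans ?_
    rw [norm_mul, norm_inv, norm_pow, norm_neg, norm_one, hw]; norm_num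
  have hsmall := hlim.eventually (gt_mem_nhds hk')
  have hlow : ∀ p : ℕ, 2 ≤ p → (k : ℝ) ^ 2 * (128 / 2 ^ p) < k → 1 ≤ ‖w⁻¹ + (-1) ^ p * w‖ →
      1 / 7 * growthScale k p ≤ ‖vCoeff h k p‖ := fun p hp hs h1 => by
    have hT : (k : ℝ) ≤ ‖bernoulliSum h k p‖ := by
      have h2 := norm_sub_norm_le (2 * k * (w⁻¹ + (-1) ^ p * w)) (bernoulliSum h k p)
      rw [norm_sub_rev, norm_mul, norm_mul, Complex.norm_natCast, Complex.norm_ofNat] at h2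
      nlinarith [hS p hp]
    rw [norm_vCoeff_eq h hk (by lia)]
    have hp0 : (0 : ℝ) < p := by exact_mod_cast (by lia : 0 < p)
    have h3 : 1 / 7 ≤ ((p : ℝ) + 1) / (p * (2 * Real.pi * k)) * k := by
      have : ((p : ℝ) + 1) / (p * (2 * Real.pi * k)) * k = (p + 1) / (p * (2 * Real.pi)) := by
        field_simp
      rw [this, div_le_div_iff₀ (by norm_num) (by positivity)]
      nlinarith [Real.pi_lt_d2]
    have h4 := growthScale_pos hk p
    calc 1 / 7 * growthScale k p ≤ ((p : ℝ) + 1) / (p * (2 * Real.pi * k)) * k * growthScale k p := by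
          gcongr
      _ = growthScale k p * ((p + 1) / (p * (2 * Real.pi * k))) * k := by ring
      _ ≤ _ := by gcongr
  filter_upwards [hsmall, (tendsto_add_atTop_nat 1).eventually hsmall, eventually_ge_atTop 2]
    with p hs hs1 hp
  constructor
  · have hT : ‖bernoulliSum h k p‖ ≤ 5 * k := by
      have h2 := norm_sub_norm_le (bernoulliSum h k p) (2 * k * (w⁻¹ + (-1) ^ p * w))
      rw [norm_mul, norm_mul, Complex.norm_natCast, Complex.norm_ofNat] at h2
      nlinarith [hS p hp, hup p]
    rw [norm_vCoeff_eq h hk (by lia)]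
    have hp0 : (0 : ℝ) < p := by exact_mod_cast (by lia : 0 < p)
    have hp2 : (2 : ℝ) ≤ p := by exact_mod_cast hp
    have h3 : ((p : ℝ) + 1) / (p * (2 * Real.pi * k)) * (5 * k) ≤ 2 := by
      have : ((p : ℝ) + 1) / (p * (2 * Real.pi * k)) * (5 * k) = 5 * (p + 1) / (p * (2 * Real.pi)) := by
        field_simp
      rw [this, div_le_iff₀ (by positivity)]
      nlinarith [Real.pi_gt_three]
    have h4 := growthScale_pos hk p
    calc _ ≤ growthScale k p * ((p + 1) / (p * (2 * Real.pi * k))) * (5 * k) := by gcongr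
      _ = ((p : ℝ) + 1) / (p * (2 * Real.pi * k)) * (5 * k) * growthScale k p := by ring
      _ ≤ _ := by gcongr
  · rcases one_le_norm_or_of_parallelogram hw p with h1 | h1
    · exact Or.inl (hlow p hp hs h1)
    · exact Or.inr (hlow (p + 1) (by lia) hs1 h1)

/-! ### Growth of the coefficients `b` and divergence of their series -/

theorem bCoeff_sub_vCoeff_isLittleO {h k : ℕ} (hk : 0 < k) (hh : h ∈ coprimeResidues k) :
    (fun m => bCoeff h k m - vCoeff h k m) =o[atTop] fun m => growthScale k m := by
  have hk' : (0 : ℝ) < k := by exact_mod_cast hk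
  set A : ℝ := ((k : ℝ) / (2 * Real.pi)) ^ 2
  have hA : 0 < A := by positivity
  have hscale (m : ℕ) : growthScale k m = k / (2 * Real.pi) * (A ^ m * m.factorial) := by
    rw [growthScale, pow_succ, pow_mul]; ring
  have hO : (fun m => vCoeff h k m) =O[atTop] fun m => growthScale k m := by
    refine IsBigO.of_bound 2 ((vCoeff_bounds hk hh).mono fun p hp => ?_)
    rw [Real.norm_of_nonneg (growthScale_pos hk p).le]; exact hp.1
  obtain ⟨K, hK, hbd⟩ := bound_of_isBigO_nat_atTop hO
  obtain ⟨K', hK', hdiff⟩ := exists_forall_norm_sub_le (A := A) (K := K * (k / (2 * Real.pi)))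
    (b := bCoeff h k) (v := vCoeff h k) hA (by positivity) (bCoeff_zero h k) (succ_mul_bCoeff h k)
    (fun j _ => by
      have := hbd (x := j) (growthScale_pos hk j).ne'
      rw [Real.norm_of_nonneg (growthScale_pos hk j).le, hscale] at this
      linarith)
  have hev : ∀ m : ℕ, 1 ≤ m →
      ‖bCoeff h k m - vCoeff h k m‖ ≤ K' * (2 * Real.pi / k) / m * growthScale k m := fun m hm => by
    obtain ⟨r, rfl⟩ : ∃ r, m = r + 1 := ⟨m - 1, by lia⟩
    refine (hdiff r).trans (le_of_eq ?_)
    rw [hscale]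
    have := Real.pi_ne_zero
    push_cast
    field_simp
  refine IsLittleO.of_bound fun ε hε => ?_
  have hlim : Tendsto (fun m : ℕ => K' * (2 * Real.pi / k) / (m : ℝ)) atTop (𝓝 0) :=
    tendsto_const_div_atTop_nhds_zero_nat _
  filter_upwards [hlim.eventually (gt_mem_nhds hε), eventually_ge_atTop 1] with m hm hm1
  rw [Real.norm_of_nonneg (growthScale_pos hk m).le]
  refine (hev m hm1).trans ?_
  have := (growthScale_pos hk m).le
  gcongr

theorem bCoeff_bounds {h k : ℕ} (hk : 0 < k) (hh : h ∈ coprimeResidues k) :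
    ∀ᶠ m : ℕ in atTop, ‖bCoeff h k m‖ ≤ 3 * growthScale k m ∧
      (1 / 14 * growthScale k m ≤ ‖bCoeff h k m‖ ∨
        1 / 14 * growthScale k (m + 1) ≤ ‖bCoeff h k (m + 1)‖) := by
  have hsmall := (bCoeff_sub_vCoeff_isLittleO hk hh).bound (c := 1 / 14) (by norm_num)
  have hlow : ∀ m, ‖bCoeff h k m - vCoeff h k m‖ ≤ 1 / 14 * ‖growthScale k m‖ →
      1 / 7 * growthScale k m ≤ ‖vCoeff h k m‖ → 1 / 14 * growthScale k m ≤ ‖bCoeff h k m‖ :=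
    fun m h1 h2 => by
      rw [Real.norm_of_nonneg (growthScale_pos hk m).le] at h1
      have := norm_sub_norm_le (vCoeff h k m) (bCoeff h k m)
      rw [norm_sub_rev] at this
      linarith
  filter_upwards [hsmall, (tendsto_add_atTop_nat 1).eventually hsmall, vCoeff_bounds hk hh]
    with m h1 h2 h3
  refine ⟨?_, h3.2.imp (hlow m h1) (hlow (m + 1) h2)⟩
  rw [Real.norm_of_nonneg (growthScale_pos hk m).le] at h1
  have := norm_add_le (bCoeff h k m - vCoeff h k m) (vCoeff h k m)
  rw [sub_add_cancel] at this
  linarith [h3.1, growthScale_pos hk m]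

/-- The terms do not tend to `0`: of two consecutive ones, far out, one has norm at least `1`. -/
theorem not_summable_bCoeff {h k : ℕ} (hk : 0 < k) (hh : h ∈ coprimeResidues k) {z : ℂ}
    (hz : z ≠ 0) : ¬ Summable fun m : ℕ => bCoeff h k m * z ^ m := by
  intro hsum
  have hk' : (0 : ℝ) < k := by exact_mod_cast hk
  have hz' : 0 < ‖z‖ := norm_pos_iff.2 hz
  have h0 := hsum.tendsto_atTop_zero.norm
  rw [norm_zero] at h0
  set c : ℝ := k / (2 * Real.pi)
  have hc : 0 < c := by positivity
  have hgrow : Tendsto (fun m : ℕ => growthScale k m * ‖z‖ ^ m) atTop atTop := by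
    have h1 := FloorSemiring.tendsto_pow_div_factorial_atTop ((c ^ 2 * ‖z‖)⁻¹)
    have h2 : Tendsto (fun m : ℕ => ((c ^ 2 * ‖z‖)⁻¹ ^ m / m.factorial)⁻¹) atTop atTop :=
      Tendsto.inv_tendsto_nhdsGT_zero (tendsto_nhdsWithin_iff.2
        ⟨h1, Eventually.of_forall fun m => by simp only [Set.mem_Ioi]; positivity⟩)
    refine (h2.const_mul_atTop hc).congr fun m => ?_
    rw [inv_div, inv_pow, div_inv_eq_mul, mul_pow]
    change _ = c ^ (2 * m + 1) * m.factorial * _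
    ring_nf
  have hsmall := h0.eventually (gt_mem_nhds (show (0 : ℝ) < 1 by norm_num))
  -- `14` compensates the lower constant `1/14` of `bCoeff_bounds`.
  have hbig := hgrow.eventually (eventually_ge_atTop 14)
  obtain ⟨m, ⟨⟨⟨hm1, hm2⟩, hm3⟩, hm4⟩, hm5⟩ := ((((bCoeff_bounds hk hh).and hsmall).and
    ((tendsto_add_atTop_nat 1).eventually hsmall)).and hbig).and
    ((tendsto_add_atTop_nat 1).eventually hbig) |>.exists
  have key : ∀ j, 1 / 14 * growthScale k j ≤ ‖bCoeff h k j‖ → ‖bCoeff h k j * z ^ j‖ < 1 →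
      14 ≤ growthScale k j * ‖z‖ ^ j → False := fun j h1 h2 h3 => by
    rw [norm_mul, norm_pow] at h2
    nlinarith [mul_le_mul_of_nonneg_right h1 (pow_nonneg hz'.le j)]
  rcases hm1.2 with h | h
  · exact key m h hm2 hm4
  · exact key (m + 1) h hm3 hm5

theorem exists_next_bCoeff_ne_zero {h k : ℕ} (hk : 0 < k) (hh : h ∈ coprimeResidues k) (M : ℕ) :
    ∃ N, M < N ∧ bCoeff h k N ≠ 0 ∧ ∀ j, M < j → j < N → bCoeff h k j = 0 := by
  have hex : ∃ N, M < N ∧ bCoeff h k N ≠ 0 := by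
    obtain ⟨m, hm, hm'⟩ := ((bCoeff_bounds hk hh).and (eventually_gt_atTop M)).exists
    have hne : ∀ j, 1 / 14 * growthScale k j ≤ ‖bCoeff h k j‖ → bCoeff h k j ≠ 0 := fun j hj h0 => by
      rw [h0, norm_zero] at hj
      linarith [growthScale_pos hk j]
    rcases hm.2 with h1 | h1
    · exact ⟨m, hm', hne m h1⟩
    · exact ⟨m + 1, by lia, hne _ h1⟩
  classical
  refine ⟨Nat.find hex, (Nat.find_spec hex).1, (Nat.find_spec hex).2, fun j hj hjN => ?_⟩
  by_contra h0
  exact Nat.find_min hex hjN ⟨hj, h0⟩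

/-! ### The loop integral -/

/-- Integrability of a function along the loop. -/
def LoopIntegrable (f : ℂ → ℂ) : Prop :=
  IntervalIntegrable (fun t : ℝ => f (t * (1 - √3 * Complex.I))) MeasureTheory.volume 0 1 ∧
    IntervalIntegrable (fun y : ℝ => f (1 + y * Complex.I)) MeasureTheory.volume (-√3) √3 ∧
    IntervalIntegrable (fun t : ℝ => f (t * (1 + √3 * Complex.I))) MeasureTheory.volume 0 1

theorem intervalIntegrable_zero_one_of_bound {f : ℝ → ℂ} (hf : ContinuousOn f (Set.Ioc 0 1)) {B : ℝ}
    (hB : ∀ t ∈ Set.Ioc (0 : ℝ) 1, ‖f t‖ ≤ B) :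
    IntervalIntegrable f MeasureTheory.volume 0 1 := by
  rw [intervalIntegrable_iff_integrableOn_Ioc_of_le zero_le_one]
  exact MeasureTheory.IntegrableOn.of_bound (by simp)
    (hf.aestronglyMeasurable measurableSet_Ioc) B
    ((MeasureTheory.ae_restrict_iff' measurableSet_Ioc).2 (Eventually.of_forall hB))

/-- A bound is needed only on the rays, where the loop runs into the vertex; the vertical segment is
compact in the open half-plane. -/
theorem LoopIntegrable.of_bound {f : ℂ → ℂ} (hf : ContinuousOn f {z | 0 < z.re}) {B : ℝ}
    (hB : ∀ z : ℂ, 0 < z.re → z.re ≤ 1 → |z.im| = √3 * z.re → ‖f z‖ ≤ B) : LoopIntegrable f := by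
  have h3 : (0 : ℝ) ≤ √3 := Real.sqrt_nonneg 3
  refine ⟨intervalIntegrable_zero_one_of_bound (B := B) ?_ fun t ht => ?_, ?_,
    intervalIntegrable_zero_one_of_bound (B := B) ?_ fun t ht => ?_⟩
  · exact hf.comp (by fun_prop) fun t ht => by simpa using ht.1
  · refine hB _ (by simpa using ht.1) (by simpa using ht.2) ?_
    simp [abs_mul, abs_of_pos ht.1, abs_of_nonneg h3, mul_comm]
  · refine Continuous.intervalIntegrable ?_ _ _
    exact hf.comp_continuous (by fun_prop) fun y => by simp
  · exact hf.comp (by fun_prop) fun t ht => by simpa using ht.1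
  · refine hB _ (by simpa using ht.1) (by simpa using ht.2) ?_
    simp [abs_mul, abs_of_pos ht.1, abs_of_nonneg h3, mul_comm]

theorem loopIntegral_congr {f g : ℂ → ℂ} (hfg : ∀ z : ℂ, 0 < z.re → f z = g z) :
    loopIntegral f = loopIntegral g := by
  unfold loopIntegral
  congr 1
  congr 1
  · congr 1
    · rw [intervalIntegral.integral_of_le zero_le_one, intervalIntegral.integral_of_le zero_le_one]
      refine MeasureTheory.setIntegral_congr_fun measurableSet_Ioc fun t ht => ?_
      rw [hfg _ (by simpa using ht.1)]
    · refine intervalIntegral.integral_congr fun y _ => ?_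
      rw [hfg _ (by simp)]
  · rw [intervalIntegral.integral_of_le zero_le_one, intervalIntegral.integral_of_le zero_le_one]
    refine MeasureTheory.setIntegral_congr_fun measurableSet_Ioc fun t ht => ?_
    rw [hfg _ (by simpa using ht.1)]

theorem loopIntegral_const_mul (a : ℂ) (f : ℂ → ℂ) :
    loopIntegral (fun z => a * f z) = a * loopIntegral f := by
  simp only [loopIntegral, mul_assoc a, intervalIntegral.integral_const_mul]
  ring

theorem LoopIntegrable.const_mul {f : ℂ → ℂ} (hf : LoopIntegrable f) (a : ℂ) :
    LoopIntegrable fun z => a * f z :=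
  ⟨hf.1.const_mul a, hf.2.1.const_mul a, hf.2.2.const_mul a⟩

theorem LoopIntegrable.sub {f g : ℂ → ℂ} (hf : LoopIntegrable f) (hg : LoopIntegrable g) :
    LoopIntegrable fun z => f z - g z :=
  ⟨hf.1.sub hg.1, hf.2.1.sub hg.2.1, hf.2.2.sub hg.2.2⟩

theorem loopIntegral_sub {f g : ℂ → ℂ} (hf : LoopIntegrable f) (hg : LoopIntegrable g) :
    loopIntegral (fun z => f z - g z) = loopIntegral f - loopIntegral g := by
  simp only [loopIntegral, sub_mul]
  rw [intervalIntegral.integral_sub (hf.1.mul_const _) (hg.1.mul_const _),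
    intervalIntegral.integral_sub (hf.2.1.mul_const _) (hg.2.1.mul_const _),
    intervalIntegral.integral_sub (hf.2.2.mul_const _) (hg.2.2.mul_const _)]
  ring

theorem loopIntegral_sub_sum {f : ℂ → ℂ} {g : ℕ → ℂ → ℂ} (hf : LoopIntegrable f)
    (hg : ∀ m, LoopIntegrable (g m)) (n : ℕ) :
    LoopIntegrable (fun z => f z - ∑ m ∈ Finset.range n, g m z) ∧
    loopIntegral (fun z => f z - ∑ m ∈ Finset.range n, g m z) =
      loopIntegral f - ∑ m ∈ Finset.range n, loopIntegral (g m) := by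
  induction n with
  | zero => simpa using hf
  | succ n ih =>
    have e : ∀ z, f z - ∑ m ∈ Finset.range (n + 1), g m z =
        (f z - ∑ m ∈ Finset.range n, g m z) - g n z := fun z => by
      rw [Finset.sum_range_succ]; ring
    simp_rw [e]
    refine ⟨ih.1.sub (hg n), ?_⟩
    rw [loopIntegral_sub ih.1 (hg n), ih.2, Finset.sum_range_succ]
    ring

/-! ### Independence of the size of the loop -/

theorem intervalIntegral_line_eq_sub {f F : ℂ → ℂ} {U : Set ℂ} (hf : ContinuousOn f U)
    (hF : ∀ z ∈ U, HasDerivAt F (f z) z) {p q : ℂ} {a b : ℝ}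
    (hU : ∀ t ∈ Set.uIcc a b, p + t * q ∈ U) :
    ∫ t in a..b, f (p + t * q) * q = F (p + b * q) - F (p + a * q) := by
  refine intervalIntegral.integral_eq_sub_of_hasDerivAt (f := fun t : ℝ => F (p + t * q))
    (fun t ht => ?_) ?_
  · have h1 : HasDerivAt (fun t : ℝ => p + t * q) q t := by
      simpa using ((Complex.ofRealCLM.hasDerivAt (x := t)).mul_const q).const_add p
    exact (hF _ (hU t ht)).comp t h1
  · refine ContinuousOn.intervalIntegrable ?_
    exact (hf.comp (by fun_prop) hU).mul continuousOn_const

/-- By Cauchy's theorem, the loop may be rescaled. -/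
theorem loopIntegral_comp_mul {f : ℂ → ℂ} (hf : DifferentiableOn ℂ f {z | 0 < z.re})
    (hint : LoopIntegrable f) {R : ℝ} (hR : 0 < R) :
    loopIntegral (fun z => R * f (R * z)) = loopIntegral f := by
  -- The disc with centre and radius `X` avoids `0` and contains every point of the sector with `2
  -- Re z < X`, since there `|z|² ≤ 4 (Re z)² < 2X Re z`. Both vertical segments lie in it, and a
  -- disc carries a primitive `F`.
  set X : ℝ := 2 * max 1 R + 1
  have hX1 : 2 * 1 < X := by have := le_max_left 1 R; simp only [X]; linarith
  have hXR : 2 * R < X := by have := le_max_right 1 R; simp only [X]; linarith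
  set U := Metric.ball (X : ℂ) X
  have hUre : U ⊆ {z | 0 < z.re} := fun z hz => by
    rw [Metric.mem_ball, Complex.dist_eq] at hz
    have := (Complex.abs_re_le_norm (z - X)).trans_lt hz
    simp only [Complex.sub_re, Complex.ofReal_re] at this
    have := abs_lt.1 this
    simp only [Set.mem_ofPred_eq]; linarith
  have hfU := hf.mono hUre
  obtain ⟨F, hF⟩ := hfU.isExactOn_ball
  have hmem (z : ℂ) (h0 : 0 < z.re) (h1 : 2 * z.re < X) (h2 : z.im ^ 2 ≤ 3 * z.re ^ 2) :
      z ∈ U := by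
    rw [Metric.mem_ball, Complex.dist_eq]
    have hX0 : 0 < X := by linarith
    refine lt_of_pow_lt_pow_left₀ 2 hX0.le ?_
    rw [← Complex.normSq_eq_norm_sq, Complex.normSq_apply]
    simp only [Complex.sub_re, Complex.ofReal_re, Complex.sub_im, Complex.ofReal_im, sub_zero]
    nlinarith
  have hsq : (√3 : ℝ) ^ 2 = 3 := Real.sq_sqrt (by norm_num)
  -- The part of the ray near the vertex is common to both loops, so `F` is never needed at `0`. The
  -- differences of `F` cancel against those of the vertical segments.
  have hray (u : ℂ) (hu1 : u.re = 1) (hu2 : u.im ^ 2 = 3)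
      (hi : IntervalIntegrable (fun t : ℝ => f (t * u)) MeasureTheory.volume 0 1) :
      ∫ t in (0 : ℝ)..1, R * f (R * (t * u)) * u =
        (∫ t in (0 : ℝ)..1, f (t * u) * u) + (F (R * u) - F u) := by
    have e1 : ∫ t in (0 : ℝ)..1, R * f (R * (t * u)) * u = ∫ t in (0 : ℝ)..R, f (t * u) * u := by
      have := intervalIntegral.smul_integral_comp_mul_left (a := 0) (b := 1)
        (fun t : ℝ => f (t * u) * u) R
      rw [mul_zero, mul_one] at this
      rw [← this, ← intervalIntegral.integral_smul]
      refine intervalIntegral.integral_congr fun t _ => ?_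
      simp only [Complex.real_smul, Complex.ofReal_mul]
      rw [mul_assoc, mul_assoc]
    have hU : ∀ t ∈ Set.uIcc 1 R, (0 : ℂ) + t * u ∈ U := fun t ht => by
      have h1 : 0 < t := lt_of_lt_of_le (lt_min one_pos hR) ht.1
      have h2 : 2 * t < X := by
        have := ht.2
        simp only [X]; linarith
      refine hmem _ (by simpa [hu1] using h1) (by simpa [hu1] using h2) ?_
      simp [hu1, mul_pow, hu2]; linarith
    have e2 := intervalIntegral_line_eq_sub hfU.continuousOn hF hU
    have hi2 : IntervalIntegrable (fun t : ℝ => f (t * u) * u) MeasureTheory.volume 1 R := by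
      have : ContinuousOn (fun t : ℝ => f ((0 : ℂ) + t * u) * u) (Set.uIcc 1 R) :=
        (hfU.continuousOn.comp (by fun_prop) hU).mul continuousOn_const
      simpa using this.intervalIntegrable
    simp only [zero_add, Complex.ofReal_one, one_mul] at e2
    rw [e1, ← intervalIntegral.integral_add_adjacent_intervals (hi.mul_const u) hi2, e2]
  have hvert (r : ℝ) (hr : 0 < r) (hrX : 2 * r < X) :
      ∫ y in (-√3 : ℝ)..√3, r * f (r * (1 + y * Complex.I)) * Complex.I =
        F (r * (1 + √3 * Complex.I)) - F (r * (1 - √3 * Complex.I)) := by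
    have hU : ∀ y ∈ Set.uIcc (-√3) √3, (r : ℂ) + y * (r * Complex.I) ∈ U := fun y hy => by
      rw [Set.uIcc_of_le (by linarith [Real.sqrt_nonneg 3])] at hy
      have hy2 : y ^ 2 ≤ 3 := by rw [← hsq]; exact sq_le_sq' hy.1 hy.2
      refine hmem _ (by simpa using hr) (by simpa using hrX) ?_
      simp [mul_pow]; nlinarith [sq_nonneg r]
    have e := intervalIntegral_line_eq_sub hfU.continuousOn hF hU
    rw [show (r : ℂ) * (1 + √3 * Complex.I) = r + (√3 : ℝ) * (r * Complex.I) by ring,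
      show (r : ℂ) * (1 - √3 * Complex.I) = r + (-√3 : ℝ) * (r * Complex.I) by push_cast; ring, ← e]
    refine intervalIntegral.integral_congr fun y _ => ?_
    rw [show (r : ℂ) * (1 + y * Complex.I) = r + y * (r * Complex.I) by ring]
    ring
  have v1 := hvert 1 one_pos (by linarith)
  have vR := hvert R hR hXR
  simp only [Complex.ofReal_one, one_mul] at v1
  unfold loopIntegral
  rw [hray _ (by simp) (by simp [hsq]) hint.1, hray _ (by simp) (by simp [hsq]) hint.2.2, vR, v1]
  ring

/-! ### Differentiation under the loop integral -/

theorem hasDerivAt_intervalIntegral_mul_exp {G γ : ℝ → ℂ} {a b : ℝ} (hγ : Continuous γ)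
    (hG : IntervalIntegrable G MeasureTheory.volume a b) (x : ℝ) :
    HasDerivAt (fun x : ℝ => ∫ t in a..b, G t * Complex.exp (x * γ t))
      (∫ t in a..b, G t * (γ t * Complex.exp (x * γ t))) x := by
  obtain ⟨B, hB⟩ := isCompact_uIcc.exists_bound_of_continuousOn (s := Set.uIcc a b) hγ.continuousOn
  have hB0 : 0 ≤ B := (norm_nonneg _).trans (hB a Set.left_mem_uIcc)
  refine (intervalIntegral.hasDerivAt_integral_of_dominated_loc_of_deriv_le
    (F := fun (x : ℝ) t => G t * Complex.exp (x * γ t))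
    (F' := fun (x : ℝ) t => G t * (γ t * Complex.exp (x * γ t)))
    (bound := fun t => ‖G t‖ * (B * Real.exp ((|x| + 1) * B)))
    (Metric.ball_mem_nhds x one_pos) ?_ ?_ ?_ ?_ ?_ ?_).2
  · refine Eventually.of_forall fun y => ?_
    exact (intervalIntegrable_iff.1 (hG.mul_continuousOn
      (by fun_prop : Continuous fun t => Complex.exp (y * γ t)).continuousOn)).aestronglyMeasurable
  · exact hG.mul_continuousOn (by fun_prop : Continuous fun t => Complex.exp (x * γ t)).continuousOn
  · exact (intervalIntegrable_iff.1 (hG.mul_continuousOn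
      (by fun_prop : Continuous fun t => γ t * Complex.exp (x * γ t)).continuousOn)).aestronglyMeasurable
  · refine Eventually.of_forall fun t ht y hy => ?_
    have hγt := hB t (Set.uIoc_subset_uIcc ht)
    have hy' : |y| ≤ |x| + 1 := by
      rw [Metric.mem_ball, Real.dist_eq] at hy
      have := abs_sub_abs_le_abs_sub y x
      linarith
    rw [norm_mul, norm_mul]
    gcongr
    refine (Complex.norm_exp_le_exp_norm _).trans (Real.exp_le_exp.2 ?_)
    rw [norm_mul, Complex.norm_real, Real.norm_eq_abs]
    gcongr
  · exact hG.norm.mul_const _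
  · refine Eventually.of_forall fun t _ y _ => ?_
    have h1 : HasDerivAt (fun y : ℝ => (y : ℂ) * γ t) (γ t) y := by
      simpa using (Complex.ofRealCLM.hasDerivAt (x := y)).mul_const (γ t)
    refine (h1.cexp.const_mul (G t)).congr_deriv ?_
    ring

theorem hasDerivAt_loopIntegral {g : ℂ → ℂ} (hg : LoopIntegrable g) (α x : ℝ) :
    HasDerivAt (fun x : ℝ => loopIntegral fun z => g z * Complex.exp (x * (α * z)))
      (loopIntegral fun z => α * (z * g z * Complex.exp (x * (α * z)))) x := by
  have key (γ : ℝ → ℂ) (hγ : Continuous γ) (q : ℂ) (a b : ℝ)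
      (hi : IntervalIntegrable (fun t => g (γ t)) MeasureTheory.volume a b) :
      HasDerivAt (fun x : ℝ => ∫ t in a..b, g (γ t) * Complex.exp (x * (α * γ t)) * q)
        (∫ t in a..b, α * (γ t * g (γ t) * Complex.exp (x * (α * γ t))) * q) x := by
    have h1 := hasDerivAt_intervalIntegral_mul_exp (γ := fun t => α * γ t) (by fun_prop)
      (hi.mul_const q) x
    refine (h1.congr_deriv ?_).congr_of_eventuallyEq (Eventually.of_forall fun y => ?_)
    · refine intervalIntegral.integral_congr fun t _ => ?_
      ring
    · refine intervalIntegral.integral_congr fun t _ => ?_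
      ring
  unfold loopIntegral
  exact (((key _ (by fun_prop) _ _ _ hg.1).add (key _ (by fun_prop) _ _ _ hg.2.1)).sub
    (key _ (by fun_prop) _ _ _ hg.2.2)).const_mul _

/-! ### Laplace's method on the loop -/

theorem norm_cpow_ofReal_exponent {z : ℂ} (hz : z ≠ 0) (ρ : ℝ) : ‖z ^ (ρ : ℂ)‖ = ‖z‖ ^ ρ := by
  rw [Complex.norm_cpow_of_ne_zero hz]; simp

theorem re_one_div_sq (z : ℂ) : (1 / z ^ 2).re = (z.re ^ 2 - z.im ^ 2) / (z.re ^ 2 + z.im ^ 2) ^ 2 := by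
  rw [one_div, Complex.inv_re, map_pow, Complex.normSq_apply]
  congr 1
  · rw [pow_two, Complex.mul_re]; ring
  · ring

/-- On `arg z = ±π/3` the argument of `1/z²` is `∓2π/3`, so `exp (c / z²)` stays bounded at the
vertex. -/
theorem re_one_div_sq_nonpos {z : ℂ} (hz : |z.im| = √3 * z.re) : (1 / z ^ 2).re ≤ 0 := by
  rw [re_one_div_sq]
  have h : z.im ^ 2 = 3 * z.re ^ 2 := by
    rw [← sq_abs, hz, mul_pow, Real.sq_sqrt (by norm_num)]
  exact div_nonpos_of_nonpos_of_nonneg (by rw [h]; nlinarith [sq_nonneg z.re]) (by positivity)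

theorem norm_le_two_of_mem {z : ℂ} (hz : z ∈ sector √3) (h1 : z.re ≤ 1) : ‖z‖ ≤ 2 := by
  have h3 : (√3 : ℝ) ^ 2 = 3 := Real.sq_sqrt (by norm_num)
  have h2 : z.im ^ 2 ≤ 3 * z.re ^ 2 := by
    rw [← sq_abs, ← h3, ← mul_pow]
    exact pow_le_pow_left₀ (abs_nonneg _) hz.2 2
  refine (abs_le_of_sq_le_sq' ?_ (by norm_num)).2
  rw [← Complex.normSq_eq_norm_sq, Complex.normSq_apply]
  nlinarith [hz.1]

theorem ray_mem {u : ℂ} (hu1 : u.re = 1) (hu2 : |u.im| = √3) {t : ℝ} (ht : 0 < t) :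
    (t * u : ℂ) ∈ sector √3 ∧ |(t * u : ℂ).im| = √3 * (t * u : ℂ).re := by
  have h : |(t * u : ℂ).im| = √3 * (t * u : ℂ).re := by
    simp [hu1, hu2, abs_mul, abs_of_pos ht, mul_comm]
  exact ⟨⟨by simpa [hu1] using ht, h.le⟩, h⟩

theorem vertical_mem {y : ℝ} (hy : |y| ≤ √3) : (1 + y * Complex.I : ℂ) ∈ sector √3 :=
  ⟨by simp, by simpa using hy⟩

/-- On the rays the phase has real part at most `2`, against `3` at the saddle point, so they are
exponentially negligible. -/
theorem norm_ray_integral_le {ρ lam B : ℝ} (hρ : 0 ≤ ρ) (hl : 0 ≤ lam) {g : ℂ → ℂ}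
    (hg : ∀ z ∈ sector √3, z.re ≤ 1 → ‖g z‖ ≤ B) {u : ℂ} (hu1 : u.re = 1) (hu2 : |u.im| = √3) :
    ‖∫ t in (0 : ℝ)..1, (t * u) ^ (ρ : ℂ) * g (t * u) *
      Complex.exp (lam * (1 / (t * u) ^ 2 + 2 * (t * u))) * u‖ ≤
        2 ^ ρ * B * Real.exp (2 * lam) * 2 := by
  have h : ∀ t ∈ Set.uIoc (0 : ℝ) 1, ‖(t * u) ^ (ρ : ℂ) * g (t * u) *
      Complex.exp (lam * (1 / (t * u) ^ 2 + 2 * (t * u))) * u‖ ≤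
        2 ^ ρ * B * Real.exp (2 * lam) * 2 := fun t ht => by
    rw [Set.uIoc_of_le zero_le_one] at ht
    obtain ⟨hs, hr⟩ := ray_mem hu1 hu2 ht.1
    have hre : (t * u : ℂ).re = t := by simp [hu1]
    have h1 : (t * u : ℂ).re ≤ 1 := by rw [hre]; exact ht.2
    have hB := hg _ hs h1
    have hB0 : 0 ≤ B := (norm_nonneg _).trans hB
    have hn := norm_le_two_of_mem hs h1
    have hun : ‖u‖ ≤ 2 := norm_le_two_of_mem
      ⟨by rw [hu1]; norm_num, by rw [hu1, hu2]; simp⟩ hu1.le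
    rw [norm_mul, norm_mul, norm_mul, norm_cpow_ofReal_exponent (sector_ne_zero hs)]
    gcongr
    rw [Complex.norm_exp]
    gcongr
    rw [Complex.re_ofReal_mul, Complex.add_re]
    have h2 := re_one_div_sq_nonpos hr
    have h3 : (2 * (t * u : ℂ)).re = 2 * t := by
      rw [show (2 : ℂ) = ((2 : ℝ) : ℂ) by norm_num, Complex.re_ofReal_mul, hre]
    rw [h3]
    nlinarith [ht.2]
  simpa using intervalIntegral.norm_integral_le_of_norm_le_const h

/-- Quadratic descent from the saddle value `3` along the whole segment. The coefficient is far from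
the local value `3`; any positive one would give a Gaussian majorant. -/
theorem re_phase_vertical_le {y : ℝ} (hy : |y| ≤ √3) :
    (1 / (1 + y * Complex.I) ^ 2 + 2 * (1 + y * Complex.I) : ℂ).re ≤ 3 - 3 / 16 * y ^ 2 := by
  have h2 : y ^ 2 ≤ 3 := by
    rw [← sq_abs, ← Real.sq_sqrt (show (0 : ℝ) ≤ 3 by norm_num)]
    exact pow_le_pow_left₀ (abs_nonneg _) hy 2
  rw [Complex.add_re, re_one_div_sq]
  have e1 : (1 + y * Complex.I : ℂ).re = 1 := by simp
  have e2 : (1 + y * Complex.I : ℂ).im = y := by simp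
  have e3 : (2 * (1 + y * Complex.I) : ℂ).re = 2 := by simp
  rw [e1, e2, e3]
  have : (1 ^ 2 - y ^ 2) / (1 ^ 2 + y ^ 2) ^ 2 ≤ 1 - 3 / 16 * y ^ 2 := by
    rw [div_le_iff₀ (by positivity)]
    have hs := sq_nonneg y
    generalize y ^ 2 = s at *
    nlinarith [mul_nonneg hs (sub_nonneg.2 h2), mul_nonneg hs (mul_nonneg hs (sub_nonneg.2 h2))]
  linarith

theorem norm_vertical_integrand_le {ρ lam B : ℝ} (hρ : 0 ≤ ρ) (hl : 0 ≤ lam) {g : ℂ → ℂ}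
    (hg : ∀ z ∈ sector √3, z.re ≤ 1 → ‖g z‖ ≤ B) {y : ℝ} (hy : |y| ≤ √3) :
    ‖(1 + y * Complex.I) ^ (ρ : ℂ) * g (1 + y * Complex.I) * Complex.exp (lam *
      (1 / (1 + y * Complex.I) ^ 2 + 2 * (1 + y * Complex.I))) * Complex.I‖ ≤
        2 ^ ρ * B * Real.exp (3 * lam) * Real.exp (-(3 / 16 * lam) * y ^ 2) := by
  have hs := vertical_mem hy
  have h1 : (1 + y * Complex.I : ℂ).re ≤ 1 := by simp
  have hB := hg _ hs h1
  have hB0 : 0 ≤ B := (norm_nonneg _).trans hB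
  have hn := norm_le_two_of_mem hs h1
  rw [norm_mul, norm_mul, norm_mul, norm_cpow_ofReal_exponent (sector_ne_zero hs), Complex.norm_I,
    mul_one, mul_assoc (2 ^ ρ * B), ← Real.exp_add]
  gcongr
  rw [Complex.norm_exp]
  gcongr
  rw [Complex.re_ofReal_mul]
  nlinarith [re_phase_vertical_le hy]

theorem norm_vertical_integral_le {ρ lam B : ℝ} (hρ : 0 ≤ ρ) (hl : 0 < lam) (hB0 : 0 ≤ B)
    {g : ℂ → ℂ} (hg : ∀ z ∈ sector √3, z.re ≤ 1 → ‖g z‖ ≤ B) :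
    ‖∫ y in (-√3 : ℝ)..√3, (1 + y * Complex.I) ^ (ρ : ℂ) * g (1 + y * Complex.I) * Complex.exp (lam *
      (1 / (1 + y * Complex.I) ^ 2 + 2 * (1 + y * Complex.I))) * Complex.I‖ ≤
        2 ^ ρ * B * Real.exp (3 * lam) * √(Real.pi / (3 / 16 * lam)) := by
  have h3 : (-√3 : ℝ) ≤ √3 := by linarith [Real.sqrt_nonneg 3]
  have hint : MeasureTheory.Integrable fun y : ℝ =>
      2 ^ ρ * B * Real.exp (3 * lam) * Real.exp (-(3 / 16 * lam) * y ^ 2) :=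
    (integrable_exp_neg_mul_sq (by positivity)).const_mul _
  calc _ ≤ ∫ y in (-√3 : ℝ)..√3,
        2 ^ ρ * B * Real.exp (3 * lam) * Real.exp (-(3 / 16 * lam) * y ^ 2) := by
        refine intervalIntegral.norm_integral_le_of_norm_le h3 ?_ hint.intervalIntegrable
        refine Eventually.of_forall fun y hy => ?_
        exact norm_vertical_integrand_le hρ hl.le hg (abs_le.2 ⟨hy.1.le, hy.2⟩)
    _ ≤ ∫ y : ℝ, 2 ^ ρ * B * Real.exp (3 * lam) * Real.exp (-(3 / 16 * lam) * y ^ 2) := by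
        rw [intervalIntegral.integral_of_le h3]
        exact MeasureTheory.setIntegral_le_integral hint
          (Eventually.of_forall fun y => by simp only [Pi.zero_apply]; positivity)
    _ = _ := by rw [MeasureTheory.integral_const_mul, integral_gaussian]

/-- The loop integral with the phase in normal form: saddle point at `z = 1`, large parameter
`lam`. -/
noncomputable def saddleIntegral (ρ : ℝ) (g : ℂ → ℂ) (lam : ℝ) : ℂ :=
  loopIntegral fun z => z ^ (ρ : ℂ) * g z * Complex.exp (lam * (1 / z ^ 2 + 2 * z))

/-- The amplitude enters only through `B`, which matters because the rescaled amplitude changes with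
`n`. -/
theorem norm_saddleIntegral_le {ρ lam B : ℝ} (hρ : 0 ≤ ρ) (hl : 0 < lam) (hB0 : 0 ≤ B)
    {g : ℂ → ℂ} (hg : ∀ z ∈ sector √3, z.re ≤ 1 → ‖g z‖ ≤ B) :
    ‖saddleIntegral ρ g lam‖ ≤ 2 * 2 ^ ρ * B * (Real.exp (3 * lam) / √lam) := by
  have hs3 : |(-√3 : ℝ)| = √3 := by rw [abs_neg, abs_of_nonneg (Real.sqrt_nonneg 3)]
  have h1 := norm_ray_integral_le hρ hl.le hg (u := 1 - √3 * Complex.I) (by simp) (by simp)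
  have h2 := norm_ray_integral_le hρ hl.le hg (u := 1 + √3 * Complex.I) (by simp) (by simp)
  have h3 := norm_vertical_integral_le hρ hl hB0 hg
  have hsl : 0 < √lam := Real.sqrt_pos.2 hl
  have h4 : Real.exp (2 * lam) ≤ Real.exp (3 * lam) / √lam := by
    rw [le_div_iff₀ hsl, show 3 * lam = 2 * lam + lam by ring, Real.exp_add]
    gcongr
    have := Real.add_one_le_exp lam
    nlinarith [Real.sq_sqrt hl.le, sq_nonneg (√lam - 1)]
  have h5 : √(Real.pi / (3 / 16 * lam)) ≤ 5 / √lam := by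
    rw [show Real.pi / (3 / 16 * lam) = (16 * Real.pi / 3) / lam by field_simp,
      Real.sqrt_div (by positivity)]
    gcongr
    rw [Real.sqrt_le_left (by norm_num)]
    nlinarith [Real.pi_lt_d2]
  have hpi : ‖(1 / (2 * Real.pi * Complex.I) : ℂ)‖ = 1 / (2 * Real.pi) := by
    rw [norm_div, norm_mul, norm_mul, Complex.norm_real, Real.norm_of_nonneg Real.pi_pos.le]; simp
  rw [saddleIntegral, loopIntegral, norm_mul, hpi]
  set E := Real.exp (3 * lam) / √lam with hE
  have hE0 : 0 < E := by positivity
  have h3' : 2 ^ ρ * B * Real.exp (3 * lam) * √(Real.pi / (3 / 16 * lam)) ≤ 2 ^ ρ * B * (5 * E) := by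
    calc _ ≤ 2 ^ ρ * B * Real.exp (3 * lam) * (5 / √lam) := by gcongr
      _ = _ := by rw [hE]; ring
  have h1' : 2 ^ ρ * B * Real.exp (2 * lam) * 2 ≤ 2 ^ ρ * B * (2 * E) := by
    calc _ ≤ 2 ^ ρ * B * E * 2 := by gcongr
      _ = _ := by ring
  calc _ ≤ 1 / (2 * Real.pi) * (2 ^ ρ * B * (2 * E) + 2 ^ ρ * B * (5 * E) + 2 ^ ρ * B * (2 * E)) := by
        gcongr
        refine (norm_sub_le _ _).trans (add_le_add ((norm_add_le _ _).trans (add_le_add ?_ ?_)) ?_)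
        · exact h1.trans h1'
        · exact h3.trans h3'
        · exact h2.trans h1'
    _ = 9 / (2 * Real.pi) * (2 ^ ρ * B * E) := by ring
    _ ≤ 2 * (2 ^ ρ * B * E) := by
        gcongr
        rw [div_le_iff₀ (by positivity)]
        nlinarith [Real.pi_gt_three]
    _ = _ := by ring

/-- Laplace's method: under `y = x / √lam` the phase minus its saddle value tends to `-3x²`,
dominated by the Gaussian from `re_phase_vertical_le`. -/
theorem tendsto_vertical_integral {H : ℝ → ℂ} (hH : Continuous H) :
    Tendsto (fun lam : ℝ => (√lam : ℂ) * Complex.exp (-(3 * lam)) * ∫ y in (-√3 : ℝ)..√3,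
      H y * Complex.exp (lam * (1 / (1 + y * Complex.I) ^ 2 + 2 * (1 + y * Complex.I)))) atTop
      (𝓝 (H 0 * √(Real.pi / 3))) := by
  have h33 : (-√3 : ℝ) ≤ √3 := by linarith [Real.sqrt_nonneg 3]
  have hs3 : (0 : ℝ) < √3 := Real.sqrt_pos.2 (by norm_num)
  have hne (y : ℝ) : (1 + y * Complex.I : ℂ) ≠ 0 := fun h => by
    have := congrArg Complex.re h; simp at this
  set F : ℝ → ℝ → ℂ := fun lam => (Set.Ioc (-√3) √3).indicator fun y => H y *
    Complex.exp (lam * (1 / (1 + y * Complex.I) ^ 2 + 2 * (1 + y * Complex.I) - 3))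
  obtain ⟨B, hB⟩ := isCompact_Icc.exists_bound_of_continuousOn (s := Set.Icc (-√3) √3)
    hH.continuousOn
  have hcont (lam : ℝ) : Continuous fun y : ℝ => H y *
      Complex.exp (lam * (1 / (1 + y * Complex.I) ^ 2 + 2 * (1 + y * Complex.I) - 3)) := by
    refine hH.mul (Complex.continuous_exp.comp (continuous_const.mul ?_))
    refine ((continuous_const.div (by fun_prop) fun y => pow_ne_zero 2 (hne y)).add
      (by fun_prop)).sub continuous_const
  have hrw : ∀ᶠ lam : ℝ in atTop, (∫ x : ℝ, F lam (x / √lam)) =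
      (√lam : ℂ) * Complex.exp (-(3 * lam)) * ∫ y in (-√3 : ℝ)..√3,
      H y * Complex.exp (lam * (1 / (1 + y * Complex.I) ^ 2 + 2 * (1 + y * Complex.I))) := by
    filter_upwards [eventually_gt_atTop 0] with lam hlam
    rw [MeasureTheory.Measure.integral_comp_div (F lam) (√lam), abs_of_nonneg (Real.sqrt_nonneg _),
      MeasureTheory.integral_indicator measurableSet_Ioc, ← intervalIntegral.integral_of_le h33,
      Complex.real_smul, mul_assoc]
    congr 1
    rw [← intervalIntegral.integral_const_mul]
    refine intervalIntegral.integral_congr fun y _ => ?_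
    rw [mul_left_comm, ← Complex.exp_add]
    congr 2; ring
  refine Tendsto.congr' hrw ?_
  have hgauss : ∫ x : ℝ, H 0 * Complex.exp (-(3 : ℝ) * (x : ℂ) ^ 2) = H 0 * √(Real.pi / 3) := by
    have hg : ((∫ x : ℝ, Real.exp (-3 * x ^ 2) : ℝ) : ℂ) = (√(Real.pi / 3) : ℝ) := by
      rw [integral_gaussian]
    have hc := integral_complex_ofReal (μ := MeasureTheory.volume)
      (f := fun x : ℝ => Real.exp (-3 * x ^ 2))
    rw [← hg, ← hc, ← MeasureTheory.integral_const_mul]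
    push_cast; rfl
  rw [← hgauss]
  refine MeasureTheory.tendsto_integral_filter_of_dominated_convergence (G := ℂ)
    (fun x => B * Real.exp (-(3 / 16) * x ^ 2)) ?_ ?_
    ((integrable_exp_neg_mul_sq (by norm_num)).const_mul _) ?_
  · refine Eventually.of_forall fun lam => ?_
    refine MeasureTheory.StronglyMeasurable.aestronglyMeasurable ?_
    exact ((hcont lam).stronglyMeasurable.indicator measurableSet_Ioc).comp_measurable (by fun_prop)
  · filter_upwards [eventually_gt_atTop 0] with lam hlam
    refine Eventually.of_forall fun x => ?_
    have hsl : 0 < √lam := Real.sqrt_pos.2 hlam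
    simp only [F]
    by_cases hx : x / √lam ∈ Set.Ioc (-√3) √3
    · rw [Set.indicator_of_mem hx, norm_mul, Complex.norm_exp]
      have h1 := hB _ ⟨hx.1.le, hx.2⟩
      have hB0 := (norm_nonneg _).trans h1
      gcongr
      rw [Complex.re_ofReal_mul, Complex.sub_re]
      have h2 := re_phase_vertical_le (abs_le.2 ⟨hx.1.le, hx.2⟩)
      have h3 : lam * (x / √lam) ^ 2 = x ^ 2 := by
        rw [div_pow, Real.sq_sqrt hlam.le]; field_simp
      have h4 : ((3 : ℂ)).re = 3 := rfl
      rw [h4]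
      nlinarith
    · rw [Set.indicator_of_notMem hx, norm_zero]
      have hB0 := (norm_nonneg _).trans (hB 0 ⟨by linarith, hs3.le⟩)
      positivity
  · refine Eventually.of_forall fun x => ?_
    have hlim : Tendsto (fun lam : ℝ => x / √lam) atTop (𝓝 0) :=
      tendsto_const_nhds.div_atTop Real.tendsto_sqrt_atTop
    -- With `v = iy`, `1/(1+v)² + 2(1+v) - 3 = v² (3+2v) / (1+v)²`. As `lam y² = x²`, the parameter
    -- drops out and the limit is continuity of `r` at `0`.
    set r : ℝ → ℂ := fun y => H y * Complex.exp (-(x : ℂ) ^ 2 *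
      ((3 + 2 * y * Complex.I) / (1 + y * Complex.I) ^ 2))
    have hr : Continuous r := by
      refine hH.mul (Complex.continuous_exp.comp (continuous_const.mul ?_))
      exact Continuous.div (by fun_prop) (by fun_prop) fun y => pow_ne_zero 2 (hne y)
    have h0 := (hr.tendsto 0).comp hlim
    have er : r 0 = H 0 * Complex.exp (-(3 : ℝ) * (x : ℂ) ^ 2) := by
      simp only [r]; congr 2; push_cast; ring
    rw [er] at h0
    refine h0.congr' ?_
    have hmem := hlim.eventually (Ioc_mem_nhds (show -√3 < 0 by linarith) hs3)
    filter_upwards [hmem, eventually_gt_atTop 0] with lam hx hlam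
    simp only [F, Function.comp, r]
    rw [Set.indicator_of_mem (show x / √lam ∈ Set.Ioc (-√3) √3 from hx)]
    congr 2
    have h3 : (lam : ℂ) * ((x / √lam : ℝ) : ℂ) ^ 2 = (x : ℂ) ^ 2 := by
      have : lam * (x / √lam) ^ 2 = x ^ 2 := by
        rw [div_pow, Real.sq_sqrt hlam.le]; field_simp
      exact_mod_cast this
    rw [← h3]
    have hy := hne (x / √lam)
    generalize ((x / √lam : ℝ) : ℂ) = y at *
    have h4 : -((lam : ℂ) * y ^ 2) = lam * (y * Complex.I) ^ 2 := by rw [mul_pow, Complex.I_sq]; ring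
    rw [h4, mul_assoc 2 y]
    generalize y * Complex.I = v at *
    field_simp
    ring

/-- Only the saddle counts, and `z ^ ρ * z ^ m` equals `1` there. The limit is nonzero, which yields
lower bounds. -/
theorem tendsto_saddleIntegral_pow {ρ : ℝ} (hρ : 0 ≤ ρ) (m : ℕ) :
    Tendsto (fun lam : ℝ => (√lam : ℂ) * Complex.exp (-(3 * lam)) *
      saddleIntegral ρ (fun z => z ^ m) lam) atTop (𝓝 (1 / (2 * Real.pi) * √(Real.pi / 3))) := by
  have hg : ∀ z ∈ sector √3, z.re ≤ 1 → ‖z ^ m‖ ≤ (2 : ℝ) ^ m := fun z hz h1 => by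
    rw [norm_pow]
    exact pow_le_pow_left₀ (norm_nonneg _) (norm_le_two_of_mem hz h1) m
  have hslit (y : ℝ) : (1 + y * Complex.I : ℂ) ∈ Complex.slitPlane := by left; simp
  have hray (u : ℂ) (hu1 : u.re = 1) (hu2 : |u.im| = √3) :
      Tendsto (fun lam : ℝ => (√lam : ℂ) * Complex.exp (-(3 * lam)) *
        ∫ t in (0 : ℝ)..1, (t * u) ^ (ρ : ℂ) * (t * u) ^ m *
          Complex.exp (lam * (1 / (t * u) ^ 2 + 2 * (t * u))) * u) atTop (𝓝 0) := by
    have h1 := (Real.tendsto_pow_mul_exp_neg_atTop_nhds_zero 1).const_mul ((2 : ℝ) ^ ρ * 2 ^ m * 2)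
    rw [mul_zero] at h1
    refine squeeze_zero_norm' ?_ h1
    filter_upwards [eventually_ge_atTop 1] with lam hlam
    have h2 := norm_ray_integral_le hρ (by linarith : 0 ≤ lam) hg hu1 hu2
    have h3 : √lam ≤ lam := Real.sqrt_le_left (by linarith) |>.2 (by nlinarith)
    have h4 : ‖Complex.exp (-(3 * lam))‖ = Real.exp (-(3 * lam)) := by
      rw [Complex.norm_exp]; simp
    rw [norm_mul, norm_mul, h4, Complex.norm_real, Real.norm_of_nonneg (Real.sqrt_nonneg _)]
    calc _ ≤ lam * Real.exp (-(3 * lam)) * (2 ^ ρ * 2 ^ m * Real.exp (2 * lam) * 2) := by gcongr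
      _ = 2 ^ ρ * 2 ^ m * 2 * (lam * (Real.exp (-(3 * lam)) * Real.exp (2 * lam))) := by ring
      _ = _ := by rw [← Real.exp_add, pow_one]; ring_nf
  have hv := tendsto_vertical_integral
    (H := fun y : ℝ => (1 + y * Complex.I) ^ (ρ : ℂ) * (1 + y * Complex.I) ^ m * Complex.I) (by
      refine Continuous.mul (Continuous.mul ?_ (by fun_prop)) continuous_const
      exact Continuous.cpow (by fun_prop) continuous_const fun y => hslit y)
  have hall := ((hray (1 - √3 * Complex.I) (by simp) (by simp)).add hv).sub
    (hray (1 + √3 * Complex.I) (by simp) (by simp))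
  have hfin := hall.const_mul (1 / (2 * Real.pi * Complex.I))
  have hpi : (Real.pi : ℂ) ≠ 0 := by exact_mod_cast Real.pi_ne_zero
  have elim : 1 / (2 * Real.pi * Complex.I) * (0 + ((fun y : ℝ => (1 + y * Complex.I) ^ (ρ : ℂ) *
      (1 + y * Complex.I) ^ m * Complex.I) 0) * (√(Real.pi / 3) : ℂ) - 0) =
      1 / (2 * Real.pi) * √(Real.pi / 3) := by
    simp
    field_simp
    rw [Complex.I_sq]; norm_num
  rw [elim] at hfin
  refine hfin.congr fun lam => ?_
  rw [saddleIntegral, loopIntegral]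
  have : ∀ y : ℝ, (1 + y * Complex.I) ^ (ρ : ℂ) * (1 + y * Complex.I) ^ m *
      Complex.exp (lam * (1 / (1 + y * Complex.I) ^ 2 + 2 * (1 + y * Complex.I))) * Complex.I =
      (1 + y * Complex.I) ^ (ρ : ℂ) * (1 + y * Complex.I) ^ m * Complex.I *
      Complex.exp (lam * (1 / (1 + y * Complex.I) ^ 2 + 2 * (1 + y * Complex.I))) :=
    fun y => by ring
  simp_rw [this]
  ring

/-! ### Generalized Almkvist integrals and their asymptotics -/

theorem ofReal_mul_cpow {R : ℝ} (hR : 0 < R) {z : ℂ} (hz : z ≠ 0) (ρ : ℝ) :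
    (R * z : ℂ) ^ (ρ : ℂ) = (R ^ ρ : ℝ) * z ^ (ρ : ℂ) := by
  have hR' : (R : ℂ) ≠ 0 := by exact_mod_cast hR.ne'
  rw [Complex.ofReal_cpow hR.le, Complex.cpow_def_of_ne_zero (mul_ne_zero hR' hz),
    Complex.cpow_def_of_ne_zero hR', Complex.cpow_def_of_ne_zero hz, Complex.log_ofReal_mul hR hz,
    Complex.ofReal_log hR.le, ← Complex.exp_add]
  ring_nf

theorem ne_zero_of_re_pos {z : ℂ} (hz : 0 < z.re) : z ≠ 0 := fun h => by simp [h] at hz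

/-- A function that is `O(z ^ m)` at the vertex of the sector satisfies such a bound on the whole
truncated sector. -/
theorem exists_bound_sector {G : ℂ → ℂ} (hG : ContinuousOn G {z | 0 < z.re}) {m : ℕ}
    (hO : G =O[𝓝[sector √3] 0] fun z => z ^ m) :
    ∃ B, 0 ≤ B ∧ ∀ z ∈ sector √3, z.re ≤ 1 → ‖G z‖ ≤ B * ‖z‖ ^ m := by
  obtain ⟨C, hC⟩ := hO.bound
  rw [eventually_nhdsWithin_iff, Metric.eventually_nhds_iff] at hC
  obtain ⟨δ, hδ, hC⟩ := hC
  -- Outside a neighbourhood of the vertex the truncated sector is covered by a compact subset of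
  -- the open half-plane.
  set K : Set ℂ := Metric.closedBall 0 2 ∩ ({z | |z.im| ≤ √3 * z.re} ∩ {z | δ ≤ ‖z‖})
  have hK : IsCompact K := (isCompact_closedBall 0 2).inter_right
    ((isClosed_le (by fun_prop) (by fun_prop)).inter (isClosed_le (by fun_prop) (by fun_prop)))
  have hKre : K ⊆ {z | 0 < z.re} := fun z hz => by
    obtain ⟨_, h1, h2⟩ := hz
    have h1' : |z.im| ≤ √3 * z.re := h1
    have h2' : δ ≤ ‖z‖ := h2
    by_contra hre
    have hre' : z.re ≤ 0 := not_lt.1 hre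
    have h3 : (0 : ℝ) < √3 := Real.sqrt_pos.2 (by norm_num)
    have h4 : √3 * z.re ≤ 0 := mul_nonpos_of_nonneg_of_nonpos h3.le hre'
    have h5 : |z.im| = 0 := le_antisymm (h1'.trans h4) (abs_nonneg _)
    have h6 : z.re = 0 := by
      rw [h5] at h1'
      exact le_antisymm hre' (by nlinarith)
    have : z = 0 := Complex.ext h6 (abs_eq_zero.1 h5)
    rw [this, norm_zero] at h2'
    linarith
  obtain ⟨B, hB⟩ := hK.exists_bound_of_continuousOn (hG.mono hKre)
  refine ⟨|C| + |B| / δ ^ m, by positivity, fun z hz h1 => ?_⟩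
  rcases lt_or_ge ‖z‖ δ with h | h
  · have := hC (by simpa using h) hz
    rw [norm_pow] at this
    calc _ ≤ C * ‖z‖ ^ m := this
      _ ≤ _ := by
        gcongr
        exact (le_abs_self C).trans (le_add_of_nonneg_right (by positivity))
  · have := hB z ⟨by simpa using norm_le_two_of_mem hz h1, hz.2, h⟩
    have h2 : δ ^ m ≤ ‖z‖ ^ m := pow_le_pow_left₀ hδ.le h m
    calc _ ≤ |B| / δ ^ m * δ ^ m := by
          rw [div_mul_cancel₀ _ (by positivity)]; exact this.trans (le_abs_self B)
      _ ≤ |B| / δ ^ m * ‖z‖ ^ m := by gcongr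
      _ ≤ _ := by
        gcongr
        exact le_add_of_nonneg_left (abs_nonneg C)

/-- `z ^ ρ G(z) exp (c / z² + x z)`. -/
noncomputable def almkvistIntegrand (ρ c x : ℝ) (G : ℂ → ℂ) (z : ℂ) : ℂ :=
  z ^ (ρ : ℂ) * G z * Complex.exp (c / z ^ 2 + x * z)

/-- The Almkvist integral with an amplitude `G`. -/
noncomputable def almkvistIntegral (ρ c x : ℝ) (G : ℂ → ℂ) : ℂ :=
  loopIntegral (almkvistIntegrand ρ c x G)

theorem differentiableOn_almkvistIntegrand (ρ c x : ℝ) {G : ℂ → ℂ}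
    (hG : DifferentiableOn ℂ G {z | 0 < z.re}) :
    DifferentiableOn ℂ (almkvistIntegrand ρ c x G) {z | 0 < z.re} := by
  intro z hz
  have hz0 : z ≠ 0 := ne_zero_of_re_pos hz
  have hpow : DifferentiableAt ℂ (fun z : ℂ => z ^ (ρ : ℂ)) z :=
    differentiableAt_id.cpow_const (Or.inl hz)
  have hexp : DifferentiableAt ℂ (fun z : ℂ => Complex.exp (c / z ^ 2 + x * z)) z := by
    have hd : DifferentiableAt ℂ (fun z : ℂ => (c : ℂ) / z ^ 2) z :=
      DifferentiableAt.fun_div (by fun_prop) (by fun_prop) (pow_ne_zero 2 hz0)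
    fun_prop
  exact (hpow.differentiableWithinAt.mul (hG z hz)).mul hexp.differentiableWithinAt

theorem loopIntegrable_almkvistIntegrand {ρ c : ℝ} (hρ : 0 ≤ ρ) (hc : 0 ≤ c) (x : ℝ) {G : ℂ → ℂ}
    (hG : DifferentiableOn ℂ G {z | 0 < z.re}) {m : ℕ}
    (hO : G =O[𝓝[sector √3] 0] fun z => z ^ m) : LoopIntegrable (almkvistIntegrand ρ c x G) := by
  obtain ⟨B, hB0, hB⟩ := exists_bound_sector hG.continuousOn hO
  refine LoopIntegrable.of_bound (B := 2 ^ ρ * (B * 2 ^ m) * Real.exp |x|)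
    (differentiableOn_almkvistIntegrand ρ c x hG).continuousOn fun z hz h1 hr => ?_
  have hs : z ∈ sector √3 := ⟨hz, hr.le⟩
  have h2 := norm_le_two_of_mem hs h1
  rw [almkvistIntegrand, norm_mul, norm_mul, norm_cpow_ofReal_exponent (ne_zero_of_re_pos hz)]
  gcongr
  · exact (hB z hs h1).trans (by gcongr)
  · rw [Complex.norm_exp]
    gcongr
    have e : (c / z ^ 2 + x * z : ℂ) = c * (1 / z ^ 2) + x * z := by ring
    rw [e, Complex.add_re, Complex.re_ofReal_mul, Complex.re_ofReal_mul]
    have h3 := mul_nonneg hc (neg_nonneg.2 (re_one_div_sq_nonpos hr))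
    have h4 : x * z.re ≤ |x| * 1 := mul_le_mul (le_abs_self x) h1 hz.le (abs_nonneg x)
    linarith

theorem almkvistIntegral_rescale {ρ c : ℝ} (hρ : 0 ≤ ρ) (hc : 0 ≤ c) (x : ℝ) {G : ℂ → ℂ}
    (hG : DifferentiableOn ℂ G {z | 0 < z.re}) {m : ℕ}
    (hO : G =O[𝓝[sector √3] 0] fun z => z ^ m) {R : ℝ} (hR : 0 < R) :
    almkvistIntegral ρ c x G = (R ^ (1 + ρ) : ℝ) *
      almkvistIntegral ρ (c / R ^ 2) (x * R) fun z => G (R * z) := by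
  have hR' : (R : ℂ) ≠ 0 := by exact_mod_cast hR.ne'
  rw [almkvistIntegral, ← loopIntegral_comp_mul (differentiableOn_almkvistIntegrand ρ c x hG)
    (loopIntegrable_almkvistIntegrand hρ hc x hG hO) hR, almkvistIntegral, ← loopIntegral_const_mul]
  refine loopIntegral_congr fun z hz => ?_
  have hz0 := ne_zero_of_re_pos hz
  have e : (c / (R * z) ^ 2 + x * (R * z) : ℂ) = ((c / R ^ 2 : ℝ) : ℂ) / z ^ 2 + ((x * R : ℝ) : ℂ) * z := by
    push_cast; field_simp
  rw [almkvistIntegrand, almkvistIntegrand, ofReal_mul_cpow hR hz0, e, Real.rpow_add hR,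
    Real.rpow_one]
  push_cast
  ring

theorem almkvistIntegral_eq_saddleIntegral (ρ lam : ℝ) (G : ℂ → ℂ) :
    almkvistIntegral ρ lam (2 * lam) G = saddleIntegral ρ G lam := by
  rw [almkvistIntegral, saddleIntegral]
  congr 1
  funext z
  rw [almkvistIntegrand]
  congr 2
  push_cast; ring

theorem isBigO_pow_self (m : ℕ) (l : Filter ℂ) :
    (fun z : ℂ => z ^ m) =O[l] fun z => z ^ m := isBigO_refl _ _

theorem differentiableOn_pow_re_pos (m : ℕ) :
    DifferentiableOn ℂ (fun z : ℂ => z ^ m) {z | 0 < z.re} := by fun_prop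

/-- The location of the saddle point of `c / z² + n z`. -/
noncomputable def saddlePoint (c : ℝ) (n : ℕ) : ℝ := (2 * c / n) ^ ((1 : ℝ) / 3)

theorem saddlePoint_pos {c : ℝ} (hc : 0 < c) {n : ℕ} (hn : 0 < n) : 0 < saddlePoint c n := by
  have : (0 : ℝ) < n := by exact_mod_cast hn
  exact Real.rpow_pos_of_pos (by positivity) _

/-- The critical point equation; it makes the two rescaled coefficients of the phase stand in the
ratio `1 : 2`. -/
theorem mul_saddlePoint {c : ℝ} (hc : 0 < c) {n : ℕ} (hn : 0 < n) :
    n * saddlePoint c n = 2 * (c / saddlePoint c n ^ 2) := by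
  have h := saddlePoint_pos hc hn
  have hn' : (0 : ℝ) < n := by exact_mod_cast hn
  have h3 : saddlePoint c n ^ 3 = 2 * c / n := by
    rw [saddlePoint, ← Real.rpow_natCast, ← Real.rpow_mul (by positivity)]
    norm_num
  field_simp
  field_simp at h3
  linarith

theorem tendsto_saddlePoint (c : ℝ) : Tendsto (saddlePoint c) atTop (𝓝 0) := by
  have h1 : Tendsto (fun n : ℕ => 2 * c / (n : ℝ)) atTop (𝓝 0) :=
    tendsto_const_nhds.div_atTop tendsto_natCast_atTop_atTop
  have h2 := h1.rpow_const (p := (1 : ℝ) / 3) (Or.inr (by norm_num))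
  rwa [Real.zero_rpow (by norm_num)] at h2

/-- The value of the large parameter at the saddle point. -/
noncomputable def saddleHeight (c : ℝ) (n : ℕ) : ℝ := c / saddlePoint c n ^ 2

theorem saddleHeight_pos {c : ℝ} (hc : 0 < c) {n : ℕ} (hn : 0 < n) : 0 < saddleHeight c n := by
  have := saddlePoint_pos hc hn
  unfold saddleHeight; positivity

theorem tendsto_saddleHeight {c : ℝ} (hc : 0 < c) : Tendsto (saddleHeight c) atTop atTop := by
  have h1 : Tendsto (fun n => saddlePoint c n ^ 2) atTop (𝓝[>] 0) := by
    refine tendsto_nhdsWithin_iff.2 ⟨by simpa using (tendsto_saddlePoint c).pow 2, ?_⟩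
    filter_upwards [eventually_gt_atTop 0] with n hn
    exact pow_pos (saddlePoint_pos hc hn) 2
  exact (h1.inv_tendsto_nhdsGT_zero).const_mul_atTop hc

/-- The order of magnitude of the Almkvist integral with amplitude `z ^ m`. -/
noncomputable def saddleScale (ρ c : ℝ) (m n : ℕ) : ℝ :=
  saddlePoint c n ^ (1 + ρ) * saddlePoint c n ^ m *
    (Real.exp (3 * saddleHeight c n) / √(saddleHeight c n))

theorem almkvistIntegral_eq_saddlePoint_mul {ρ c : ℝ} (hρ : 0 ≤ ρ) (hc : 0 < c) {G : ℂ → ℂ}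
    (hG : DifferentiableOn ℂ G {z | 0 < z.re}) {m : ℕ}
    (hO : G =O[𝓝[sector √3] 0] fun z => z ^ m) {n : ℕ} (hn : 0 < n) :
    almkvistIntegral ρ c n G = (saddlePoint c n ^ (1 + ρ) : ℝ) *
      saddleIntegral ρ (fun z => G (saddlePoint c n * z)) (saddleHeight c n) := by
  rw [almkvistIntegral_rescale hρ hc.le n hG hO (saddlePoint_pos hc hn), mul_saddlePoint hc hn,
    ← almkvistIntegral_eq_saddleIntegral, saddleHeight]

/-- Once the saddle point `R` is at most `1`, the rescaled amplitude `G (R z)` is `O(R^m)` uniformly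
on the truncated sector. -/
theorem almkvistIntegral_isBigO {ρ c : ℝ} (hρ : 0 ≤ ρ) (hc : 0 < c) {G : ℂ → ℂ}
    (hG : DifferentiableOn ℂ G {z | 0 < z.re}) {m : ℕ}
    (hO : G =O[𝓝[sector √3] 0] fun z => z ^ m) :
    (fun n : ℕ => almkvistIntegral ρ c n G) =O[atTop] saddleScale ρ c m := by
  obtain ⟨B, hB0, hB⟩ := exists_bound_sector hG.continuousOn hO
  refine IsBigO.of_bound (2 * 2 ^ ρ * (B * 2 ^ m)) ?_
  filter_upwards [eventually_gt_atTop 0,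
    (tendsto_saddlePoint c).eventually (eventually_le_nhds zero_lt_one)] with n hn hR1
  have hR := saddlePoint_pos hc hn
  have hl := saddleHeight_pos hc hn
  rw [almkvistIntegral_eq_saddlePoint_mul hρ hc hG hO hn, norm_mul, Complex.norm_real,
    Real.norm_of_nonneg (by positivity), saddleScale, Real.norm_of_nonneg (by positivity)]
  have h := norm_saddleIntegral_le hρ hl (B := B * 2 ^ m * saddlePoint c n ^ m) (by positivity)
    (g := fun z => G (saddlePoint c n * z)) fun z hz h1 => by
      have hre : (saddlePoint c n * z : ℂ).re = saddlePoint c n * z.re := Complex.re_ofReal_mul _ _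
      have him : (saddlePoint c n * z : ℂ).im = saddlePoint c n * z.im := Complex.im_ofReal_mul _ _
      have hz0 : 0 < z.re := hz.1
      have hmem : (saddlePoint c n * z : ℂ) ∈ sector √3 := by
        refine ⟨by rw [hre]; positivity, ?_⟩
        rw [hre, him, abs_mul, abs_of_pos hR]
        nlinarith [mul_le_mul_of_nonneg_left hz.2 hR.le]
      refine (hB _ hmem (by rw [hre]; exact mul_le_one₀ hR1 hz0.le h1)).trans ?_
      rw [norm_mul, Complex.norm_real, Real.norm_of_nonneg hR.le, mul_pow]
      have := pow_le_pow_left₀ (norm_nonneg z) (norm_le_two_of_mem hz h1) m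
      calc _ ≤ B * (saddlePoint c n ^ m * 2 ^ m) := by gcongr
        _ = _ := by ring
  calc _ ≤ saddlePoint c n ^ (1 + ρ) * (2 * 2 ^ ρ * (B * 2 ^ m * saddlePoint c n ^ m) *
        (Real.exp (3 * saddleHeight c n) / √(saddleHeight c n))) := by gcongr
    _ = _ := by ring

/-- The nonzero Laplace limit shows that pure powers attain the scale, so abstract upper bounds
become bounds by derivatives of the Almkvist function. -/
theorem saddleScale_isBigO {ρ c : ℝ} (hρ : 0 ≤ ρ) (hc : 0 < c) (m : ℕ) :
    saddleScale ρ c m =O[atTop] fun n : ℕ => almkvistIntegral ρ c n fun z => z ^ m := by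
  have hlim := (tendsto_saddleIntegral_pow hρ m).comp (tendsto_saddleHeight hc)
  have hL : (1 / (2 * Real.pi) * √(Real.pi / 3) : ℂ) ≠ 0 := by
    have h1 : (0 : ℝ) < 1 / (2 * Real.pi) * √(Real.pi / 3) := by
      have := Real.pi_pos
      positivity
    exact_mod_cast h1.ne'
  have h1 := hlim.norm.eventually (eventually_ge_nhds (half_lt_self (norm_pos_iff.2 hL)))
  set L := ‖(1 / (2 * Real.pi) * √(Real.pi / 3) : ℂ)‖
  have hL0 : 0 < L := norm_pos_iff.2 hL
  refine IsBigO.of_bound (2 / L) ?_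
  filter_upwards [eventually_gt_atTop 0, h1] with n hn h
  have hR := saddlePoint_pos hc hn
  have hl := saddleHeight_pos hc hn
  have e : almkvistIntegral ρ c n (fun z => z ^ m) = (saddlePoint c n ^ (1 + ρ) : ℝ) *
      ((saddlePoint c n : ℂ) ^ m * saddleIntegral ρ (fun z => z ^ m) (saddleHeight c n)) := by
    rw [almkvistIntegral_eq_saddlePoint_mul hρ hc (differentiableOn_pow_re_pos m)
      (isBigO_pow_self m _) hn, saddleIntegral, saddleIntegral,
      ← loopIntegral_const_mul ((saddlePoint c n : ℂ) ^ m)]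
    congr 2
    funext z
    ring
  have hexp : ‖Complex.exp (-(3 * saddleHeight c n))‖ = (Real.exp (3 * saddleHeight c n))⁻¹ := by
    rw [Complex.norm_exp, ← Real.exp_neg]; simp
  simp only [Function.comp, norm_mul, hexp, Complex.norm_real,
    Real.norm_of_nonneg (Real.sqrt_nonneg _)] at h
  rw [e, norm_mul, norm_mul, norm_pow, Complex.norm_real, Complex.norm_real,
    Real.norm_of_nonneg (by positivity : 0 ≤ saddlePoint c n ^ (1 + ρ)), Real.norm_of_nonneg hR.le,
    saddleScale, Real.norm_of_nonneg (by positivity)]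
  have hs : 0 < √(saddleHeight c n) := Real.sqrt_pos.2 hl
  have hE := Real.exp_pos (3 * saddleHeight c n)
  have h2 : Real.exp (3 * saddleHeight c n) / √(saddleHeight c n) ≤
      2 / L * ‖saddleIntegral ρ (fun z => z ^ m) (saddleHeight c n)‖ := by
    rw [div_le_iff₀ hs, div_mul_eq_mul_div, div_mul_eq_mul_div, le_div_iff₀ hL0]
    have h3 := mul_le_mul_of_nonneg_left h hE.le
    have h4 : Real.exp (3 * saddleHeight c n) * (√(saddleHeight c n) *
        (Real.exp (3 * saddleHeight c n))⁻¹ *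
        ‖saddleIntegral ρ (fun z => z ^ m) (saddleHeight c n)‖) =
        √(saddleHeight c n) * ‖saddleIntegral ρ (fun z => z ^ m) (saddleHeight c n)‖ := by
      field_simp
    rw [h4] at h3
    linarith
  calc _ ≤ saddlePoint c n ^ (1 + ρ) * saddlePoint c n ^ m *
        (2 / L * ‖saddleIntegral ρ (fun z => z ^ m) (saddleHeight c n)‖) := by gcongr
    _ = _ := by ring

theorem almkvistIntegral_pow_succ_isLittleO {ρ c : ℝ} (hρ : 0 ≤ ρ) (hc : 0 < c) (m : ℕ) :
    (fun n : ℕ => almkvistIntegral ρ c n fun z => z ^ (m + 1)) =o[atTop]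
      fun n : ℕ => almkvistIntegral ρ c n fun z => z ^ m := by
  have h1 := almkvistIntegral_isBigO hρ hc (differentiableOn_pow_re_pos (m + 1))
    (isBigO_pow_self (m + 1) _)
  have h2 := saddleScale_isBigO hρ hc m
  have h3 : saddleScale ρ c (m + 1) =o[atTop] saddleScale ρ c m := by
    have h0 : (fun n => saddlePoint c n) =o[atTop] fun _ => (1 : ℝ) :=
      (isLittleO_one_iff ℝ).2 (tendsto_saddlePoint c)
    have := h0.mul_isBigO (isBigO_refl (saddleScale ρ c m) atTop)
    refine this.congr (fun n => ?_) fun n => one_mul _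
    rw [saddleScale, saddleScale]; ring
  exact (h1.trans_isLittleO h3).trans_isBigO h2

/-! ### The contribution of a root of unity -/

theorem zetaThree_pos : 0 < zetaThree := by
  have h := zeta_nat_eq_tsum_of_gt_one (k := 3) (by norm_num)
  have hs : Summable fun n : ℕ => 1 / (n : ℝ) ^ 3 := Real.summable_one_div_nat_pow.2 (by norm_num)
  have h2 : riemannZeta 3 = ((∑' n : ℕ, 1 / (n : ℝ) ^ 3 : ℝ) : ℂ) := by
    push_cast at h ⊢
    exact h
  rw [zetaThree, h2, Complex.ofReal_re]
  exact hs.tsum_pos (fun n => by positivity) 1 (by norm_num)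

theorem zetaThree_div_pos {k : ℕ} (hk : 0 < k) : 0 < zetaThree / (k : ℝ) ^ 3 := by
  have : (0 : ℝ) < k := by exact_mod_cast hk
  have := zetaThree_pos
  positivity

theorem natCast_div_twelve_nonneg (k : ℕ) : (0 : ℝ) ≤ (k : ℝ) / 12 := by positivity

theorem differentiableOn_exp_VFun (h : ℕ) {k : ℕ} (hk : 0 < k) :
    DifferentiableOn ℂ (fun z => Complex.exp (VFun h k z)) {z | 0 < z.re} := fun _ hz =>
  (differentiableAt_VFun h k hk hz).cexp.differentiableWithinAt

theorem iteratedDeriv_almkvistIntegral {ρ : ℝ} (hρ : 0 ≤ ρ) (α : ℝ) (m : ℕ) (x : ℝ) :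
    iteratedDeriv m (fun x : ℝ => almkvistIntegral ρ 1 (α * x) fun _ => 1) x =
      α ^ m * almkvistIntegral ρ 1 (α * x) fun z => z ^ m := by
  induction m generalizing x with
  | zero => simp
  | succ m ih =>
    rw [iteratedDeriv_succ, funext ih]
    have hint := loopIntegrable_almkvistIntegrand hρ zero_le_one 0 (differentiableOn_pow_re_pos m)
      (isBigO_pow_self m _)
    have hd := (hasDerivAt_loopIntegral hint α x).const_mul ((α : ℂ) ^ m)
    have e (x : ℝ) : almkvistIntegral ρ 1 (α * x) (fun z => z ^ m) = loopIntegral fun z =>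
        almkvistIntegrand ρ 1 0 (fun z => z ^ m) z * Complex.exp (x * (α * z)) := by
      refine loopIntegral_congr fun z _ => ?_
      rw [almkvistIntegrand, almkvistIntegrand, mul_assoc _ (Complex.exp _) (Complex.exp _),
        ← Complex.exp_add]
      congr 2
      push_cast; ring
    simp only [e]
    rw [hd.deriv, almkvistIntegral, loopIntegral_const_mul, ← mul_assoc, ← pow_succ]
    congr 1
    refine loopIntegral_congr fun z _ => ?_
    rw [almkvistIntegrand, almkvistIntegrand, mul_assoc z, mul_assoc _ (Complex.exp _) (Complex.exp _),
      ← Complex.exp_add]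
    have e2 : ((1 : ℝ) : ℂ) / z ^ 2 + ((0 : ℝ) : ℂ) * z + x * (α * z) =
        ((1 : ℝ) : ℂ) / z ^ 2 + ((α * x : ℝ) : ℂ) * z := by push_cast; ring
    rw [e2]
    ring

theorem almkvist_eq (x ρ : ℝ) : almkvist x (-ρ) = almkvistIntegral ρ 1 x fun _ => 1 := by
  refine loopIntegral_congr fun z _ => ?_
  simp [almkvistIntegrand]

/-- Rescaling by `R = √c` makes the coefficient of `1/z²` equal to `1`, and `R^m` from the amplitude
is the chain rule factor of the `m`-th derivative. -/
theorem rpow_mul_almkvistDeriv {k : ℕ} (hk : 0 < k) (m n : ℕ) :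
    ((√(zetaThree / (k : ℝ) ^ 3) ^ (1 + (k : ℝ) / 12) : ℝ) : ℂ) * almkvistDeriv k m n =
      almkvistIntegral ((k : ℝ) / 12) (zetaThree / (k : ℝ) ^ 3) n fun z => z ^ m := by
  have hc := zetaThree_div_pos hk
  have hα := Real.sqrt_pos.2 hc
  have hρ := natCast_div_twelve_nonneg k
  rw [almkvistIntegral_rescale hρ hc.le n (differentiableOn_pow_re_pos m) (isBigO_pow_self m _) hα,
    Real.sq_sqrt hc.le, div_self hc.ne', almkvistDeriv]
  simp only [neg_div, almkvist_eq]
  rw [iteratedDeriv_almkvistIntegral hρ, almkvistIntegral, ← loopIntegral_const_mul,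
    almkvistIntegral]
  congr 1
  refine loopIntegral_congr fun z _ => ?_
  simp only [almkvistIntegrand]
  rw [mul_comm (n : ℝ)]
  ring

/-- The constant `e^{-2πi n h/k + k ζ'(-1) + C_{h,k}}`. -/
noncomputable def psiPhase (h k n : ℕ) : ℂ :=
  Complex.exp (-(2 * Real.pi * Complex.I * n * h / k) + k * deriv riemannZeta (-1)
      + (dedekindC h k : ℂ))

theorem norm_psiPhase (h k n : ℕ) : ‖psiPhase h k n‖ = ‖psiPhase h k 0‖ := by
  have e : -(2 * Real.pi * Complex.I * n * h / k : ℂ) =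
      ((-(2 * Real.pi * n * h / k) : ℝ) : ℂ) * Complex.I := by push_cast; ring
  rw [psiPhase, psiPhase, add_assoc, add_assoc, Complex.exp_add, norm_mul, e,
    Complex.norm_exp_ofReal_mul_I, one_mul]
  simp

theorem psiPhase_mod (h : ℕ) {k : ℕ} (hk : 0 < k) (n : ℕ) : psiPhase h k n = psiPhase h k (n % k) := by
  have hk' : (k : ℂ) ≠ 0 := by exact_mod_cast hk.ne'
  rw [psiPhase, psiPhase, Complex.exp_eq_exp_iff_exists_int]
  refine ⟨-(((n / k : ℕ) : ℤ) * (h : ℤ)), ?_⟩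
  have hn : (n : ℂ) = (n % k : ℕ) + k * (n / k : ℕ) := by exact_mod_cast (Nat.mod_add_div n k).symm
  rw [hn]
  generalize n / k = q
  push_cast
  field_simp
  ring

theorem psi_eq (h : ℕ) {k : ℕ} (hk : 0 < k) (n : ℕ) :
    psi h k n = psiPhase h k n * ((k : ℝ) ^ ((k : ℝ) / 12) : ℝ) *
      almkvistIntegral ((k : ℝ) / 12) (zetaThree / (k : ℝ) ^ 3) n
        (fun z => Complex.exp (VFun h k z)) := by
  have hk' : (0 : ℝ) < k := by exact_mod_cast hk
  rw [psi, almkvistIntegral, ← loopIntegral_const_mul, ← loopIntegral_const_mul]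
  refine loopIntegral_congr fun z hz => ?_
  have hp := ofReal_mul_cpow hk' (ne_zero_of_re_pos hz) ((k : ℝ) / 12)
  have e : (z * k) ^ ((k : ℂ) / 12) = (((k : ℝ) ^ ((k : ℝ) / 12) : ℝ) : ℂ) *
      z ^ (((k : ℝ) / 12 : ℝ) : ℂ) := by
    rw [← hp, mul_comm z]
    push_cast; rfl
  rw [e, psiPhase, almkvistIntegrand]
  have e2 : Complex.exp (k * deriv riemannZeta (-1) + (dedekindC h k : ℂ) + VFun h k z
          + (zetaThree : ℂ) / ((k : ℂ) ^ 3 * z ^ 2) + n * z) =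
      Complex.exp (k * deriv riemannZeta (-1)) * Complex.exp (dedekindC h k) *
        Complex.exp (VFun h k z) * Complex.exp (((zetaThree / (k : ℝ) ^ 3 : ℝ) : ℂ) / z ^ 2 +
          ((n : ℝ) : ℂ) * z) := by
    rw [← Complex.exp_add, ← Complex.exp_add, ← Complex.exp_add]
    congr 1
    push_cast
    rw [div_div]
    ring
  have e3 : Complex.exp (-(2 * Real.pi * Complex.I * n * h / k) + k * deriv riemannZeta (-1)
      + (dedekindC h k : ℂ)) = Complex.exp (-(2 * Real.pi * Complex.I * n * h / k)) *
        Complex.exp (k * deriv riemannZeta (-1)) * Complex.exp (dedekindC h k) := by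
    rw [Complex.exp_add, Complex.exp_add]
  rw [e2, e3]
  ring

/-- The powers of `a` and `k` are regrouped so that the prefactor is the one of `psi_eq`; only then
can the series be subtracted inside the loop. -/
theorem psiTerm_eq (h : ℕ) {k : ℕ} (hk : 0 < k) (m n : ℕ) :
    psiTerm h k m n = psiPhase h k n * ((k : ℝ) ^ ((k : ℝ) / 12) : ℝ) *
      (bCoeff h k m * almkvistIntegral ((k : ℝ) / 12) (zetaThree / (k : ℝ) ^ 3) n fun z => z ^ m) := by
  have hk' : (0 : ℝ) < k := by exact_mod_cast hk
  have ha := zetaThree_pos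
  have hc := zetaThree_div_pos hk
  have e : (k : ℝ)⁻¹ * (zetaThree / k) ^ ((1 : ℝ) / 2 + k / 24) =
      (k : ℝ) ^ ((k : ℝ) / 12) * √(zetaThree / (k : ℝ) ^ 3) ^ (1 + (k : ℝ) / 12) := by
    have e1 : zetaThree / (k : ℝ) = zetaThree / (k : ℝ) ^ 3 * (k : ℝ) ^ (2 : ℝ) := by
      rw [Real.rpow_two]; field_simp
    rw [e1, Real.mul_rpow hc.le (by positivity), ← Real.rpow_mul hk'.le, Real.sqrt_eq_rpow,
      ← Real.rpow_mul hc.le, show (2 : ℝ) * (1 / 2 + k / 24) = 1 + k / 12 by ring,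
      Real.rpow_add hk', Real.rpow_one,
      show (1 : ℝ) / 2 * (1 + k / 12) = 1 / 2 + k / 24 by ring]
    field_simp
  rw [← rpow_mul_almkvistDeriv hk, psiTerm, psiPhase]
  have e' := congrArg (fun r : ℝ => (r : ℂ)) e
  simp only [Complex.ofReal_mul, Complex.ofReal_inv, Complex.ofReal_natCast] at e'
  rw [e']
  ring

theorem psi_sub_sum_eq (h : ℕ) {k : ℕ} (hk : 0 < k) (M n : ℕ) :
    psi h k n - ∑ m ∈ Finset.range M, psiTerm h k m n =
      psiPhase h k n * ((k : ℝ) ^ ((k : ℝ) / 12) : ℝ) *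
      almkvistIntegral ((k : ℝ) / 12) (zetaThree / (k : ℝ) ^ 3) n
        (fun z => Complex.exp (VFun h k z) - ∑ m ∈ Finset.range M, bCoeff h k m * z ^ m) := by
  have hc := zetaThree_div_pos hk
  have hρ := natCast_div_twelve_nonneg k
  have h0 : (fun z => Complex.exp (VFun h k z)) =O[𝓝[sector √3] 0] fun z => z ^ 0 := by
    simpa using exp_VFun_sub_sum_isBigO_pow h k hk √3 0
  have hs := (loopIntegral_sub_sum
    (loopIntegrable_almkvistIntegrand hρ hc.le n (differentiableOn_exp_VFun h hk) h0)
    (fun m => (loopIntegrable_almkvistIntegrand hρ hc.le n (differentiableOn_pow_re_pos m)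
      (isBigO_pow_self m _)).const_mul (bCoeff h k m)) M).2
  simp only [loopIntegral_const_mul] at hs
  rw [psi_eq h hk]
  simp only [psiTerm_eq h hk]
  rw [← Finset.mul_sum, ← mul_sub]
  congr 1
  refine hs.symm.trans (loopIntegral_congr fun z _ => ?_)
  simp only [almkvistIntegrand]
  rw [mul_sub, sub_mul, Finset.mul_sum, Finset.sum_mul]
  congr 1
  exact Finset.sum_congr rfl fun m _ => by ring

theorem sqrt_rpow_ne_zero {k : ℕ} (hk : 0 < k) (s : ℝ) :
    ((√(zetaThree / (k : ℝ) ^ 3) ^ s : ℝ) : ℂ) ≠ 0 := by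
  exact_mod_cast (Real.rpow_pos_of_pos (Real.sqrt_pos.2 (zetaThree_div_pos hk)) s).ne'

theorem almkvistIntegral_pow_isTheta {k : ℕ} (hk : 0 < k) (m : ℕ) :
    (fun n : ℕ => almkvistIntegral ((k : ℝ) / 12) (zetaThree / (k : ℝ) ^ 3) n fun z => z ^ m)
      =Θ[atTop] fun n => almkvistDeriv k m n := by
  simp only [← rpow_mul_almkvistDeriv hk]
  exact (isTheta_const_mul_left (sqrt_rpow_ne_zero hk _)).2 isTheta_rfl

theorem almkvistDeriv_succ_isLittleO {k : ℕ} (hk : 0 < k) (m : ℕ) :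
    (fun n : ℕ => almkvistDeriv k (m + 1) n) =o[atTop] fun n : ℕ => almkvistDeriv k m n :=
  ((almkvistIntegral_pow_isTheta hk (m + 1)).2.trans_isLittleO (almkvistIntegral_pow_succ_isLittleO
    (natCast_div_twelve_nonneg k) (zetaThree_div_pos hk) m)).trans_isBigO
    (almkvistIntegral_pow_isTheta hk m).1

theorem psi_sub_sum_isBigO (h : ℕ) {k : ℕ} (hk : 0 < k) (M : ℕ) :
    (fun n : ℕ => psi h k n - ∑ m ∈ Finset.range M, psiTerm h k m n) =O[atTop]
      fun n : ℕ => almkvistDeriv k M n := by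
  simp only [psi_sub_sum_eq h hk]
  have hρ := natCast_div_twelve_nonneg k
  have hc := zetaThree_div_pos hk
  have hdiff : DifferentiableOn ℂ (fun z => Complex.exp (VFun h k z) -
      ∑ m ∈ Finset.range M, bCoeff h k m * z ^ m) {z | 0 < z.re} :=
    (differentiableOn_exp_VFun h hk).sub (by fun_prop)
  have h1 := almkvistIntegral_isBigO hρ hc hdiff (exp_VFun_sub_sum_isBigO_pow h k hk √3 M)
  have h2 := (h1.trans (saddleScale_isBigO hρ hc M)).trans (almkvistIntegral_pow_isTheta hk M).1
  have h3 : (fun n => psiPhase h k n * ((k : ℝ) ^ ((k : ℝ) / 12) : ℝ)) =O[atTop]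
      fun _ : ℕ => (1 : ℝ) := by
    refine IsBigO.of_bound (‖psiPhase h k 0‖ * ‖(((k : ℝ) ^ ((k : ℝ) / 12) : ℝ) : ℂ)‖)
      (Eventually.of_forall fun n => ?_)
    rw [norm_mul, norm_psiPhase h k n]
    simp
  have h4 := h3.mul h2.norm_right
  simp only [one_mul] at h4
  exact h4.of_norm_right

/-! ### Summation over the primitive roots of unity -/

theorem phi_sub_sum_isBigO {k : ℕ} (hk : 0 < k) (M : ℕ) :
    (fun n : ℕ => phi k n - ∑ m ∈ Finset.range M, phiTerm k m n) =O[atTop]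
      fun n : ℕ => almkvistDeriv k M n := by
  have h := IsBigO.sum fun h (_ : h ∈ coprimeResidues k) => psi_sub_sum_isBigO h hk M
  refine h.congr_left fun n => ?_
  simp only [phi, phiTerm]
  rw [Finset.sum_apply, Finset.sum_sub_distrib, Finset.sum_comm]

theorem exists_pos_le_norm_of_ne_zero (S : ℕ → ℂ) (k : ℕ) :
    ∃ δ : ℝ, 0 < δ ∧ ∀ r < k, S r ≠ 0 → δ ≤ ‖S r‖ := by
  induction k with
  | zero => exact ⟨1, one_pos, fun r hr => absurd hr (Nat.not_lt_zero r)⟩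
  | succ k ih =>
    obtain ⟨δ, hδ, h⟩ := ih
    by_cases hS : S k = 0
    · refine ⟨δ, hδ, fun r hr hr0 => h r ?_ hr0⟩
      exact lt_of_le_of_ne (Nat.lt_succ_iff.1 hr) fun e => hr0 (e ▸ hS)
    · refine ⟨min δ ‖S k‖, lt_min hδ (norm_pos_iff.2 hS), fun r hr hr0 => ?_⟩
      rcases (Nat.lt_succ_iff.1 hr).lt_or_eq with hlt | rfl
      · exact (min_le_left _ _).trans (h r hlt hr0)
      · exact min_le_right _ _

/-- Where it does not vanish, `φ_k^{(m)}` is of the same order as the Almkvist function, since the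
quotient is periodic in `n`. -/
theorem almkvistDeriv_isBigO_phiTerm {k : ℕ} (hk : 0 < k) (m : ℕ) :
    (fun n : ℕ => almkvistDeriv k m n) =O[𝓟 {n : ℕ | phiTerm k m n ≠ 0}]
      fun n : ℕ => phiTerm k m n := by
  set S : ℕ → ℂ := fun n => (k : ℂ)⁻¹ * (((zetaThree / k) ^ ((1 : ℝ) / 2 + k / 24) : ℝ) : ℂ) *
    ∑ h ∈ coprimeResidues k, psiPhase h k n * bCoeff h k m
  have hS (n : ℕ) : phiTerm k m n = S n * almkvistDeriv k m n := by
    simp only [phiTerm, S, psiTerm]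
    rw [Finset.mul_sum, Finset.sum_mul]
    refine Finset.sum_congr rfl fun h _ => ?_
    rw [psiPhase]
    ring
  have hper (n : ℕ) : S n = S (n % k) := by
    simp only [S]
    congr 1
    exact Finset.sum_congr rfl fun h _ => by rw [psiPhase_mod h hk n]
  obtain ⟨δ, hδ, hle⟩ := exists_pos_le_norm_of_ne_zero S k
  refine IsBigO.of_bound δ⁻¹ (eventually_principal.2 fun n hn => ?_)
  have hn' : phiTerm k m n ≠ 0 := hn
  rw [hS] at hn' ⊢
  have hSn : S n ≠ 0 := left_ne_zero_of_mul hn'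
  have h1 : δ ≤ ‖S n‖ := by
    rw [hper] at hSn ⊢
    exact hle _ (Nat.mod_lt n hk) hSn
  rw [norm_mul, inv_mul_eq_div, le_div_iff₀ hδ, mul_comm]
  gcongr

/-- For the admitted `n` the skipped terms are zero, so the sum may be extended up to `N` and the
error estimate applied there. -/
theorem phi_sub_sum_isBigO_phiTerm {k : ℕ} (hk : 0 < k) {M N : ℕ} (hMN : M < N) :
    (fun n : ℕ => phi k n - ∑ m ∈ Finset.range (M + 1), phiTerm k m n)
      =O[atTop ⊓ 𝓟 {n : ℕ | phiTerm k N n ≠ 0 ∧ ∀ j : ℕ, M < j → j < N → phiTerm k j n = 0}]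
        (fun n : ℕ => phiTerm k N n) := by
  have h1 := (phi_sub_sum_isBigO hk N).mono (inf_le_left (b := 𝓟 {n : ℕ | phiTerm k N n ≠ 0 ∧
    ∀ j : ℕ, M < j → j < N → phiTerm k j n = 0}))
  have h2 := (almkvistDeriv_isBigO_phiTerm hk N).mono (inf_le_right.trans (principal_mono.2
    fun n (hn : phiTerm k N n ≠ 0 ∧ ∀ j : ℕ, M < j → j < N → phiTerm k j n = 0) => hn.1) :
    atTop ⊓ 𝓟 {n : ℕ | phiTerm k N n ≠ 0 ∧ ∀ j : ℕ, M < j → j < N → phiTerm k j n = 0} ≤ _)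
  refine (h1.trans h2).congr' ?_ EventuallyEq.rfl
  refine (eventually_principal.2 fun n hn => ?_ : ∀ᶠ n in 𝓟 {n : ℕ | phiTerm k N n ≠ 0 ∧
    ∀ j : ℕ, M < j → j < N → phiTerm k j n = 0}, _).filter_mono inf_le_right
  refine congrArg (fun s => phi k n - s) ?_
  refine (Finset.sum_subset (Finset.range_subset_range.2 hMN) fun j hj hj' => ?_).symm
  rw [Finset.mem_range] at hj hj'
  exact hn.2 j (by omega) hj

/-! ### Assembly of the four statements -/

theorem lemma3p3 :
    -- the power series is asymptotic to the exponential, with error `O` of the first omitted term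
    (∀ k h : ℕ, 0 < k → h ∈ coprimeResidues k → ∀ M : ℕ,
      ∃ N : ℕ, M < N ∧ bCoeff h k N ≠ 0 ∧ (∀ j : ℕ, M < j → j < N → bCoeff h k j = 0) ∧
        ∀ κ : ℝ,
          (fun z : ℂ => Complex.exp (VFun h k z)
              - ∑ m ∈ Finset.range (M + 1), bCoeff h k m * z ^ m)
            =O[𝓝[sector κ] 0] fun z : ℂ => bCoeff h k N * z ^ N) ∧
    -- the power series diverges away from the origin
    (∀ k h : ℕ, 0 < k → h ∈ coprimeResidues k → ∀ z : ℂ, z ≠ 0 →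
      ¬ Summable fun m : ℕ => bCoeff h k m * z ^ m) ∧
    -- factorial growth of the coefficients
    (∃ c C : ℝ, 0 < c ∧ 0 < C ∧ ∀ k h : ℕ, 0 < k → h ∈ coprimeResidues k →
      ∀ᶠ m : ℕ in atTop,
        ‖bCoeff h k m‖ ≤ C * (((k : ℝ) / (2 * Real.pi)) ^ (2 * m + 1) * (m.factorial : ℝ)) ∧
        (c * (((k : ℝ) / (2 * Real.pi)) ^ (2 * m + 1) * (m.factorial : ℝ)) ≤ ‖bCoeff h k m‖ ∨
          c * (((k : ℝ) / (2 * Real.pi)) ^ (2 * (m + 1) + 1) * ((m + 1).factorial : ℝ))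
            ≤ ‖bCoeff h k (m + 1)‖)) ∧
    -- the series for `φ_k(n)` is asymptotic as `n → ∞`
    (∀ k : ℕ, 0 < k → ∀ M : ℕ,
      (fun n : ℕ => phi k n - ∑ m ∈ Finset.range (M + 1), phiTerm k m n)
          =O[atTop] (fun n : ℕ => almkvistDeriv k (M + 1) n) ∧
      (fun n : ℕ => almkvistDeriv k (M + 1) n) =o[atTop] (fun n : ℕ => almkvistDeriv k M n) ∧
      ∀ N : ℕ, M < N →
        (fun n : ℕ => phi k n - ∑ m ∈ Finset.range (M + 1), phiTerm k m n)
          =O[atTop ⊓ 𝓟 {n : ℕ | phiTerm k N n ≠ 0 ∧ ∀ j : ℕ, M < j → j < N → phiTerm k j n = 0}]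
            (fun n : ℕ => phiTerm k N n)) := by
  refine ⟨fun k h hk hh M => ?_, fun k h hk hh z hz => not_summable_bCoeff hk hh hz,
    ⟨1 / 14, 3, by norm_num, by norm_num, fun k h hk hh => bCoeff_bounds hk hh⟩,
    fun k hk M => ⟨phi_sub_sum_isBigO hk (M + 1), almkvistDeriv_succ_isLittleO hk M,
      fun N hMN => phi_sub_sum_isBigO_phiTerm hk hMN⟩⟩
  obtain ⟨N, hMN, hN, hzero⟩ := exists_next_bCoeff_ne_zero hk hh M
  exact ⟨N, hMN, hN, hzero, exp_VFun_sub_sum_isBigO h k hk hMN hN hzero⟩
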